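/- Let $D\in\mathbb N$, and for each color $c\in\{1,\dots,D\}$ let a parity $|c|\in\{0,1\}$ and a dimension $N_c\in\mathbb N$ be given, with $N_c$ even if $|c|=1$. Let $g^c$ be the Kronecker delta $\delta_{ab}$ on $\{1,\dots,N_c\}$ if $|c|=0$ and the canonical symplectic form $\omega_{ab}$ if $|c|=1$. The tensor components $T^{a_1\dots a_D}$ ($1\le a_c\le N_c$) are commuting variables if $\sum_c|c|$ is even and anticommuting (Grassmann) variables if it is odd, and $g^{\otimes D}(T,T)=\sum_{a,b}T^{a}T^{b}\prod_c g^c_{a_cb_c}$. A $D$-colored graph (bubble) $\mathcal B$ is a set $V(\mathcal B)=\{1,\dots,2k\}$ with one pairing $E^c$ of $V(\mathcal B)$ for each color $c$. After directing the pairs arbitrarily to directed pairings $\vec E^c$, its trace invariant is $$I_{\vec{\mathcal B}}(T)=\sum_{a^1,\dots,a^{2k}}T^{a^1}T^{a^2}\cdots T^{a^{2k}}\prod_{c}\Big(\epsilon(\vec P_{\rm ref},\vec E^c)^{|c|}\prod_{(i,j)\in\vec E^c}g^c_{a^i_ca^j_c}\Big),$$ where each $a^i$ is a multi-index, $\vec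 P_{\rm ref}=\{(1,2),\dots,(2k-1,2k)\}$, and $\epsilon(\vec P,\vec Q)$ is the sign of a permutation that carries the directed pairs of $\vec P$ to those of $\vec Q$. Let $(\mathcal B_i)_{i\in I}$ be any family of connected $D$-colored graphs with $|V(\mathcal B_i)|>2$ (for instance all of them, or one from each isomorphism class), with formal coupling constants $\lambda_i$ and arbitrarily chosen directions, and let $$S[T]=\tfrac12 g^{\otimes D}(T,T)+\sum_{i\in I}\frac{\lambda_i}{|V(\mathcal B_i)|}I_{\vec{\mathcal B}_i}(T),\qquad d\mu[T]=e^{-S[T]}[dT],\qquad Z=\int d\mu[T],\qquad \langle f(T)\rangle=\frac1Z\int d\mu[T]\,f(T),$$ as formal power series in the $\lambda_i$: the exponential of the interaction is expanded, and each coefficient is integrated against the normalized Gaussian weight $e^{-\frac12g^{\otimes D}(T,T)}[dT]$. The integral is a Berezin integral for anticommuting $T$, and for commuting $T$ a Lebesgue integral, in which the directions where the form $g^{\otimes D}$ is negative are integrated along the imaginary axis. Then $Z$ has constant term $1$, and the following holds. 1. For every $i\in I$ and every choice of directions of $\mathcal B_i$ in the invariant, $$\langle I_{\vec{\mathcal B}_i}(T)\rangle=-|V(\mathcal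 B_i)|\,\frac{\partial}{\partial\lambda_i}\ln Z=\sum_{(\mathcal G,\,\text{marked }\mathcal B_i)}\frac1{n_b(\mathcal G)!}\Big(\prod_{\mathcal B_j\ \text{unmarked}}\frac{-\lambda_j}{|V(\mathcal B_j)|}\Big)\prod_{c}\big((-1)^{|c|}N_c\big)^{F_{c/0}(\mathcal G)}.$$ The formal sum runs over the connected $(D+1)$-colored graphs $\mathcal G$ with a marked bubble equal to $\mathcal B_i$: such a $\mathcal G$ consists of $n_b(\mathcal G)\ge1$ numbered bubbles taken from the family (with labeled vertices; repetitions are allowed), one of which is marked and is the one with index $i$, and of a pairing of the set of all their vertices by edges of color $0$. The product over unmarked bubbles runs over all other bubbles of $\mathcal G$, and $F_{c/0}(\mathcal G)$ is the number of cycles of edges of alternating colors $c$ and $0$. 2. The quadratic invariant satisfies $$\langle g^{\otimes D}(T,T)\rangle=\prod_{c}(-1)^{|c|}N_c+\sum_{i\in I}\lambda_i\,|V(\mathcal B_i)|\,\frac{\partial}{\partial\lambda_i}\ln Z .$$ -/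

import Mathlib

open scoped MvPowerSeries.WithPiTopology

noncomputable section

namespace GradedTensor

/-! ## Pairings, orientations and the sign of two directed pairings -/

/-- An (undirected) pairing of the set `V`: a fixed-point-free involution. -/
structure Pairing (V : Type*) where
  mate : V → V
  mate_mate : ∀ v, mate (mate v) = v
  mate_ne : ∀ v, mate v ≠ v

/-- A direction of every pair `{v, mate v}` of a pairing. The vertices in `tail` are the first
entries of the directed pairs, so the directed pairing is `{(v, mate v) | v ∈ tail}`. -/
structure Pairing.Orientation {V : Type*} (P : Pairing V) where
  tail : Finset V
  mate_mem_tail : ∀ v, P.mate v ∈ tail ↔ v ∉ tail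

/-- The permutation `σ` carries the directed pairs of `P` to those of `Q`, that is, it takes
`i₁ i₂ … i₂ₖ` to `j₁ j₂ … j₂ₖ` for suitable enumerations `P = {(i₁, i₂), …}` and
`Q = {(j₁, j₂), …}`. -/
def Carries {V : Type*} {P Q : Pairing V} (o : P.Orientation) (o' : Q.Orientation)
    (σ : Equiv.Perm V) : Prop :=
  (∀ v, σ (P.mate v) = Q.mate (σ v)) ∧ ∀ v, σ v ∈ o'.tail ↔ v ∈ o.tail

/-- The vertices of a directed pairing, as first and second entries of the directed pairs. -/
def Pairing.Orientation.split {V : Type*} {P : Pairing V} (o : P.Orientation) :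
    V ≃ {v // v ∈ o.tail} × Bool := by
  classical
  exact
  { toFun := fun v => if h : v ∈ o.tail then (⟨v, h⟩, true)
      else (⟨P.mate v, (o.mate_mem_tail v).2 h⟩, false)
    invFun := fun x => if x.2 then x.1.1 else P.mate x.1.1
    left_inv := fun v => by
      by_cases h : v ∈ o.tail <;> simp [h, P.mate_mate]
    right_inv := fun x => by
      obtain ⟨⟨v, h⟩, b⟩ := x
      have h' : P.mate v ∉ o.tail := fun h2 => (o.mate_mem_tail v).1 h2 h
      cases b <;> simp [h, h', P.mate_mate] }

theorem Pairing.Orientation.split_mate {V : Type*} {P : Pairing V} (o : P.Orientation) (v : V) :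
    o.split (P.mate v) = ((o.split v).1, !(o.split v).2) := by
  by_cases h : v ∈ o.tail
  · have h' : P.mate v ∉ o.tail := fun h2 => (o.mate_mem_tail v).1 h2 h
    simp [split, h, h', P.mate_mate]
  · have h' : P.mate v ∈ o.tail := (o.mate_mem_tail v).2 h
    simp [split, h, h']

theorem Pairing.Orientation.split_mem {V : Type*} {P : Pairing V} (o : P.Orientation) (v : V) :
    (o.split v).2 = true ↔ v ∈ o.tail := by
  by_cases h : v ∈ o.tail <;> simp [split, h]

theorem exists_carries {V : Type*} [Fintype V] {P Q : Pairing V}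
    (o : P.Orientation) (o' : Q.Orientation) : ∃ σ, Carries o o' σ := by
  classical
  have hc : Fintype.card {v // v ∈ o.tail} = Fintype.card {v // v ∈ o'.tail} := by
    have h1 := Fintype.card_congr o.split
    have h2 := Fintype.card_congr o'.split
    simp only [Fintype.card_prod, Fintype.card_bool] at h1 h2
    omega
  let e := Fintype.equivOfCardEq hc
  refine ⟨(o.split.trans (e.prodCongr (Equiv.refl Bool))).trans o'.split.symm, ?_, ?_⟩
  · intro v
    apply o'.split.injective
    rw [o'.split_mate]
    simp [o.split_mate]
  · intro v
    rw [← o'.split_mem, ← o.split_mem]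
    simp

/-- `ε(P, Q)`, the sign of two directed pairings with respect to each other: the sign of a
permutation that carries the directed pairs of the first to those of the second. -/
def pairingSign {V : Type*} [Fintype V] [DecidableEq V] {P Q : Pairing V}
    (o : P.Orientation) (o' : Q.Orientation) : ℤˣ :=
  Equiv.Perm.sign (exists_carries o o').choose

theorem Carries.sign_eq_one {V : Type*} [Fintype V] [DecidableEq V] {P : Pairing V}
    {o : P.Orientation} {τ : Equiv.Perm V} (h : Carries o o τ) : Equiv.Perm.sign τ = 1 := by
  let e : Equiv.Perm {v // v ∈ o.tail} := τ.subtypePerm h.2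
  have key : o.split.permCongr τ = Equiv.prodCongrLeft (fun _ : Bool => e) := by
    ext1 x
    obtain ⟨⟨v, hv⟩, b⟩ := x
    have hv' : τ v ∈ o.tail := (h.2 v).2 hv
    have hm : P.mate (τ v) ∉ o.tail := fun h2 => (o.mate_mem_tail _).1 h2 hv'
    cases b
    · simp [Equiv.permCongr_apply, Pairing.Orientation.split, e, h.1, hm, P.mate_mate]
    · simp [Equiv.permCongr_apply, Pairing.Orientation.split, e, hv']
  rw [← Equiv.Perm.sign_permCongr o.split τ, key, Equiv.Perm.sign_prodCongrLeft]
  simp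

/-- The sign does not depend on the permutation that is used. -/
theorem pairingSign_eq {V : Type*} [Fintype V] [DecidableEq V] {P Q : Pairing V}
    (o : P.Orientation) (o' : Q.Orientation) (σ : Equiv.Perm V) (h : Carries o o' σ) :
    pairingSign o o' = Equiv.Perm.sign σ := by
  have h0 := (exists_carries o o').choose_spec
  have h1 : Carries o o ((exists_carries o o').choose⁻¹ * σ) := by
    refine ⟨fun v => ?_, fun v => ?_⟩
    · rw [Equiv.Perm.mul_apply, Equiv.Perm.mul_apply, h.1, Equiv.Perm.inv_eq_iff_eq, h0.1]
      simp
    · rw [← h0.2, ← h.2]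
      simp
  have h2 := h1.sign_eq_one
  rw [Equiv.Perm.sign_mul, Equiv.Perm.sign_inv] at h2
  rw [pairingSign]
  rw [mul_eq_one_iff_eq_inv, Int.units_inv_eq_self] at h2
  exact h2

/-! ## Colored graphs -/

/-- An (undirected, closed, edge) `D`-colored graph with labeled vertices `1, …, 2k` (here
`0, …, 2k - 1`): one pairing of the vertices for every color. -/
structure ColoredGraph (D : ℕ) where
  k : ℕ
  edges : Fin D → Pairing (Fin (2 * k))

/-- The number of vertices. -/
def ColoredGraph.order {D : ℕ} (B : ColoredGraph D) : ℕ := 2 * B.k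

def ColoredGraph.Connected {D : ℕ} (B : ColoredGraph D) : Prop :=
  (SimpleGraph.fromRel fun v w => ∃ c, (B.edges c).mate v = w).Connected

/-- A direction of all the edges of a colored graph. A `ColoredGraph` with a `Direction` is a
directed colored graph, and forgetting the direction is passing to its equivalence class. -/
abbrev ColoredGraph.Direction {D : ℕ} (B : ColoredGraph D) :=
  ∀ c, (B.edges c).Orientation

/-- The reference pairing `{(1,2), (3,4), …, (2k-1,2k)}`; with vertices counted from `0` it is
`{(0,1), (2,3), …, (2k-2,2k-1)}`. -/
def refPairing (k : ℕ) : Pairing (Fin (2 * k)) where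
  mate v := if h : v.1 % 2 = 0 then ⟨v.1 + 1, by omega⟩ else ⟨v.1 - 1, by omega⟩
  mate_mate v := by
    ext
    by_cases h : v.1 % 2 = 0
    · have h2 : ¬ (v.1 + 1) % 2 = 0 := by omega
      simp [h, h2]
    · have h2 : (v.1 - 1) % 2 = 0 := by omega
      have h3 : v.1 - 1 + 1 = v.1 := by omega
      simp [h, h2, h3]
  mate_ne v := by
    intro h0
    have h1 := congrArg Fin.val h0
    by_cases h : v.1 % 2 = 0
    · simp [h] at h1
    · simp only [h, dite_false] at h1
      omega

/-- The direction of the reference pairing. -/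
def refOrientation (k : ℕ) : (refPairing k).Orientation where
  tail := {v | v.1 % 2 = 0}
  mate_mem_tail v := by
    by_cases h : v.1 % 2 = 0
    · simp [refPairing, h]
      omega
    · simp [refPairing, h]
      omega

/-- The number of faces of two colors: the cycles of edges that alternate between two pairings,
which are the connected components of the union of the two pairings. -/
def faces {V : Type*} (P Q : Pairing V) : ℕ :=
  Nat.card (SimpleGraph.fromRel fun v w => P.mate v = w ∨ Q.mate v = w).ConnectedComponent

/-! ## The tensors -/

/-- The data of the model: for every color `c` the dimension `N c` and the parity `|c|`, where
`odd c = false` stands for `O(N c)` and `odd c = true` for `Sp(N c)`, which needs an even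
dimension. -/
structure Signature (D : ℕ) where
  N : Fin D → ℕ
  odd : Fin D → Bool
  even_of_odd : ∀ c, odd c = true → Even (N c)

namespace Signature

variable {D : ℕ} (s : Signature D)

/-- The multi-indices `a = (a₁, …, a_D)` of the tensor components. -/
abbrev Index : Type := (c : Fin D) → Fin (s.N c)

/-- The parity of the tensor components: `true` (fermionic) if the number of odd colors is odd,
`false` (bosonic) if it is even. -/
def parity : Bool := decide (Odd (∑ c, (s.odd c).toNat))

/-- The form `g^c`: the Kronecker delta for an even color; for an odd color the canonical
symplectic form `ω`, which is the block matrix with rows `(0, 1)` and `(-1, 0)`. -/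
def form (c : Fin D) : Matrix (Fin (s.N c)) (Fin (s.N c)) ℂ := fun a b =>
  if s.odd c then
    if b.1 = a.1 + s.N c / 2 then 1 else if a.1 = b.1 + s.N c / 2 then -1 else 0
  else if a = b then 1 else 0

/-- The form `g^{⊗D}` on multi-indices. -/
def tensorForm : Matrix s.Index s.Index ℂ := fun a b => ∏ c, s.form c (a c) (b c)

end Signature

/-- The algebra of polynomials over `ℂ` in the tensor components: the polynomial ring if the
components commute, the Grassmann (exterior) algebra if they anticommute. -/
def Alg (I : Type) : Bool → Type
  | false => MvPolynomial I ℂ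
  | true => ExteriorAlgebra ℂ (I → ℂ)

instance (I : Type) : (p : Bool) → Ring (Alg I p)
  | false => inferInstanceAs (Ring (MvPolynomial I ℂ))
  | true => inferInstanceAs (Ring (ExteriorAlgebra ℂ (I → ℂ)))

instance (I : Type) : (p : Bool) → Algebra ℂ (Alg I p)
  | false => inferInstanceAs (Algebra ℂ (MvPolynomial I ℂ))
  | true => inferInstanceAs (Algebra ℂ (ExteriorAlgebra ℂ (I → ℂ)))

/-- The tensor component with multi-index `a`, as a generator of the algebra. -/
def Alg.gen {I : Type} [DecidableEq I] : (p : Bool) → I → Alg I p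
  | false => fun a => (MvPolynomial.X a : MvPolynomial I ℂ)
  | true => fun a => ExteriorAlgebra.ι ℂ (Pi.single a 1 : I → ℂ)

/-- The quadratic element `∑ g_{ab} T^a T^b`. -/
def quadratic {I : Type} [Fintype I] [DecidableEq I] (p : Bool) (g : Matrix I I ℂ) : Alg I p :=
  ∑ a, ∑ b, g a b • (Alg.gen p a * Alg.gen p b)

/-! ## The Gaussian integrals -/

/-- The contour of the bosonic integral, parametrized by real `x`. A bosonic form `g` is a real
symmetric matrix with `g * g = 1`, so that its eigenvalues are `1` and `-1`; the contour is
`T = x` on the first eigenspace and `T = i x` on the second one, that is,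
`T = ((1 + g) / 2 + i (1 - g) / 2) x`. If all the colors are even, then `g = 1` and `T = x`. If
there are odd colors, then `g` is indefinite and the rotation makes the integral converge. -/
def contour {I : Type} [Fintype I] [DecidableEq I] (g : Matrix I I ℂ) (x : I → ℝ) : I → ℂ :=
  ((1 / 2 : ℂ) • (1 + g) + (Complex.I / 2) • (1 - g)).mulVec fun a => (x a : ℂ)

/-- The Berezin integral on the Grassmann algebra: the iterated derivative with respect to all
the generators, of which the constant term is taken. The derivatives are taken in an arbitrary
fixed order, which only affects the overall sign. -/
def berezin {I : Type} [Fintype I] (f : ExteriorAlgebra ℂ (I → ℂ)) : ℂ :=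
  ExteriorAlgebra.algebraMapInv
    ((Finset.univ : Finset I).toList.foldr
      (fun a h => CliffordAlgebra.contractLeft (LinearMap.proj a : Module.Dual ℂ (I → ℂ)) h) f)

/-- The unnormalized Gaussian integral `∫ ∏ dT^a exp(-g(T,T)/2) f(T)`: a Lebesgue integral along
the contour for bosonic components, a Berezin integral for fermionic ones. In the latter case
the exponential series ends because a product of more than `|I|` generators vanishes. -/
def gaussianIntegral {I : Type} [Fintype I] [DecidableEq I] (g : Matrix I I ℂ) :
    (p : Bool) → Alg I p → ℂ
  | false => fun f => ∫ x : I → ℝ,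
      Complex.exp (-(1 / 2) * MvPolynomial.eval (contour g x) (quadratic false g)) *
        MvPolynomial.eval (contour g x) f
  | true => fun f => berezin
      ((∑ n ∈ Finset.range (Fintype.card I + 1),
        ((n.factorial : ℂ)⁻¹ • (-(1 / 2 : ℂ) • quadratic true g) ^ n : Alg I true)) * f)

/-- The normalized Gaussian integral `∫ [dT] exp(-g(T,T)/2) f(T)`, whose value at `f = 1` is
`1`. -/
def gaussianMean {I : Type} [Fintype I] [DecidableEq I] (g : Matrix I I ℂ) (p : Bool)
    (f : Alg I p) : ℂ :=
  gaussianIntegral g p f / gaussianIntegral g p 1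

/-! ## The model -/

/-- The formal exponential `∑ Wⁿ / n!` of a power series `W` without constant term: the summands
with `n > |m|` do not contribute to the coefficient of the monomial with exponent `m`. -/
def formalExp {ι : Type*} {A : Type*} [Ring A] [Algebra ℂ A] (W : MvPowerSeries ι A) :
    MvPowerSeries ι A := fun m =>
  ∑ n ∈ Finset.range (m.degree + 1), (n.factorial : ℂ)⁻¹ • MvPowerSeries.coeff m (W ^ n)

namespace Signature

variable {D : ℕ} (s : Signature D)

/-- The algebra of polynomials in the tensor components. -/
abbrev Obs : Type := Alg s.Index s.parity

/-- The tensor component `T^a`. -/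
def T (a : s.Index) : s.Obs := Alg.gen s.parity a

/-- The quadratic invariant `g^{⊗D}(T,T)`. -/
def quadraticInvariant : s.Obs := quadratic s.parity s.tensorForm

/-- The trace invariant of a directed colored graph. The product over the reference pairing of
`T^{a^i} T^{a^j}` is the product of all the `T^{a^i}` in the order of the vertices. -/
def invariant (B : ColoredGraph D) (o : B.Direction) : s.Obs :=
  ∑ a : Fin (2 * B.k) → s.Index,
    (∏ c, (((pairingSign (refOrientation B.k) (o c) : ℤˣ) : ℤ) : ℂ) ^ (s.odd c).toNat *
        ∏ v ∈ (o c).tail, s.form c (a v c) (a ((B.edges c).mate v) c)) •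
      (List.ofFn fun v => s.T (a v)).prod

variable {ι : Type*} (𝓑 : ι → ColoredGraph D) (o : ∀ i, (𝓑 i).Direction)

open scoped Classical in
/-- The interaction `∑ i, (λ_i / |V(𝓑 i)|) I_{𝓑 i}(T)` as a formal power series in the coupling
constants `λ_i`, `i : ι`, with coefficients in the algebra of the tensor components. -/
def interaction : MvPowerSeries ι s.Obs := fun m =>
  ∑ i ∈ m.support,
    if m = Finsupp.single i 1 then ((𝓑 i).order : ℂ)⁻¹ • s.invariant (𝓑 i) (o i) else 0

/-- The formal power series `∫ dμ[T] f(T)`, where `dμ[T] = exp(-S[T]) [dT]`. -/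
def integral (f : s.Obs) : MvPowerSeries ι ℂ := fun m =>
  gaussianMean s.tensorForm s.parity
    (MvPowerSeries.coeff m (formalExp (-s.interaction 𝓑 o)) * f)

/-- The partition function `Z = ∫ dμ[T]`. -/
def Z : MvPowerSeries ι ℂ := s.integral 𝓑 o 1

/-- The expectation value `⟨f(T)⟩ = (1 / Z) ∫ dμ[T] f(T)`. -/
def expectation (f : s.Obs) : MvPowerSeries ι ℂ := (s.Z 𝓑 o)⁻¹ * s.integral 𝓑 o f

/-- The formal power series `ln Z = log(1 + (Z - 1))`. -/
def lnZ : MvPowerSeries ι ℂ := (PowerSeries.log ℂ).subst (s.Z 𝓑 o - 1)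

end Signature

/-! ## Feynman graphs -/

/-- A `(D+1)`-colored graph, given by its `n` numbered bubbles, with labeled vertices, and a
pairing of all the vertices by the edges of color `0`. -/
structure FeynmanGraph {D : ℕ} {ι : Type*} (𝓑 : ι → ColoredGraph D) where
  n : ℕ
  bubble : Fin n → ι
  edges0 : Pairing (Σ j : Fin n, Fin (2 * (𝓑 (bubble j)).k))

namespace FeynmanGraph

variable {D : ℕ} {ι : Type*} {𝓑 : ι → ColoredGraph D} (G : FeynmanGraph 𝓑)

abbrev Vertex : Type := Σ j : Fin G.n, Fin (2 * (𝓑 (G.bubble j)).k)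

/-- The edges of color `c` in `1, …, D`, which are those of the bubbles. -/
def edges (c : Fin D) : Pairing G.Vertex where
  mate v := ⟨v.1, ((𝓑 (G.bubble v.1)).edges c).mate v.2⟩
  mate_mate v := by simp [Pairing.mate_mate]
  mate_ne v := by
    intro h
    obtain ⟨j, v⟩ := v
    exact ((𝓑 (G.bubble j)).edges c).mate_ne v (by simpa using h)

def Connected : Prop :=
  (SimpleGraph.fromRel fun v w : G.Vertex =>
    G.edges0.mate v = w ∨ ∃ c, (G.edges c).mate v = w).Connected

/-- The factor `∏ c, ((-1)^{|c|} N_c) ^ F_{c/0}(G)`. -/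
def faceWeight (s : Signature D) : ℂ :=
  ∏ c, ((-1) ^ (s.odd c).toNat * (s.N c : ℂ)) ^ faces (G.edges c) G.edges0

end FeynmanGraph

/-- A connected Feynman graph with a marked bubble, which is `𝓑 i`. -/
structure MarkedGraph {D : ℕ} {ι : Type*} (𝓑 : ι → ColoredGraph D) (i : ι) extends
    FeynmanGraph 𝓑 where
  connected : toFeynmanGraph.Connected
  marked : Fin n
  bubble_marked : bubble marked = i

/-- The contribution of a connected graph with a marked bubble to the expectation value of the
invariant of this bubble. -/
def MarkedGraph.term {D : ℕ} {ι : Type*} {𝓑 : ι → ColoredGraph D} {i : ι} (G : MarkedGraph 𝓑 i)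
    (s : Signature D) : MvPowerSeries ι ℂ :=
  MvPowerSeries.C ((G.n.factorial : ℂ)⁻¹) *
    (∏ j ∈ Finset.univ.erase G.marked,
      MvPowerSeries.C (-((𝓑 (G.bubble j)).order : ℂ)⁻¹) * MvPowerSeries.X (G.bubble j)) *
    MvPowerSeries.C (G.faceWeight s)

end GradedTensor

end

/-! Both Gaussian integrals obey the same Schwinger-Dyson rule: the mean of `T^e f` is `∑ a, g a e`
times the mean of `∂_a f`, where `∂_a` is a derivation for bosons and an antiderivation for
fermions. It comes from integration by parts, the Berezin integral of a derivative being zero, and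
it uses that `g` is symmetric with square `1` or antisymmetric with square `-1`. From here on only
the exchange sign `±1` tells the two cases apart. Iterating the rule gives Wick's theorem, in which
each pairing carries the sign `ε` relative to the reference pairing, raised to the parity of `T`.

The signs are controlled by two facts. The sign `ε` is a cocycle, so the reference pairing cancels
when the Wick sign is combined with the sign in a trace invariant. The parity of `T` is the sum of
the `|c|` modulo 2, so the Wick sign splits into one sign per color. The amplitude therefore
factorizes over the colors. For one color, two pairings can be directed with the same tails, since
their union consists of even cycles. The index sum then counts functions that are constant on the
cycles of a permutation of the tails, the sign of this permutation is a power of `-1` given by its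
number of cycles, and the result is `((-1)^{|c|} N_c)^F` (`sum_gradedSign_mul`,
`mean_prod_invariant`).

Part 1 is the linked cluster theorem in labeled form. Iterated derivatives of `Z` at zero are sums
over all joinings of labeled bubbles, and a joining splits into the component of a chosen bubble and
the rest (`totalOn_insert`). Leibniz's rule for `⟨I⟩ Z = -|V| ∂Z` is the same recursion, so the
derivatives of `⟨I⟩` are the connected sums (`dcoeff_expectation`). Orbit counting turns the
factorials of the multi-exponents into `1 / n_b!`.

Part 2 is the rule applied to the quadratic invariant. Inserting it multiplies the mean of an
element of degree `d` by `±(number of components) + d` (`meanLinear_mul_quadratic`). In the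
coefficient of a monomial in the couplings, `d` is the total number of vertices of the bubbles,
which is what `λ_i |V_i| ∂_i` measures. -/

open scoped MvPowerSeries.WithPiTopology

noncomputable section

namespace GradedTensor

set_option linter.unusedSectionVars false

/-! ## Gaussian integrals: integration by parts -/


/-! ### Berezin integrals: integration by parts and nonzero normalization. -/

section Fermionic

variable {I : Type} [Fintype I] [DecidableEq I]

/-- The left derivative with respect to a Grassmann generator. -/
def grassmannDeriv (a : I) :
    ExteriorAlgebra ℂ (I → ℂ) →ₗ[ℂ] ExteriorAlgebra ℂ (I → ℂ) :=
  CliffordAlgebra.contractLeft (LinearMap.proj a : Module.Dual ℂ (I → ℂ))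

/-- A Grassmann generator. -/
def grassmannGen (a : I) : ExteriorAlgebra ℂ (I → ℂ) :=
  ExteriorAlgebra.ι ℂ (Pi.single a 1 : I → ℂ)

theorem grassmannDeriv_gen_mul (a b : I) (f : ExteriorAlgebra ℂ (I → ℂ)) :
    grassmannDeriv a (grassmannGen b * f) =
      (if a = b then (1 : ℂ) else 0) • f - grassmannGen b * grassmannDeriv a f := by
  unfold grassmannDeriv grassmannGen
  erw [CliffordAlgebra.contractLeft_ι_mul]
  simp [Pi.single_apply]

theorem grassmannDeriv_one (a : I) : grassmannDeriv a 1 = 0 :=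
  CliffordAlgebra.contractLeft_one _ _

theorem grassmannDeriv_comm (a b : I) (f : ExteriorAlgebra ℂ (I → ℂ)) :
    grassmannDeriv a (grassmannDeriv b f) = -grassmannDeriv b (grassmannDeriv a f) :=
  CliffordAlgebra.contractLeft_comm _ _ _

theorem grassmannDeriv_self (a : I) (f : ExteriorAlgebra ℂ (I → ℂ)) :
    grassmannDeriv a (grassmannDeriv a f) = 0 :=
  CliffordAlgebra.contractLeft_contractLeft _ _

theorem grassmannGen_mul_comm (a b : I) :
    grassmannGen a * grassmannGen b = -(grassmannGen b * grassmannGen a) :=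
  eq_neg_of_add_eq_zero_left (ExteriorAlgebra.ι_add_mul_swap _ _)

/-- Derivatives anticommute, so moving one of them outward past the whole list costs one sign per
entry. -/
theorem foldr_grassmannDeriv_deriv (l : List I) (a : I) (f : ExteriorAlgebra ℂ (I → ℂ)) :
    l.foldr (fun a h => grassmannDeriv a h) (grassmannDeriv a f) =
      (-1 : ℂ) ^ l.length • grassmannDeriv a (l.foldr (fun a h => grassmannDeriv a h) f) := by
  induction l with
  | nil => simp
  | cons b l ih =>
    simp only [List.foldr_cons, ih, map_smul, List.length_cons]
    rw [grassmannDeriv_comm b a, pow_succ, smul_neg, mul_smul, neg_one_smul, smul_neg]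

theorem foldr_grassmannDeriv_deriv_of_mem (l : List I) (a : I) (h : a ∈ l)
    (f : ExteriorAlgebra ℂ (I → ℂ)) :
    l.foldr (fun a h => grassmannDeriv a h) (grassmannDeriv a f) = 0 := by
  induction l with
  | nil => simp at h
  | cons b l ih =>
    rw [List.foldr_cons]
    rcases List.mem_cons.1 h with rfl | h
    · rw [foldr_grassmannDeriv_deriv, map_smul, grassmannDeriv_self, smul_zero]
    · rw [ih h, map_zero]

theorem berezin_eq (f : ExteriorAlgebra ℂ (I → ℂ)) :
    berezin f = ExteriorAlgebra.algebraMapInv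
      ((Finset.univ : Finset I).toList.foldr (fun a h => grassmannDeriv a h) f) := rfl

/-- The integral already contains `∂_a`, and `∂_a` squares to zero. This is the source of
integration by parts. -/
theorem berezin_deriv (a : I) (f : ExteriorAlgebra ℂ (I → ℂ)) :
    berezin (grassmannDeriv a f) = 0 := by
  rw [berezin_eq, foldr_grassmannDeriv_deriv_of_mem _ _ (by simp), map_zero]

/-- The Berezin integral as a linear map. -/
def berezinLinear : ExteriorAlgebra ℂ (I → ℂ) →ₗ[ℂ] ℂ :=
  ExteriorAlgebra.algebraMapInv.toLinearMap ∘ₗ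
    (Finset.univ : Finset I).toList.foldr (fun a h => grassmannDeriv a ∘ₗ h) LinearMap.id

theorem berezinLinear_apply (f : ExteriorAlgebra ℂ (I → ℂ)) : berezinLinear f = berezin f := by
  have (l : List I) : (l.foldr (fun a h => grassmannDeriv a ∘ₗ h) LinearMap.id) f =
      l.foldr (fun a h => grassmannDeriv a h) f := by
    induction l with
    | nil => rfl
    | cons b l ih => simp [ih]
  rw [berezin_eq, ← this]
  rfl

/-- The left fold puts the last generator outermost, where the innermost derivative of the right
fold meets it. This nesting avoids all signs, so the top monomial built in this order has Berezin
integral `1`. -/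
theorem foldr_grassmannDeriv_foldl_gen (l : List I) (f : ExteriorAlgebra ℂ (I → ℂ))
    (hl : l.Nodup) (hf : ∀ a ∈ l, grassmannDeriv a f = 0) :
    l.foldr (fun a h => grassmannDeriv a h) (l.foldl (fun h a => grassmannGen a * h) f) = f := by
  induction l generalizing f with
  | nil => rfl
  | cons b l ih =>
    rw [List.nodup_cons] at hl
    rw [List.foldl_cons, List.foldr_cons, ih _ hl.2, grassmannDeriv_gen_mul,
      hf b (by simp)]
    · simp
    · intro a ha
      rw [grassmannDeriv_gen_mul, hf a (by simp [ha]), if_neg]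
      · simp
      · rintro rfl
        exact hl.1 ha

theorem exists_berezin_ne_zero : ∃ f : ExteriorAlgebra ℂ (I → ℂ), berezin f ≠ 0 := by
  refine ⟨(Finset.univ : Finset I).toList.foldl (fun h a => grassmannGen a * h) 1, ?_⟩
  rw [berezin_eq, foldr_grassmannDeriv_foldl_gen _ _ (Finset.nodup_toList _)
    (fun a _ => grassmannDeriv_one a)]
  simp

theorem grassmann_eq_zero_of_mem {n : ℕ} (hn : Fintype.card I < n)
    {f : ExteriorAlgebra ℂ (I → ℂ)} (hf : f ∈ LinearMap.range (ExteriorAlgebra.ι ℂ (M := I → ℂ)) ^ n) :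
    f = 0 := by
  have h1 : Module.finrank ℂ (⋀[ℂ]^n (I → ℂ)) = 0 := by
    rw [exteriorPower.finrank_eq, Module.finrank_fintype_fun_eq_card]
    exact Nat.choose_eq_zero_of_lt hn
  have h2 := Submodule.finrank_eq_zero.1 h1
  exact (Submodule.eq_bot_iff _).1 h2 f hf

theorem grassmannGen_mem (a : I) :
    grassmannGen a ∈ LinearMap.range (ExteriorAlgebra.ι ℂ (M := I → ℂ)) ^ 1 := by
  rw [pow_one]
  exact ⟨_, rfl⟩

/-- The quadratic element of the Grassmann algebra. -/
def grassmannQuadratic (g : Matrix I I ℂ) : ExteriorAlgebra ℂ (I → ℂ) :=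
  ∑ a, ∑ b, g a b • (grassmannGen a * grassmannGen b)

theorem grassmannQuadratic_mem (g : Matrix I I ℂ) :
    grassmannQuadratic g ∈ LinearMap.range (ExteriorAlgebra.ι ℂ (M := I → ℂ)) ^ 2 := by
  refine Submodule.sum_mem _ fun a _ => Submodule.sum_mem _ fun b _ => Submodule.smul_mem _ _ ?_
  rw [show 2 = 1 + 1 from rfl, pow_add]
  exact Submodule.mul_mem_mul (grassmannGen_mem a) (grassmannGen_mem b)

/-- The derivative hits either factor of `T^b T^c`. The antisymmetry of `g` cancels the sign of the
second case, so the two contributions agree and give the factor 2. -/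
theorem grassmannDeriv_quadratic_mul (g : Matrix I I ℂ) (hg : g.transpose = -g) (a : I)
    (f : ExteriorAlgebra ℂ (I → ℂ)) :
    grassmannDeriv a (grassmannQuadratic g * f) =
      2 • ((∑ c, g a c • grassmannGen c) * f) + grassmannQuadratic g * grassmannDeriv a f := by
  have hg' (b c) : g b c = - g c b := by
    have := congrFun (congrFun hg c) b
    simpa using this
  simp only [grassmannQuadratic, Finset.sum_mul, map_sum, smul_mul_assoc, map_smul, mul_assoc,
    grassmannDeriv_gen_mul, mul_sub, smul_sub, Finset.sum_sub_distrib, mul_smul_comm]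
  have h1 : ∑ b, ∑ c, g b c • (if a = b then (1 : ℂ) else 0) • (grassmannGen c * f) =
      ∑ c, g a c • (grassmannGen c * f) := by
    rw [Finset.sum_comm]
    simp
  have h2 : ∑ b, ∑ c, g b c • (if a = c then (1 : ℂ) else 0) • (grassmannGen b * f) =
      - ∑ c, g a c • (grassmannGen c * f) := by
    simp [hg' _ a]
  rw [h1, h2]
  abel

theorem grassmannQuadratic_commute (g : Matrix I I ℂ) (a : I) :
    Commute (grassmannQuadratic g) (grassmannGen a) := by
  refine Commute.sum_left _ _ _ fun b _ => Commute.sum_left _ _ _ fun c _ => ?_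
  refine Commute.smul_left ?_ _
  show _ * _ * _ = _ * (_ * _)
  rw [mul_assoc, grassmannGen_mul_comm c a, mul_neg, ← mul_assoc, grassmannGen_mul_comm b a]
  simp [mul_assoc]

/-- The Gaussian weight on the Grassmann algebra. -/
def grassmannWeight (g : Matrix I I ℂ) : ExteriorAlgebra ℂ (I → ℂ) :=
  ∑ n ∈ Finset.range (Fintype.card I + 1),
    (n.factorial : ℂ)⁻¹ • (-(1 / 2 : ℂ) • grassmannQuadratic g) ^ n

theorem quadratic_pow_mem (g : Matrix I I ℂ) (t : ℂ) (n : ℕ) :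
    (t • grassmannQuadratic g) ^ n ∈
      LinearMap.range (ExteriorAlgebra.ι ℂ (M := I → ℂ)) ^ (2 * n) := by
  rw [pow_mul]
  exact Submodule.pow_mem_pow _ (Submodule.smul_mem _ _ (grassmannQuadratic_mem g)) n

/-- The ordinary power rule holds because the exponent `Q` is even: it commutes with the linear
element `θ` that differentiating it produces. -/
theorem grassmannDeriv_pow_mul (g : Matrix I I ℂ) (hg : g.transpose = -g) (a : I) (n : ℕ)
    (f : ExteriorAlgebra ℂ (I → ℂ)) :
    grassmannDeriv a ((-(1 / 2 : ℂ) • grassmannQuadratic g) ^ (n + 1) * f) =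
      -((n + 1 : ℂ) • ((-(1 / 2 : ℂ) • grassmannQuadratic g) ^ n *
        ((∑ c, g a c • grassmannGen c) * f))) +
      (-(1 / 2 : ℂ) • grassmannQuadratic g) ^ (n + 1) * grassmannDeriv a f := by
  set Q := -(1 / 2 : ℂ) • grassmannQuadratic g with hQ
  set θ := ∑ c, g a c • grassmannGen c with hθ
  have hc : Commute Q θ := by
    refine Commute.smul_left (Commute.sum_right _ _ _ fun c _ => Commute.smul_right ?_ _) _
    exact grassmannQuadratic_commute g c
  have h1 (f) : grassmannDeriv a (Q * f) = -(θ * f) + Q * grassmannDeriv a f := by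
    rw [hQ, smul_mul_assoc, map_smul, grassmannDeriv_quadratic_mul g hg, smul_add, ← hθ]
    congr 1
    · rw [← Nat.cast_smul_eq_nsmul ℂ, smul_smul]
      norm_num
    · simp
  induction n generalizing f with
  | zero => simp [h1]
  | succ n ih =>
    rw [pow_succ' Q (n + 1), mul_assoc, h1, ih, mul_add, ← mul_assoc Q (Q ^ (n + 1)),
      ← mul_assoc θ, ← (hc.pow_left (n + 1)).eq, mul_neg, mul_smul_comm, ← mul_assoc Q (Q ^ n),
      ← pow_succ', ← add_assoc, mul_assoc]
    congr 1
    rw [Nat.cast_succ, add_smul (n + 1 : ℂ) 1, one_smul]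
    abel

theorem grassmannDeriv_weight_mul (g : Matrix I I ℂ) (hg : g.transpose = -g) (a : I)
    (f : ExteriorAlgebra ℂ (I → ℂ)) :
    grassmannDeriv a (grassmannWeight g * f) =
      -(grassmannWeight g * ((∑ c, g a c • grassmannGen c) * f)) +
        grassmannWeight g * grassmannDeriv a f := by
  set Q := -(1 / 2 : ℂ) • grassmannQuadratic g with hQ
  set θ := ∑ c, g a c • grassmannGen c with hθ
  -- Differentiation shifts the truncated exponential series by one term. The missing top term has
  -- degree `2|I| + 1`, more than the number of generators, and vanishes.
  have hz : Q ^ (Fintype.card I) * θ = 0 := by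
    have : Nonempty I := ⟨a⟩
    have hpos := Fintype.card_pos (α := I)
    apply grassmann_eq_zero_of_mem (n := 2 * Fintype.card I + 1) (by omega)
    rw [pow_succ]
    refine Submodule.mul_mem_mul (quadratic_pow_mem g _ _) ?_
    refine Submodule.sum_mem _ fun c _ => Submodule.smul_mem _ _ ⟨_, rfl⟩
  have e1 : grassmannWeight g * (θ * f) =
      ∑ n ∈ Finset.range (Fintype.card I), (n.factorial : ℂ)⁻¹ • (Q ^ n * (θ * f)) := by
    rw [grassmannWeight, Finset.sum_range_succ, add_mul, ← hQ, smul_mul_assoc, ← mul_assoc (Q ^ _),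
      hz]
    simp [Finset.sum_mul]
  have e2 (f) : grassmannWeight g * f = f +
      ∑ n ∈ Finset.range (Fintype.card I), ((n + 1).factorial : ℂ)⁻¹ • (Q ^ (n + 1) * f) := by
    rw [grassmannWeight, Finset.sum_range_succ', add_mul, ← hQ]
    simp [Finset.sum_mul, add_comm]
  rw [e1, e2, e2, map_add, map_sum]
  simp only [map_smul, hQ, grassmannDeriv_pow_mul g hg]
  simp only [← hQ, ← hθ, smul_add, Finset.sum_add_distrib, smul_neg, Finset.sum_neg_distrib,
    smul_smul]
  have (n : ℕ) : ((n + 1).factorial : ℂ)⁻¹ * (n + 1) = (n.factorial : ℂ)⁻¹ := by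
    have h1 : (n + 1 : ℂ) ≠ 0 := Nat.cast_add_one_ne_zero n
    rw [Nat.factorial_succ]
    push_cast
    field_simp
  simp only [this]
  abel

theorem exists_grassmannWeight_mul_eq_one (g : Matrix I I ℂ) :
    ∃ v, grassmannWeight g * v = 1 := by
  set Q := -(1 / 2 : ℂ) • grassmannQuadratic g with hQ
  have h0 : Q ^ (Fintype.card I + 1) = 0 :=
    grassmann_eq_zero_of_mem (by omega) (quadratic_pow_mem g _ _)
  refine ⟨IsNilpotent.exp (-Q), ?_⟩
  have : grassmannWeight g = IsNilpotent.exp Q := by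
    rw [IsNilpotent.exp_eq_sum h0, grassmannWeight]
    refine Finset.sum_congr rfl fun n _ => ?_
    rw [← hQ, ← Rat.cast_smul_eq_qsmul ℂ]
    simp
  rw [this]
  exact IsNilpotent.exp_mul_exp_neg_self ⟨_, h0⟩

/-- Integrating `∂_a` of weight times `f` to zero expresses the mean of `∂_a f` by those of the `T^c
f` with matrix `g`. This linear system is inverted with `gᵀ g = 1`. -/
theorem berezin_weight_gen_mul (g : Matrix I I ℂ) (hg : g.transpose = -g) (hg2 : g * g = -1)
    (e : I) (f : ExteriorAlgebra ℂ (I → ℂ)) :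
    berezinLinear (grassmannWeight g * (grassmannGen e * f)) =
      ∑ a, g a e * berezinLinear (grassmannWeight g * grassmannDeriv a f) := by
  have h (a : I) : berezinLinear (grassmannWeight g * grassmannDeriv a f) =
      ∑ c, g a c * berezinLinear (grassmannWeight g * (grassmannGen c * f)) := by
    have h1 := congrArg berezinLinear (grassmannDeriv_weight_mul g hg a f)
    rw [berezinLinear_apply, berezin_deriv, map_add, map_neg] at h1
    rw [← neg_add_eq_zero.1 h1.symm]
    simp [Finset.sum_mul, Finset.mul_sum]
  simp only [h, Finset.mul_sum]
  rw [Finset.sum_comm]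
  have h2 (c : I) : ∑ a, g a e * g a c = if e = c then 1 else 0 := by
    have h3 : (g.transpose * g) e c = (1 : Matrix I I ℂ) e c := by
      rw [hg, Matrix.neg_mul, hg2, neg_neg]
    simpa [Matrix.mul_apply, Matrix.one_apply] using h3
  simp only [← mul_assoc, ← Finset.sum_mul, h2]
  simp

theorem grassmannDeriv_prod_mem (a : I) (l : List I) :
    grassmannDeriv a (l.map grassmannGen).prod ∈
      Submodule.span ℂ {f | ∃ l' : List I, l'.length < l.length ∧ f = (l'.map grassmannGen).prod} := by
  induction l with
  | nil => simp [grassmannDeriv_one]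
  | cons b l ih =>
    rw [List.map_cons, List.prod_cons, grassmannDeriv_gen_mul]
    refine Submodule.sub_mem _ (Submodule.smul_mem _ _ (Submodule.subset_span ⟨l, by simp, rfl⟩)) ?_
    refine Submodule.span_induction (p := fun x _ => grassmannGen b * x ∈ _) ?_ ?_ ?_ ?_ ih
    · rintro _ ⟨l', h, rfl⟩
      exact Submodule.subset_span ⟨b :: l', by simpa using h, by simp⟩
    · simp
    · intro x y _ _ hx hy
      rw [mul_add]
      exact Submodule.add_mem _ hx hy
    · intro t x _ hx
      rw [mul_smul_comm]
      exact Submodule.smul_mem _ _ hx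

theorem mem_span_grassmannGen_prod (f : ExteriorAlgebra ℂ (I → ℂ)) :
    f ∈ Submodule.span ℂ (Set.range fun l : List I => (l.map grassmannGen).prod) := by
  refine CliffordAlgebra.left_induction 0 (P := fun f => f ∈ Submodule.span ℂ
    (Set.range fun l : List I => (l.map grassmannGen).prod)) ?_ ?_ ?_ f
  · intro r
    rw [Algebra.algebraMap_eq_smul_one]
    exact Submodule.smul_mem _ _ (Submodule.subset_span ⟨[], rfl⟩)
  · intro x y hx hy
    exact Submodule.add_mem _ hx hy
  · intro x m hx
    have hm : CliffordAlgebra.ι (0 : QuadraticForm ℂ (I → ℂ)) m = ∑ a, m a • grassmannGen a := by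
      conv_lhs => rw [pi_eq_sum_univ' m]
      simp only [map_sum, map_smul, grassmannGen]
    rw [hm, Finset.sum_mul]
    refine Submodule.sum_mem _ fun a _ => ?_
    rw [smul_mul_assoc]
    refine Submodule.smul_mem _ _ ?_
    refine Submodule.span_induction (p := fun x _ => grassmannGen a * x ∈ _) ?_ ?_ ?_ ?_ hx
    · rintro _ ⟨l', rfl⟩
      exact Submodule.subset_span ⟨a :: l', by simp⟩
    · simp
    · intro x y _ _ hx hy
      rw [mul_add]
      exact Submodule.add_mem _ hx hy
    · intro t x _ hx
      rw [mul_smul_comm]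
      exact Submodule.smul_mem _ _ hx

/-- No Pfaffian is computed. If the normalization vanished, integration by parts would lower degrees
until every monomial integrated to zero against the weight. The weight is invertible, so the Berezin
integral itself would vanish identically. -/
theorem berezin_weight_ne_zero (g : Matrix I I ℂ) (hg : g.transpose = -g) (hg2 : g * g = -1) :
    berezinLinear (grassmannWeight g) ≠ 0 := by
  intro h0
  let L := berezinLinear ∘ₗ LinearMap.mulLeft ℂ (grassmannWeight g)
  have hlist (l : List I) : L (l.map grassmannGen).prod = 0 := by
    induction hn : l.length using Nat.strong_induction_on generalizing l with
    | _ n ih =>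
      cases l with
      | nil => simpa [L] using h0
      | cons e l =>
        rw [List.map_cons, List.prod_cons]
        refine (berezin_weight_gen_mul g hg hg2 e _).trans (Finset.sum_eq_zero fun a _ => ?_)
        refine mul_eq_zero_of_right _ ?_
        suffices h : grassmannDeriv a (l.map grassmannGen).prod ∈ LinearMap.ker L from h
        refine Submodule.span_le.2 ?_ (grassmannDeriv_prod_mem a l)
        rintro _ ⟨l', h, rfl⟩
        exact ih _ (by simp at hn; omega) l' rfl
  have hall : LinearMap.ker L = ⊤ := by
    refine eq_top_iff.2 fun f _ => Submodule.span_le.2 ?_ (mem_span_grassmannGen_prod f)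
    rintro _ ⟨l, rfl⟩
    exact hlist l
  obtain ⟨f, hf⟩ := exists_berezin_ne_zero (I := I)
  obtain ⟨v, hv⟩ := exists_grassmannWeight_mul_eq_one g
  apply hf
  rw [← berezinLinear_apply, ← one_mul f, ← hv, mul_assoc]
  have : v * f ∈ LinearMap.ker L := hall ▸ Submodule.mem_top
  exact this

end Fermionic

/-! ### Lebesgue integrals along the rotated contour. -/

section Bosonic

open MeasureTheory

/-- The unnormalized Gaussian moments. -/
def gaussianMoment (n : ℕ) : ℂ := ∫ x : ℝ, ((Real.exp (-(1 / 2) * x ^ 2) : ℝ) : ℂ) * (x : ℂ) ^ n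

theorem integrable_exp_mul_pow (n : ℕ) :
    Integrable fun x : ℝ => ((Real.exp (-(1 / 2) * x ^ 2) : ℝ) : ℂ) * (x : ℂ) ^ n := by
  have h := integrable_rpow_mul_exp_neg_mul_sq (b := 1 / 2) (by norm_num) (s := n)
    (by have := Nat.cast_nonneg (α := ℝ) n; linarith)
  convert h.ofReal (𝕜 := ℂ) using 2 with x
  simp [mul_comm]

theorem gaussianMoment_zero_ne_zero : gaussianMoment 0 ≠ 0 := by
  have h : gaussianMoment 0 = ((∫ x : ℝ, Real.exp (-(1 / 2) * x ^ 2) : ℝ) : ℂ) := by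
    rw [← integral_complex_ofReal]
    simp [gaussianMoment]
  rw [h, integral_gaussian, Complex.ofReal_ne_zero]
  positivity

/-- Integration by parts with `x` times the weight as the derivative of minus the weight. For `n =
0` the truncated `n - 1` is harmless, its coefficient being zero. -/
theorem gaussianMoment_succ (n : ℕ) : gaussianMoment (n + 1) = n * gaussianMoment (n - 1) := by
  have hu (x : ℝ) : HasDerivAt (fun x : ℝ => (x : ℂ) ^ n) (n * (x : ℂ) ^ (n - 1)) x := by
    simpa using (hasDerivAt_pow n (x : ℂ)).comp_ofReal
  have hv (x : ℝ) : HasDerivAt (fun x : ℝ => -((Real.exp (-(1 / 2) * x ^ 2) : ℝ) : ℂ))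
      (((Real.exp (-(1 / 2) * x ^ 2) : ℝ) : ℂ) * x) x := by
    have h1 : HasDerivAt (fun x : ℝ => Real.exp (-(1 / 2) * x ^ 2))
        (Real.exp (-(1 / 2) * x ^ 2) * (-(1 / 2) * (2 * x))) x := by
      simpa only [Nat.cast_ofNat, Nat.add_one_sub_one, pow_one] using
        ((hasDerivAt_pow 2 x).const_mul (-(1 / 2))).exp
    have h2 := h1.ofReal_comp.neg
    rw [show -((Real.exp (-(1 / 2) * x ^ 2) * (-(1 / 2) * (2 * x)) : ℝ) : ℂ) =
      ((Real.exp (-(1 / 2) * x ^ 2) : ℝ) : ℂ) * x by push_cast; ring] at h2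
    exact h2
  have h := integral_mul_deriv_eq_deriv_mul_of_integrable (fun x _ => hu x) (fun x _ => hv x)
    ?_ ?_ ?_
  · rw [gaussianMoment, gaussianMoment, ← integral_const_mul]
    rw [← integral_neg] at h
    refine Eq.trans (integral_congr_ae (ae_of_all _ fun x => ?_))
      (h.trans (integral_congr_ae (ae_of_all _ fun x => ?_))) <;> ring
  · refine (integrable_exp_mul_pow (n + 1)).congr (ae_of_all _ fun x => ?_)
    simp only [Pi.mul_apply]
    ring
  · refine ((integrable_exp_mul_pow (n - 1)).const_mul (n : ℂ)).neg.congr (ae_of_all _ fun x => ?_)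
    simp only [Pi.mul_apply, Pi.neg_apply]
    ring
  · refine (integrable_exp_mul_pow n).neg.congr (ae_of_all _ fun x => ?_)
    simp only [Pi.mul_apply, Pi.neg_apply]
    ring

variable {I : Type} [Fintype I] [DecidableEq I]

/-- The real Gaussian weight on functions. -/
def gaussWeight (x : I → ℝ) : ℂ := ∏ a, ((Real.exp (-(1 / 2) * x a ^ 2) : ℝ) : ℂ)

/-- Evaluation of a complex polynomial at a real point. -/
def evalReal (x : I → ℝ) : MvPolynomial I ℂ →ₐ[ℂ] ℂ := MvPolynomial.aeval fun a => (x a : ℂ)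

theorem gaussWeight_mul_eval_monomial (m : I →₀ ℕ) (t : ℂ) (x : I → ℝ) :
    gaussWeight x * evalReal x (MvPolynomial.monomial m t) =
      t * ∏ a, (((Real.exp (-(1 / 2) * x a ^ 2) : ℝ) : ℂ) * (x a : ℂ) ^ m a) := by
  rw [evalReal, MvPolynomial.aeval_monomial, Finset.prod_mul_distrib, gaussWeight,
    Finsupp.prod_fintype _ _ (by simp)]
  simp only [Algebra.algebraMap_self, RingHom.id_apply]
  ring

theorem integrable_gaussWeight_mul_eval (h : MvPolynomial I ℂ) :
    Integrable fun x : I → ℝ => gaussWeight x * evalReal x h := by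
  induction h using MvPolynomial.induction_on' with
  | monomial m t =>
    simp only [gaussWeight_mul_eval_monomial]
    exact (Integrable.fintype_prod (f := fun a (y : ℝ) =>
      ((Real.exp (-(1 / 2) * y ^ 2) : ℝ) : ℂ) * (y : ℂ) ^ m a)
      fun a => integrable_exp_mul_pow (m a)).const_mul t
  | add p q hp hq =>
    simp only [map_add, mul_add]
    exact hp.add hq

/-- The standard Gaussian integral of a polynomial. -/
def gaussLinear : MvPolynomial I ℂ →ₗ[ℂ] ℂ where
  toFun h := ∫ x : I → ℝ, gaussWeight x * evalReal x h
  map_add' p q := by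
    simp only [map_add, mul_add]
    exact integral_add (integrable_gaussWeight_mul_eval p) (integrable_gaussWeight_mul_eval q)
  map_smul' t p := by
    simp only [map_smul, smul_eq_mul, RingHom.id_apply, ← integral_const_mul]
    congr 1 with x
    ring

theorem gaussLinear_monomial (m : I →₀ ℕ) (t : ℂ) :
    gaussLinear (MvPolynomial.monomial m t) = t * ∏ a, gaussianMoment (m a) := by
  simp only [gaussLinear, LinearMap.coe_mk, AddHom.coe_mk, gaussWeight_mul_eval_monomial,
    integral_const_mul]
  congr 1
  exact integral_fintype_prod_eq_prod (fun a (y : ℝ) =>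
      ((Real.exp (-(1 / 2) * y ^ 2) : ℝ) : ℂ) * (y : ℂ) ^ m a)

theorem gaussLinear_one_ne_zero : gaussLinear (1 : MvPolynomial I ℂ) ≠ 0 := by
  have := gaussLinear_monomial (I := I) 0 1
  rw [MvPolynomial.monomial_zero', map_one] at this
  rw [this]
  simp [gaussianMoment_zero_ne_zero]

theorem gaussLinear_X_mul (a : I) (h : MvPolynomial I ℂ) :
    gaussLinear (MvPolynomial.X a * h) = gaussLinear (MvPolynomial.pderiv a h) := by
  induction h using MvPolynomial.induction_on' with
  | monomial m t =>
    rw [MvPolynomial.pderiv_monomial, MvPolynomial.X, MvPolynomial.monomial_mul,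
      gaussLinear_monomial, gaussLinear_monomial, ← Finset.mul_prod_erase _ _ (Finset.mem_univ a),
      ← Finset.mul_prod_erase _ _ (Finset.mem_univ a)]
    have h1 : ∏ b ∈ Finset.univ.erase a, gaussianMoment ((Finsupp.single a 1 + m : I →₀ ℕ) b) =
        ∏ b ∈ Finset.univ.erase a, gaussianMoment ((m - Finsupp.single a 1 : I →₀ ℕ) b) := by
      refine Finset.prod_congr rfl fun b hb => ?_
      have : a ≠ b := (Finset.ne_of_mem_erase hb).symm
      simp [this]
    rw [h1]
    simp only [Finsupp.coe_add, Pi.add_apply, Finsupp.single_eq_same, Finsupp.coe_tsub,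
      Pi.sub_apply]
    rw [add_comm 1, gaussianMoment_succ]
    ring
  | add p q hp hq => rw [mul_add, map_add, map_add, map_add, hp, hq]

/-- The matrix of the rotated contour. -/
def contourMatrix (g : Matrix I I ℂ) : Matrix I I ℂ :=
  (1 / 2 : ℂ) • (1 + g) + (Complex.I / 2) • (1 - g)

theorem contourMatrix_transpose (g : Matrix I I ℂ) (hg : g.transpose = g) :
    (contourMatrix g).transpose = contourMatrix g := by
  simp [contourMatrix, hg]

/-- With the spectral projections of `g` the contour is `P₊ + i P₋`, whose square is `P₊ - P₋ = g`.
-/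
theorem contourMatrix_mul_self (g : Matrix I I ℂ) (hg2 : g * g = 1) :
    contourMatrix g * contourMatrix g = g := by
  simp only [contourMatrix, Matrix.add_mul, Matrix.mul_add, Matrix.sub_mul, Matrix.mul_sub, hg2,
    smul_add, smul_sub, Matrix.smul_mul, Matrix.mul_smul, one_mul, mul_one]
  have hI := Complex.I_mul_I
  ext a b
  simp only [Matrix.add_apply, Matrix.sub_apply, Matrix.smul_apply, smul_eq_mul]
  linear_combination (1 / 2 : ℂ) * ((1 : Matrix I I ℂ) a b - g a b) * hI

/-- Substitution of the contour into a polynomial. -/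
def contourSubst (g : Matrix I I ℂ) : MvPolynomial I ℂ →ₐ[ℂ] MvPolynomial I ℂ :=
  MvPolynomial.bind₁ fun a => ∑ b, contourMatrix g a b • MvPolynomial.X b

theorem eval_contour (g : Matrix I I ℂ) (x : I → ℝ) (f : MvPolynomial I ℂ) :
    MvPolynomial.eval (contour g x) f = evalReal x (contourSubst g f) := by
  rw [evalReal, contourSubst, MvPolynomial.aeval_bind₁]
  have : (fun a => (MvPolynomial.aeval fun a => (x a : ℂ))
      (∑ b, contourMatrix g a b • (MvPolynomial.X b : MvPolynomial I ℂ))) = contour g x := by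
    ext a
    simp [contour, contourMatrix, Matrix.mulVec, dotProduct]
  rw [this]
  rfl

/-- The contour matrix `C` is symmetric, commutes with `g` and squares to `g`, so `C g C = g² = 1`
and the exponent becomes the standard real Gaussian. -/
theorem exp_quadratic_contour (g : Matrix I I ℂ) (hg : g.transpose = g) (hg2 : g * g = 1)
    (x : I → ℝ) :
    Complex.exp (-(1 / 2) * MvPolynomial.eval (contour g x)
      (∑ a, ∑ b, g a b • (MvPolynomial.X a * MvPolynomial.X b))) = gaussWeight x := by
  have h1 : MvPolynomial.eval (contour g x)
      (∑ a, ∑ b, g a b • (MvPolynomial.X a * MvPolynomial.X b)) = ∑ a, (x a : ℂ) ^ 2 := by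
    have h2 : MvPolynomial.eval (contour g x)
      (∑ a, ∑ b, g a b • (MvPolynomial.X a * MvPolynomial.X b)) =
        contour g x ⬝ᵥ g.mulVec (contour g x) := by
      simp only [map_sum, MvPolynomial.smul_eval, map_mul, MvPolynomial.eval_X, dotProduct,
        Matrix.mulVec, Finset.mul_sum]
      refine Finset.sum_congr rfl fun a _ => Finset.sum_congr rfl fun b _ => by ring
    have h3 : contour g x = (contourMatrix g).mulVec fun a => (x a : ℂ) := rfl
    have h4 : contourMatrix g * (g * contourMatrix g) = 1 := by
      have hc : g * contourMatrix g = contourMatrix g * g := by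
        simp [contourMatrix, Matrix.mul_add, Matrix.add_mul, Matrix.mul_sub, Matrix.sub_mul]
      rw [hc, ← mul_assoc, contourMatrix_mul_self g hg2, hg2]
    rw [h2, h3, Matrix.mulVec_mulVec, ← Matrix.vecMul_transpose, contourMatrix_transpose g hg,
      Matrix.dotProduct_mulVec, Matrix.vecMul_vecMul, h4, Matrix.vecMul_one]
    simp [dotProduct, sq]
  rw [h1, gaussWeight, Finset.mul_sum, Complex.exp_sum]
  simp

theorem pderiv_contourSubst (g : Matrix I I ℂ) (b : I) (f : MvPolynomial I ℂ) :
    MvPolynomial.pderiv b (contourSubst g f) =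
      ∑ a, contourMatrix g a b • contourSubst g (MvPolynomial.pderiv a f) := by
  induction f using MvPolynomial.induction_on with
  | C t => simp [contourSubst]
  | add p q hp hq => simp [hp, hq, Finset.sum_add_distrib]
  | mul_X p i hp =>
    rw [map_mul, Derivation.leibniz, hp]
    simp only [contourSubst, MvPolynomial.bind₁_X_right, Derivation.leibniz, map_add, smul_eq_mul,
      map_mul, map_sum, MvPolynomial.pderiv_X, smul_add, Finset.sum_add_distrib]
    congr 1
    · simp [Pi.single_apply, MvPolynomial.smul_eq_C_mul, mul_comm, apply_ite, Finset.sum_ite_eq]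
    · rw [Finset.mul_sum]
      refine Finset.sum_congr rfl fun a _ => by rw [mul_smul_comm]

/-- Integration by parts in the real coordinates and the chain rule each bring one contour matrix.
Their product is `g`. -/
theorem gaussLinear_contour_X_mul (g : Matrix I I ℂ) (hg : g.transpose = g) (hg2 : g * g = 1)
    (e : I) (f : MvPolynomial I ℂ) :
    gaussLinear (contourSubst g (MvPolynomial.X e * f)) =
      ∑ a, g a e * gaussLinear (contourSubst g (MvPolynomial.pderiv a f)) := by
  have hs (a b) : contourMatrix g a b = contourMatrix g b a :=
    congrFun (congrFun (contourMatrix_transpose g hg) b) a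
  rw [map_mul]
  conv_lhs => rw [contourSubst, MvPolynomial.bind₁_X_right, ← contourSubst, Finset.sum_mul]
  simp only [map_sum, smul_mul_assoc, map_smul, gaussLinear_X_mul, pderiv_contourSubst,
    smul_eq_mul, Finset.mul_sum]
  rw [Finset.sum_comm]
  refine Finset.sum_congr rfl fun a _ => ?_
  simp only [← mul_assoc, ← Finset.sum_mul]
  congr 1
  conv_rhs => rw [← contourMatrix_mul_self g hg2, Matrix.mul_apply]
  refine Finset.sum_congr rfl fun b _ => by rw [hs e b, mul_comm]

end Bosonic

/-! ## The common rules of the two Gaussian integrals -/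

/-- The sign of an exchange of two tensor components. -/
def exchangeSign : Bool → ℂ
  | false => 1
  | true => -1

theorem exchangeSign_mul_self (p : Bool) : exchangeSign p * exchangeSign p = 1 := by
  cases p <;> simp [exchangeSign]

theorem exchangeSign_eq_pow (p : Bool) : exchangeSign p = (-1) ^ p.toNat := by
  cases p <;> simp [exchangeSign]

section Mean

variable {I : Type} [Fintype I] [DecidableEq I]

/-- The left derivative with respect to a generator. -/
def Alg.deriv : (p : Bool) → I → Alg I p →ₗ[ℂ] Alg I p
  | false => fun a => (MvPolynomial.pderiv a : Derivation ℂ (MvPolynomial I ℂ) _).toLinearMap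
  | true => fun a => grassmannDeriv a

theorem Alg.deriv_one (p : Bool) (a : I) : Alg.deriv p a 1 = 0 := by
  cases p
  · exact (MvPolynomial.pderiv a : Derivation ℂ (MvPolynomial I ℂ) _).map_one_eq_zero
  · exact grassmannDeriv_one a

theorem Alg.deriv_gen_mul (p : Bool) (a b : I) (f : Alg I p) :
    Alg.deriv p a (Alg.gen p b * f) =
      (if a = b then (1 : ℂ) else 0) • f + exchangeSign p • (Alg.gen p b * Alg.deriv p a f) := by
  cases p
  · refine ((MvPolynomial.pderiv a).leibniz (MvPolynomial.X b : MvPolynomial I ℂ) f).trans ?_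
    rw [MvPolynomial.pderiv_X, exchangeSign, one_smul, add_comm]
    refine congrArg₂ (· + ·) ?_ rfl
    by_cases h : a = b
    · subst h
      simp only [Pi.single_eq_same, if_true, one_smul]
      exact mul_one (show MvPolynomial I ℂ from f)
    · simp only [if_neg h, zero_smul, Pi.single_eq_of_ne (Ne.symm h)]
      exact mul_zero (show MvPolynomial I ℂ from f)
  · refine (grassmannDeriv_gen_mul a b f).trans ?_
    rw [exchangeSign, neg_one_smul, ← sub_eq_add_neg]
    rfl

theorem Alg.gen_mul_gen (p : Bool) (a b : I) :
    (Alg.gen p a * Alg.gen p b : Alg I p) = exchangeSign p • (Alg.gen p b * Alg.gen p a) := by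
  cases p
  · rw [exchangeSign, one_smul]
    exact mul_comm (MvPolynomial.X a : MvPolynomial I ℂ) (MvPolynomial.X b)
  · rw [exchangeSign, neg_one_smul]
    exact grassmannGen_mul_comm a b

/-- The Gaussian integral, as a linear map. -/
def integralLinear (g : Matrix I I ℂ) : (p : Bool) → Alg I p →ₗ[ℂ] ℂ
  | false => gaussLinear ∘ₗ (contourSubst g).toLinearMap
  | true => berezinLinear ∘ₗ LinearMap.mulLeft ℂ (grassmannWeight g)

/-- A nondegenerate form of the symmetry that the components require. -/
structure IsGradedForm (p : Bool) (g : Matrix I I ℂ) : Prop where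
  transpose_eq : g.transpose = exchangeSign p • g
  mul_self : g * g = exchangeSign p • 1

variable {p : Bool} {g : Matrix I I ℂ}

theorem IsGradedForm.apply_comm (hg : IsGradedForm p g) (a b : I) :
    g a b = exchangeSign p * g b a :=
  congrFun (congrFun hg.transpose_eq b) a

theorem IsGradedForm.sum_mul (hg : IsGradedForm p g) (a b : I) :
    ∑ c, g a c * g c b = exchangeSign p * if a = b then 1 else 0 := by
  simpa [Matrix.mul_apply, Matrix.one_apply] using congrFun (congrFun hg.mul_self a) b

theorem gaussianIntegral_eq (hg : IsGradedForm p g) (f : Alg I p) :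
    gaussianIntegral g p f = integralLinear g p f := by
  cases p
  · have h1 : g.transpose = g := by simpa [exchangeSign] using hg.transpose_eq
    have h2 : g * g = 1 := by simpa [exchangeSign] using hg.mul_self
    refine MeasureTheory.integral_congr_ae (MeasureTheory.ae_of_all _ fun x => ?_)
    exact congrArg₂ (· * ·) (exp_quadratic_contour g h1 h2 x) (eval_contour g x f)
  · exact (berezinLinear_apply _).symm

theorem integralLinear_one_ne_zero (hg : IsGradedForm p g) : integralLinear g p 1 ≠ 0 := by
  cases p
  · show gaussLinear (contourSubst g 1) ≠ 0
    rw [map_one]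
    exact gaussLinear_one_ne_zero
  · show berezinLinear (grassmannWeight g * 1) ≠ 0
    rw [mul_one]
    exact berezin_weight_ne_zero g (by simpa [exchangeSign] using hg.transpose_eq)
      (by simpa [exchangeSign] using hg.mul_self)

theorem integralLinear_gen_mul (hg : IsGradedForm p g) (e : I) (f : Alg I p) :
    integralLinear g p (Alg.gen p e * f) =
      ∑ a, g a e * integralLinear g p (Alg.deriv p a f) := by
  cases p
  · exact gaussLinear_contour_X_mul g (by simpa [exchangeSign] using hg.transpose_eq)
      (by simpa [exchangeSign] using hg.mul_self) e f
  · exact berezin_weight_gen_mul g (by simpa [exchangeSign] using hg.transpose_eq)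
      (by simpa [exchangeSign] using hg.mul_self) e f

/-- The normalized Gaussian integral, as a linear map. -/
def meanLinear (p : Bool) (g : Matrix I I ℂ) : Alg I p →ₗ[ℂ] ℂ :=
  (integralLinear g p 1)⁻¹ • integralLinear g p

theorem gaussianMean_eq (hg : IsGradedForm p g) (f : Alg I p) :
    gaussianMean g p f = meanLinear p g f := by
  rw [gaussianMean, gaussianIntegral_eq hg, gaussianIntegral_eq hg, div_eq_inv_mul]
  rfl

theorem meanLinear_one (hg : IsGradedForm p g) : meanLinear p g 1 = 1 :=
  inv_mul_cancel₀ (integralLinear_one_ne_zero hg)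

/-- For `f = T^a` this reads `⟨T^e T^a⟩ = g a e`, which is the `(e, a)` entry of `g⁻¹ = gᵀ`. The
reversed arguments of `g` in Wick's theorem come from here. -/
theorem meanLinear_gen_mul (hg : IsGradedForm p g) (e : I) (f : Alg I p) :
    meanLinear p g (Alg.gen p e * f) = ∑ a, g a e * meanLinear p g (Alg.deriv p a f) := by
  simp only [meanLinear, LinearMap.smul_apply, integralLinear_gen_mul hg, smul_eq_mul,
    Finset.mul_sum]
  exact Finset.sum_congr rfl fun a _ => by ring

/-- Graded Leibniz rule: to reach factor `j` the derivative passes `j` generators, each with an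
exchange sign. -/
theorem Alg.deriv_prod_ofFn (p : Bool) (a : I) (n : ℕ) (b : Fin (n + 1) → I) :
    Alg.deriv p a (List.ofFn fun i => Alg.gen p (b i)).prod =
      ∑ j : Fin (n + 1), (exchangeSign p ^ (j : ℕ) * if a = b j then 1 else 0) •
        (List.ofFn fun i => Alg.gen p (b (j.succAbove i))).prod := by
  induction n with
  | zero =>
    rw [List.ofFn_succ, List.prod_cons, Alg.deriv_gen_mul, Fin.sum_univ_succ, Fin.sum_univ_zero]
    simp [Alg.deriv_one]
  | succ n ih =>
    rw [List.ofFn_succ, List.prod_cons, Alg.deriv_gen_mul, ih fun i => b i.succ,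
      Fin.sum_univ_succ (n := n + 1)]
    congr 1
    · simp
    · rw [Finset.mul_sum, Finset.smul_sum]
      refine Finset.sum_congr rfl fun j _ => ?_
      rw [List.ofFn_succ (f := fun i => Alg.gen p (b (j.succ.succAbove i))), List.prod_cons,
        mul_smul_comm, smul_smul]
      simp [pow_succ']

/-- The recursion of Wick's theorem. -/
theorem meanLinear_prod_ofFn (hg : IsGradedForm p g) (n : ℕ) (b : Fin (n + 2) → I) :
    meanLinear p g (List.ofFn fun i => Alg.gen p (b i)).prod =
      ∑ j : Fin (n + 1), exchangeSign p ^ (j : ℕ) * g (b j.succ) (b 0) *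
        meanLinear p g (List.ofFn fun i => Alg.gen p (b (j.succAbove i).succ)).prod := by
  rw [List.ofFn_succ, List.prod_cons, meanLinear_gen_mul hg]
  simp only [Alg.deriv_prod_ofFn p _ n fun i => b i.succ, map_sum, map_smul, Finset.mul_sum]
  rw [Finset.sum_comm]
  refine Finset.sum_congr rfl fun j _ => ?_
  simp only [smul_eq_mul, mul_ite, mul_one, mul_zero, ite_mul, zero_mul, Finset.sum_ite_eq',
    Finset.mem_univ, if_true]
  ring

/-- The Euler operator multiplies a product of generators by its degree. -/
theorem Alg.sum_gen_mul_deriv (p : Bool) (l : List I) :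
    ∑ a, Alg.gen p a * Alg.deriv p a (l.map (Alg.gen p)).prod =
      (l.length : ℂ) • (l.map (Alg.gen p)).prod := by
  induction l with
  | nil => simp [Alg.deriv_one]
  | cons b l ih =>
    simp only [List.map_cons, List.prod_cons, Alg.deriv_gen_mul, mul_add, mul_smul_comm,
      Finset.sum_add_distrib, ← mul_assoc]
    -- The sign from passing the derivative over `T^b` cancels the one from exchanging `T^a` and
    -- `T^b`, so the Euler operator is an even derivation.
    have h (a : I) : exchangeSign p • (Alg.gen p a * Alg.gen p b * Alg.deriv p a
        (l.map (Alg.gen p)).prod) = Alg.gen p b * (Alg.gen p a * Alg.deriv p a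
        (l.map (Alg.gen p)).prod) := by
      rw [Alg.gen_mul_gen p a b, smul_mul_assoc, smul_smul, exchangeSign_mul_self, one_smul,
        mul_assoc]
    simp only [h, ← Finset.mul_sum, ih, mul_smul_comm, List.length_cons, Nat.cast_succ, add_smul,
      one_smul]
    rw [add_comm]
    simp

/-- The Schwinger–Dyson equation of the quadratic element. -/
theorem meanLinear_quadratic_mul (hg : IsGradedForm p g) (l : List I) :
    meanLinear p g (quadratic p g * (l.map (Alg.gen p)).prod) =
      (exchangeSign p * Fintype.card I + l.length) *
        meanLinear p g (l.map (Alg.gen p)).prod := by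
  set f := (l.map (Alg.gen p)).prod with hf
  -- Eliminating the first factor `T^a` contracts `g` with the propagator to the exchange sign times
  -- the identity, leaving `∂_b (T^b f)`. That splits into `f`, once per component, and the Euler
  -- operator, whose two signs cancel.
  have h1 : meanLinear p g (quadratic p g * f) =
      ∑ b, exchangeSign p * meanLinear p g (Alg.deriv p b (Alg.gen p b * f)) := by
    simp only [quadratic, Finset.sum_mul, smul_mul_assoc, map_sum, map_smul, mul_assoc,
      meanLinear_gen_mul hg, smul_eq_mul]
    rw [Finset.sum_comm]
    refine Finset.sum_congr rfl fun b _ => ?_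
    simp only [Finset.mul_sum]
    rw [Finset.sum_comm]
    simp only [← mul_assoc, ← Finset.sum_mul]
    rw [Finset.sum_eq_single b]
    · congr 1
      simpa [mul_comm] using hg.sum_mul b b
    · intro d _ hd
      have := hg.sum_mul d b
      rw [if_neg hd, mul_zero] at this
      simp only [mul_comm (g _ b), this, zero_mul]
    · simp
  rw [h1]
  simp only [Alg.deriv_gen_mul, if_true, one_smul, map_add, map_smul, smul_eq_mul, mul_add,
    Finset.sum_add_distrib, ← mul_assoc, exchangeSign_mul_self, one_mul, ← map_sum]
  rw [Alg.sum_gen_mul_deriv, map_smul, smul_eq_mul]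
  simp only [Finset.sum_const, Finset.card_univ, nsmul_eq_mul]
  ring

end Mean

/-! ## Pairings, orientations and signs -/

@[ext]
theorem Pairing.ext {V : Type*} {P Q : Pairing V} (h : ∀ v, P.mate v = Q.mate v) : P = Q := by
  cases P
  cases Q
  congr 1
  exact funext h

instance {V : Type*} [Finite V] : Finite (Pairing V) :=
  Finite.of_injective Pairing.mate fun _ _ h => Pairing.ext fun v => congrFun h v

instance {V : Type*} [Finite V] : Fintype (Pairing V) := Fintype.ofFinite _

theorem Pairing.mate_eq_iff {V : Type*} (P : Pairing V) {v w : V} :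
    P.mate v = w ↔ v = P.mate w :=
  ⟨fun h => by rw [← h, P.mate_mate], fun h => by rw [h, P.mate_mate]⟩

theorem Pairing.exists_orientation {V : Type*} [Finite V] (P : Pairing V) :
    Nonempty P.Orientation := by
  classical
  cases nonempty_fintype V
  let e := Fintype.equivFin V
  refine ⟨⟨Finset.univ.filter fun v => e v < e (P.mate v), fun v => ?_⟩⟩
  have : e v ≠ e (P.mate v) := fun h => P.mate_ne v (e.injective h).symm
  simp only [Finset.mem_filter, Finset.mem_univ, true_and, P.mate_mate, not_lt]
  exact ⟨le_of_lt, fun h => lt_of_le_of_ne h this.symm⟩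

/-- An arbitrary direction of a pairing. -/
def Pairing.orient {V : Type*} [Finite V] (P : Pairing V) : P.Orientation :=
  Classical.choice P.exists_orientation

theorem Carries.trans {V : Type*} {P Q R : Pairing V} {o : P.Orientation} {o' : Q.Orientation}
    {o'' : R.Orientation} {σ τ : Equiv.Perm V} (h : Carries o o' σ) (h' : Carries o' o'' τ) :
    Carries o o'' (τ * σ) :=
  ⟨fun v => by simp [h.1, h'.1], fun v => by simp [h.2, h'.2]⟩

section Sign

variable {V : Type*} [Fintype V] [DecidableEq V]

/-- The cocycle property: carrying permutations compose. It is what later removes the reference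
pairing. -/
theorem pairingSign_mul {P Q R : Pairing V} (o : P.Orientation) (o' : Q.Orientation)
    (o'' : R.Orientation) : pairingSign o o' * pairingSign o' o'' = pairingSign o o'' := by
  obtain ⟨σ, hσ⟩ := exists_carries o o'
  obtain ⟨τ, hτ⟩ := exists_carries o' o''
  rw [pairingSign_eq _ _ _ hσ, pairingSign_eq _ _ _ hτ, pairingSign_eq _ _ _ (hσ.trans hτ),
    Equiv.Perm.sign_mul, mul_comm]

theorem pairingSign_self {P : Pairing V} (o : P.Orientation) : pairingSign o o = 1 := by
  rw [pairingSign_eq o o 1 ⟨fun _ => rfl, fun _ => Iff.rfl⟩, Equiv.Perm.sign_one]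

theorem pairingSign_comm {P Q : Pairing V} (o : P.Orientation) (o' : Q.Orientation) :
    pairingSign o o' = pairingSign o' o := by
  have h := pairingSign_mul o o' o
  rw [pairingSign_self, mul_eq_one_iff_eq_inv, Int.units_inv_eq_self] at h
  exact h

/-- The permutation that flips the pairs on which two directions differ. -/
def Pairing.Orientation.flip {P : Pairing V} (o o' : P.Orientation) : Equiv.Perm V :=
  Function.Involutive.toPerm (fun v => if v ∈ o.tail ↔ v ∈ o'.tail then v else P.mate v) <| by
    intro v
    by_cases h : v ∈ o.tail ↔ v ∈ o'.tail
    · simp only [if_pos h]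
    · have h' : ¬(P.mate v ∈ o.tail ↔ P.mate v ∈ o'.tail) := by
        rw [o.mate_mem_tail, o'.mate_mem_tail, not_iff_not]
        exact h
      simp only [if_neg h, if_neg h', P.mate_mate]

theorem Pairing.Orientation.flip_apply {P : Pairing V} (o o' : P.Orientation) (v : V) :
    o.flip o' v = if v ∈ o.tail ↔ v ∈ o'.tail then v else P.mate v := rfl

theorem Pairing.Orientation.carries_flip {P : Pairing V} (o o' : P.Orientation) :
    Carries o o' (o.flip o') := by
  refine ⟨fun v => ?_, fun v => ?_⟩
  · simp only [flip_apply, o.mate_mem_tail, o'.mate_mem_tail, not_iff_not]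
    split_ifs <;> rfl
  · rw [flip_apply]
    split_ifs with h
    · exact h.symm
    · rw [o'.mate_mem_tail]
      tauto

/-- In the coordinates (pair, end) the flip acts on each pair separately, as the identity or as a
transposition. -/
theorem Pairing.Orientation.sign_flip {P : Pairing V} (o o' : P.Orientation) :
    Equiv.Perm.sign (o.flip o') = ∏ v ∈ o.tail, if v ∈ o'.tail then (1 : ℤˣ) else -1 := by
  have key : o.split.permCongr (o.flip o') = Equiv.prodCongrRight
      (fun v : {v // v ∈ o.tail} => if v.1 ∈ o'.tail then 1 else Equiv.swap true false) := by
    ext1 x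
    obtain ⟨⟨v, hv⟩, b⟩ := x
    have hm : P.mate v ∉ o.tail := fun h2 => (o.mate_mem_tail _).1 h2 hv
    by_cases h : v ∈ o'.tail
    · have h' : P.mate v ∉ o'.tail := fun h2 => (o'.mate_mem_tail _).1 h2 h
      cases b <;>
        simp [Equiv.permCongr_apply, Pairing.Orientation.split, flip_apply, hv, hm, h, h',
          P.mate_mate]
    · have h' : P.mate v ∈ o'.tail := (o'.mate_mem_tail _).2 h
      cases b <;>
        simp [Equiv.permCongr_apply, Pairing.Orientation.split, flip_apply, hv, hm, h, h',
          P.mate_mate]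
  rw [← Equiv.Perm.sign_permCongr o.split, key, Equiv.Perm.sign_prodCongrRight]
  refine Eq.trans (Finset.prod_congr rfl fun v _ => ?_)
    (Finset.prod_coe_sort o.tail fun v => if v ∈ o'.tail then (1 : ℤˣ) else -1)
  split_ifs
  · simp
  · exact Equiv.Perm.sign_swap (by decide)

/-- The sign of a directed pairing relative to another one, raised to a parity. -/
def gradedSign {P Q : Pairing V} (b : Bool) (o : P.Orientation) (o' : Q.Orientation) : ℂ :=
  (((pairingSign o o' : ℤˣ) : ℤ) : ℂ) ^ b.toNat

theorem gradedSign_mul {P Q R : Pairing V} (b : Bool) (o : P.Orientation) (o' : Q.Orientation)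
    (o'' : R.Orientation) : gradedSign b o o' * gradedSign b o' o'' = gradedSign b o o'' := by
  rw [gradedSign, gradedSign, gradedSign, ← mul_pow, ← pairingSign_mul o o' o'']
  push_cast
  rfl

theorem gradedSign_comm {P Q : Pairing V} (b : Bool) (o : P.Orientation) (o' : Q.Orientation) :
    gradedSign b o o' = gradedSign b o' o := by
  rw [gradedSign, gradedSign, pairingSign_comm]

/-- The product of a kernel over the directed pairs. -/
def orientedProd {P : Pairing V} (o : P.Orientation) (K : V → V → ℂ) : ℂ :=
  ∏ v ∈ o.tail, K v (P.mate v)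

/-- Reversing one pair changes both the pairing sign, raised to the parity, and the kernel by the
same exchange sign. -/
theorem gradedSign_mul_orientedProd {P : Pairing V} (b : Bool) (o o' : P.Orientation)
    (K : V → V → ℂ) (hK : ∀ v w, K v w = exchangeSign b * K w v) :
    gradedSign b o o' * orientedProd o' K = orientedProd o K := by
  have h1 : gradedSign b o o' = ∏ v ∈ o.tail, if v ∈ o'.tail then 1 else exchangeSign b := by
    rw [gradedSign, pairingSign_eq _ _ _ (o.carries_flip o'), o.sign_flip]
    push_cast
    rw [← Finset.prod_pow]
    refine Finset.prod_congr rfl fun v _ => ?_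
    rw [exchangeSign_eq_pow]
    split_ifs <;> simp
  have h2 : orientedProd o' K = ∏ v ∈ o.tail, K (o.flip o' v) (P.mate (o.flip o' v)) := by
    refine (Finset.prod_equiv (o.flip o') (fun v => ?_) fun v _ => rfl).symm
    exact ((o.carries_flip o').2 v).symm
  rw [h1, h2, orientedProd, ← Finset.prod_mul_distrib]
  refine Finset.prod_congr rfl fun v hv => ?_
  rw [Pairing.Orientation.flip_apply]
  by_cases h : v ∈ o'.tail
  · simp [h, hv]
  · simp only [h, hv, if_false, true_iff, P.mate_mate]
    exact (hK _ _).symm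

/-- The signed product does not depend on the direction. -/
theorem gradedSign_mul_orientedProd_eq {P R : Pairing V} (b : Bool) (r : R.Orientation)
    (o o' : P.Orientation) (K : V → V → ℂ) (hK : ∀ v w, K v w = exchangeSign b * K w v) :
    gradedSign b r o' * orientedProd o' K = gradedSign b r o * orientedProd o K := by
  rw [← gradedSign_mul_orientedProd b o o' K hK, ← mul_assoc, gradedSign_mul]

end Sign

/-! ## Wick's theorem -/

/-- The position, among `n + 2` points, of the `i`-th one that is left when the first one and
the one with number `j + 1` are removed. -/
def skipTwo {n : ℕ} (j : Fin (n + 1)) (i : Fin n) : Fin (n + 2) := (j.succAbove i).succ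

theorem skipTwo_injective {n : ℕ} (j : Fin (n + 1)) : Function.Injective (skipTwo j) :=
  (Fin.succ_injective _).comp Fin.succAbove_right_injective

theorem skipTwo_ne_zero {n : ℕ} (j : Fin (n + 1)) (i : Fin n) : skipTwo j i ≠ 0 :=
  Fin.succ_ne_zero _

theorem skipTwo_ne_succ {n : ℕ} (j : Fin (n + 1)) (i : Fin n) : skipTwo j i ≠ j.succ :=
  fun h => Fin.succAbove_ne j i (Fin.succ_injective _ h)

theorem skipTwo_cases {n : ℕ} (j : Fin (n + 1)) (v : Fin (n + 2)) :
    v = 0 ∨ v = j.succ ∨ ∃ i, v = skipTwo j i := by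
  induction v using Fin.cases with
  | zero => exact Or.inl rfl
  | succ v =>
    by_cases h : v = j
    · exact Or.inr (Or.inl (by rw [h]))
    · obtain ⟨i, hi⟩ := Fin.exists_succAbove_eq h
      exact Or.inr (Or.inr ⟨i, by rw [skipTwo, hi]⟩)

/-- Add the pair `{0, j + 1}` to a pairing of the other points. -/
def Pairing.insertPair {n : ℕ} (j : Fin (n + 1)) (P : Pairing (Fin n)) :
    Pairing (Fin (n + 2)) where
  mate := Fin.cons j.succ (j.insertNth 0 fun i => skipTwo j (P.mate i))
  mate_mate v := by
    rcases skipTwo_cases j v with rfl | rfl | ⟨i, rfl⟩ <;> simp [skipTwo, P.mate_mate]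
  mate_ne v := by
    rcases skipTwo_cases j v with rfl | rfl | ⟨i, rfl⟩
    · simp
    · simp [Fin.succ_ne_zero, eq_comm]
    · simp [skipTwo, P.mate_ne]

theorem Pairing.insertPair_zero {n : ℕ} (j : Fin (n + 1)) (P : Pairing (Fin n)) :
    (P.insertPair j).mate 0 = j.succ := rfl

theorem Pairing.insertPair_succ {n : ℕ} (j : Fin (n + 1)) (P : Pairing (Fin n)) :
    (P.insertPair j).mate j.succ = 0 := by
  simp [insertPair]

theorem Pairing.insertPair_skipTwo {n : ℕ} (j : Fin (n + 1)) (P : Pairing (Fin n)) (i : Fin n) :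
    (P.insertPair j).mate (skipTwo j i) = skipTwo j (P.mate i) := by
  simp [insertPair, skipTwo]

/-- A pairing is the partner of the first point together with a pairing of the remaining points.
This matches the recursion of Wick's theorem. -/
theorem Pairing.insertPair_bijective (n : ℕ) : Function.Bijective
    fun x : Fin (n + 1) × Pairing (Fin n) => x.2.insertPair x.1 := by
  constructor
  · rintro ⟨j, P⟩ ⟨j', P'⟩ h
    have h1 : j = j' := by
      have := congrArg (fun P => P.mate 0) h
      simpa [insertPair_zero] using this
    subst h1
    refine Prod.ext rfl (Pairing.ext fun i => skipTwo_injective j ?_)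
    have := congrArg (fun P => P.mate (skipTwo j i)) h
    simpa only [insertPair_skipTwo] using this
  · intro P
    obtain ⟨j, hj⟩ := Fin.exists_succ_eq.2 (P.mate_ne 0)
    have hj' : P.mate j.succ = 0 := by rw [hj, P.mate_mate]
    have hf (i : Fin n) : ∃ i', P.mate (skipTwo j i) = skipTwo j i' := by
      rcases skipTwo_cases j (P.mate (skipTwo j i)) with h | h | h
      · rw [P.mate_eq_iff, ← hj] at h
        exact absurd h (skipTwo_ne_succ j i)
      · rw [P.mate_eq_iff, hj'] at h
        exact absurd h (skipTwo_ne_zero j i)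
      · exact h
    choose f hf using hf
    refine ⟨⟨j, ⟨f, fun i => ?_, fun i h => ?_⟩⟩, ?_⟩
    · apply skipTwo_injective j
      rw [← hf, ← hf, P.mate_mate]
    · have := hf i
      rw [h] at this
      exact P.mate_ne _ this
    · refine Pairing.ext fun v => ?_
      rcases skipTwo_cases j v with rfl | rfl | ⟨i, rfl⟩
      · exact hj
      · exact (insertPair_succ _ _).trans hj'.symm
      · exact (insertPair_skipTwo _ _ _).trans (hf i).symm

/-- The direction of the new pair is from `0` to `j + 1`. -/
def Pairing.Orientation.insertPair {n : ℕ} (j : Fin (n + 1)) {P : Pairing (Fin n)}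
    (o : P.Orientation) : (P.insertPair j).Orientation where
  tail := insert 0 (o.tail.map ⟨skipTwo j, skipTwo_injective j⟩)
  mate_mem_tail v := by
    rcases skipTwo_cases j v with rfl | rfl | ⟨i, rfl⟩
    · simp [Pairing.insertPair_zero, skipTwo_ne_succ, Fin.succ_ne_zero]
    · simp [Pairing.insertPair_succ, skipTwo_ne_succ, Fin.succ_ne_zero]
    · simp [Pairing.insertPair_skipTwo, skipTwo_ne_zero, o.mate_mem_tail]

theorem orientedProd_insertPair {n : ℕ} (j : Fin (n + 1)) {P : Pairing (Fin n)}
    (o : P.Orientation) (K : Fin (n + 2) → Fin (n + 2) → ℂ) :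
    orientedProd (o.insertPair j) K =
      K 0 j.succ * orientedProd o fun v w => K (skipTwo j v) (skipTwo j w) := by
  rw [orientedProd, Pairing.Orientation.insertPair, Finset.prod_insert, Finset.prod_map]
  · simp [orientedProd, Pairing.insertPair_skipTwo, Pairing.insertPair_zero]
  · simp [skipTwo_ne_zero]

/-- Moving the partner of `0` from position `1` to position `j + 1` is a cycle of length `j + 1`, of
sign `(-1)^j`. -/
theorem pairingSign_insertPair {k : ℕ} (j : Fin (2 * k + 1)) {P : Pairing (Fin (2 * k))}
    (o : P.Orientation) :
    pairingSign (refOrientation (k + 1)) (V := Fin (2 * k + 2)) (o.insertPair j) =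
      (-1) ^ (j : ℕ) * pairingSign (refOrientation k) o := by
  obtain ⟨σ, hσ⟩ := exists_carries (refOrientation k) o
  rw [pairingSign_eq _ _ _ hσ]
  -- The right factor fixes `0` and `1` and acts as `σ` on the other points. The left one fixes `0`,
  -- sends `1` to `j + 1` and keeps the order of the rest.
  set τ : Equiv.Perm (Fin (2 * k + 2)) := Equiv.Perm.decomposeFin.symm (0, j.cycleRange.symm) *
    Equiv.Perm.decomposeFin.symm (0, Equiv.Perm.decomposeFin.symm (0, σ)) with hτ
  have h0 : τ 0 = 0 := by simp [hτ]
  have h1 : τ 1 = j.succ := by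
    rw [← Fin.succ_zero_eq_one]
    simp [hτ, -Fin.succ_zero_eq_one]
  have h2 (i : Fin (2 * k)) : τ i.succ.succ = skipTwo j (σ i) := by
    simp [hτ, skipTwo, Equiv.Perm.decomposeFin_symm_apply_succ]
  rw [pairingSign_eq _ _ τ]
  · simp [hτ, Equiv.Perm.decomposeFin.symm_sign]
  · have m0 : (refPairing (k + 1)).mate (0 : Fin (2 * k + 2)) = (1 : Fin (2 * k + 2)) := by
      simp [refPairing]
    have m1 : (refPairing (k + 1)).mate (1 : Fin (2 * k + 2)) = (0 : Fin (2 * k + 2)) := by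
      simp only [refPairing, Fin.ext_iff, Fin.val_one]
      rfl
    have m2 (i : Fin (2 * k)) : (refPairing (k + 1)).mate (i.succ.succ : Fin (2 * k + 2)) =
        (((refPairing k).mate i).succ.succ : Fin (2 * k + 2)) := by
      have : (i.1 + 1 + 1) % 2 = i.1 % 2 := by omega
      apply Fin.ext
      by_cases h : i.1 % 2 = 0
      · simp [refPairing, this, h]
      · simp [refPairing, this, h]
        omega
    have t0 : (0 : Fin (2 * k + 2)) ∈ (refOrientation (k + 1)).tail := by simp [refOrientation]
    have t1 : (1 : Fin (2 * k + 2)) ∉ (refOrientation (k + 1)).tail := by simp [refOrientation]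
    have t2 (i : Fin (2 * k)) : (i.succ.succ : Fin (2 * k + 2)) ∈ (refOrientation (k + 1)).tail ↔
        i ∈ (refOrientation k).tail := by
      simp only [refOrientation, Finset.mem_filter, Finset.mem_univ, true_and, Fin.val_succ]
      omega
    refine ⟨fun v => ?_, fun v => ?_⟩
    · refine Fin.cases ?_ (fun v => Fin.cases ?_ (fun i => ?_) v) v
      · rw [m0, h0, h1]
        rfl
      · erw [m1]
        rw [Fin.succ_zero_eq_one, h0, h1, Pairing.insertPair_succ]
      · rw [m2, h2, h2, hσ.1, Pairing.insertPair_skipTwo]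
    · refine Fin.cases ?_ (fun v => Fin.cases ?_ (fun i => ?_) v) v
      · rw [h0]
        simp [t0, Pairing.Orientation.insertPair]
      · rw [Fin.succ_zero_eq_one, h1]
        simp [t1, Pairing.Orientation.insertPair, skipTwo_ne_succ, Fin.succ_ne_zero]
      · rw [h2, t2, ← hσ.2]
        simp [Pairing.Orientation.insertPair, skipTwo_ne_zero]

section Wick

variable {I : Type} [Fintype I] [DecidableEq I] {p : Bool} {g : Matrix I I ℂ}

/-- **Wick's theorem.** -/
theorem meanLinear_prod_ofFn_eq_sum_pairing (hg : IsGradedForm p g) (k : ℕ)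
    (a : Fin (2 * k) → I) :
    meanLinear p g (List.ofFn fun i => Alg.gen p (a i)).prod =
      ∑ P : Pairing (Fin (2 * k)), gradedSign p (refOrientation k) P.orient *
        orientedProd P.orient fun v w => g (a w) (a v) := by
  have hK {n : ℕ} (a : Fin n → I) (v w) : g (a w) (a v) = exchangeSign p * g (a v) (a w) :=
    hg.apply_comm _ _
  induction k with
  | zero =>
    have : Subsingleton (Pairing (Fin (2 * 0))) := ⟨fun P Q => Pairing.ext fun v => v.elim0⟩
    have hp (P : Pairing (Fin (2 * 0))) : P.orient.tail = ∅ := by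
      ext v
      exact v.elim0
    have : IsEmpty (Fin (2 * 0)) := inferInstanceAs (IsEmpty (Fin 0))
    rw [Fintype.sum_subsingleton _ (refPairing 0), List.ofFn_zero, List.prod_nil,
      meanLinear_one hg]
    simp [orientedProd, hp, gradedSign, pairingSign,
      Subsingleton.elim (exists_carries (refOrientation 0) _).choose 1]
  | succ k ih =>
    refine (meanLinear_prod_ofFn hg (2 * k) a).trans ?_
    refine Eq.trans ?_ ((Pairing.insertPair_bijective (2 * k)).sum_comp _)
    rw [Fintype.sum_prod_type]
    refine Finset.sum_congr rfl fun j _ => ?_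
    rw [ih fun i => a (j.succAbove i).succ, Finset.mul_sum]
    refine Finset.sum_congr rfl fun P _ => ?_
    -- The arbitrary direction of the enlarged pairing may be replaced by the one inserted from the
    -- smaller pairing, for which the sign is known.
    refine Eq.trans ?_ (gradedSign_mul_orientedProd_eq p (refOrientation (k + 1))
      ((P.insertPair j).orient) (P.orient.insertPair j) _ (hK a))
    refine Eq.trans ?_ (congrArg (_ * ·) (orientedProd_insertPair j P.orient _).symm)
    have hs : gradedSign p (refOrientation (k + 1)) (V := Fin (2 * k + 2)) (P.orient.insertPair j) =
        exchangeSign p ^ (j : ℕ) * gradedSign p (refOrientation k) P.orient := by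
      rw [gradedSign, pairingSign_insertPair, gradedSign, exchangeSign_eq_pow]
      push_cast
      rw [mul_pow, pow_right_comm]
    refine Eq.trans ?_ (congrArg (· * _) hs.symm)
    simp only [skipTwo]
    ring

end Wick

/-! ## Faces -/

/-- The number of functions that are constant on the classes of a quotient. -/
theorem card_functions_quot {V X : Type*} [Fintype V] [Fintype X] (r : V → V → Prop) :
    Nat.card {a : V → X // ∀ v w, r v w → a v = a w} = Fintype.card X ^ Nat.card (Quot r) := by
  classical
  have : Finite (Quot r) := Quot.finite r
  let e : {a : V → X // ∀ v w, r v w → a v = a w} ≃ (Quot r → X) :=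
    { toFun := fun a => Quot.lift a.1 a.2
      invFun := fun f => ⟨fun v => f (Quot.mk r v), fun v w h => congrArg f (Quot.sound h)⟩
      left_inv := fun a => rfl
      right_inv := fun f => by
        ext q
        induction q using Quot.ind
        rfl }
  rw [Nat.card_congr e, Nat.card_fun, Nat.card_eq_fintype_card]

/-- The faces of two pairings count the functions that are invariant under both of them. -/
theorem card_invariant_functions {V X : Type*} [Fintype V] [Fintype X] (P Q : Pairing V) :
    Nat.card {a : V → X // (∀ v, a (P.mate v) = a v) ∧ ∀ v, a (Q.mate v) = a v} =
      Fintype.card X ^ faces P Q := by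
  rw [faces, SimpleGraph.ConnectedComponent, ← card_functions_quot]
  refine Nat.card_congr (Equiv.subtypeEquivRight fun a => ?_)
  constructor
  · rintro ⟨h1, h2⟩ v w ⟨u⟩
    induction u with
    | nil => rfl
    | cons h _ ih =>
      rw [← ih]
      rw [SimpleGraph.fromRel_adj] at h
      rcases h.2 with (h | h) | (h | h)
      · rw [← h, h1]
      · rw [← h, h2]
      · rw [← h, h1]
      · rw [← h, h2]
  · intro h
    refine ⟨fun v => (h _ _ ?_).symm, fun v => (h _ _ ?_).symm⟩
    · refine SimpleGraph.Adj.reachable ?_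
      rw [SimpleGraph.fromRel_adj]
      exact ⟨(P.mate_ne v).symm, Or.inl (Or.inl rfl)⟩
    · refine SimpleGraph.Adj.reachable ?_
      rw [SimpleGraph.fromRel_adj]
      exact ⟨(Q.mate_ne v).symm, Or.inl (Or.inr rfl)⟩

/-- The number of cycles of a permutation, including the fixed points. -/
def cycleCount {A : Type*} (τ : Equiv.Perm A) : ℕ := Nat.card (Quot τ.SameCycle)

theorem card_functions_perm {A X : Type*} [Fintype A] [Fintype X] (τ : Equiv.Perm A) :
    Nat.card {x : A → X // ∀ v, x (τ v) = x v} = Fintype.card X ^ cycleCount τ := by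
  rw [cycleCount, ← card_functions_quot]
  refine Nat.card_congr (Equiv.subtypeEquivRight fun x => ⟨?_, fun h v => (h _ _ ?_).symm⟩)
  · rintro h v w ⟨n, rfl⟩
    induction n using Int.induction_on with
    | zero => rfl
    | succ n ih =>
      rw [ih, add_comm, zpow_add, zpow_one, Equiv.Perm.mul_apply, h]
    | pred n ih =>
      rw [ih, ← h ((τ ^ (-(n : ℤ) - 1)) v), ← Equiv.Perm.mul_apply, ← zpow_one_add]
      congr 3
      ring
  · exact ⟨1, by simp⟩

/-- `cycleType` omits fixed points, while orbits do not. The bijection sends a cycle factor to the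
orbit of a point of its support and a fixed point to its own orbit. -/
theorem cycleCount_eq {A : Type*} [Fintype A] [DecidableEq A] (τ : Equiv.Perm A) :
    cycleCount τ = τ.cycleType.card + Fintype.card {v // τ v = v} := by
  classical
  have hc : τ.cycleType.card = Fintype.card τ.cycleFactorsFinset := by
    rw [Equiv.Perm.cycleType_def, Multiset.card_map, Fintype.card_coe]
    rfl
  have hx (c : τ.cycleFactorsFinset) : ∃ v, v ∈ c.1.support := by
    have := (Equiv.Perm.mem_cycleFactorsFinset_iff.1 c.2).1.nonempty_support
    exact this
  choose x hx using hx
  rw [hc, ← Fintype.card_sum, ← Nat.card_eq_fintype_card, cycleCount]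
  symm
  refine Nat.card_eq_of_bijective (Sum.elim (fun c => Quot.mk _ (x c)) fun v => Quot.mk _ v.1) ?_
  have hq {v w : A} (h : Quot.mk τ.SameCycle v = Quot.mk τ.SameCycle w) : τ.SameCycle v w :=
    (Quot.eqvGen_exact h).rec (fun _ _ h => h) (fun _ => .refl _ _) (fun _ _ _ => .symm)
      fun _ _ _ _ _ => .trans
  have hfix {v w : A} (hv : τ v = v) (h : τ.SameCycle v w) : v = w :=
    Equiv.Perm.SameCycle.eq_of_left h hv
  have hcyc (c : τ.cycleFactorsFinset) : c.1 = τ.cycleOf (x c) :=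
    Equiv.Perm.cycle_is_cycleOf (hx c) c.2
  constructor
  · rintro (c | v) (c' | v') h
    · have := (hq h).cycleOf_eq
      rw [← hcyc, ← hcyc] at this
      rw [Subtype.ext this]
    · exfalso
      have := hfix v'.2 (hq h).symm
      have h2 := Equiv.Perm.mem_cycleFactorsFinset_support_le c.2 (hx c)
      rw [← this, Equiv.Perm.mem_support] at h2
      exact h2 v'.2
    · exfalso
      have := hfix v.2 (hq h)
      have h2 := Equiv.Perm.mem_cycleFactorsFinset_support_le c'.2 (hx c')
      rw [← this, Equiv.Perm.mem_support] at h2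
      exact h2 v.2
    · rw [Subtype.ext (hfix v.2 (hq h))]
  · intro q
    induction q using Quot.ind with
    | mk v =>
      by_cases h : τ v = v
      · exact ⟨Sum.inr ⟨v, h⟩, rfl⟩
      · have hm : τ.cycleOf v ∈ τ.cycleFactorsFinset :=
          Equiv.Perm.cycleOf_mem_cycleFactorsFinset_iff.2 (Equiv.Perm.mem_support.2 h)
        refine ⟨Sum.inl ⟨_, hm⟩, Quot.sound ?_⟩
        exact ((Equiv.Perm.mem_support_cycleOf_iff.1 (hx ⟨_, hm⟩)).1).symm

theorem sign_eq_neg_one_pow_cycleCount {A : Type*} [Fintype A] [DecidableEq A]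
    (τ : Equiv.Perm A) :
    Equiv.Perm.sign τ = (-1) ^ (Fintype.card A + cycleCount τ) := by
  have h1 : Fintype.card A = τ.cycleType.sum + Fintype.card {v // τ v = v} := by
    rw [Equiv.Perm.sum_cycleType, Fintype.card_subtype, Equiv.Perm.support,
      ← Finset.card_univ, ← Finset.card_filter_add_card_filter_not (s := Finset.univ)
        (fun v => τ v ≠ v)]
    simp
  rw [Equiv.Perm.sign_of_cycleType, cycleCount_eq, h1]
  rw [show τ.cycleType.sum + Fintype.card {v // τ v = v} +
      (τ.cycleType.card + Fintype.card {v // τ v = v}) = τ.cycleType.sum + τ.cycleType.card +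
      2 * Fintype.card {v // τ v = v} by ring, pow_add _ _ (2 * _), pow_mul]
  simp

/-- The involution of a pairing as a permutation. -/
def Pairing.perm {V : Type*} (P : Pairing V) : Equiv.Perm V :=
  Function.Involutive.toPerm P.mate P.mate_mate

/-- The union of two pairings is bipartite: there are directions of the two pairings with the
same set of tails. -/
theorem Pairing.exists_common_tail {V : Type*} [Finite V] (P Q : Pairing V) :
    ∃ (o : P.Orientation) (o' : Q.Orientation), o.tail = o'.tail := by
  classical
  cases nonempty_fintype V
  set ρ : Equiv.Perm V := Q.perm * P.perm with hρ
  have hρv (v : V) : ρ v = Q.mate (P.mate v) := rfl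
  -- The two involutions generate a dihedral action: `P` conjugates `ρ = Q P` to its inverse and
  -- therefore permutes the orbits of `ρ`.
  have hc (n : ℤ) (v : V) : P.mate ((ρ ^ n) v) = (ρ ^ (-n)) (P.mate v) := by
    have h1 : SemiconjBy P.perm ρ ρ⁻¹ := by
      have hP : P.perm⁻¹ = P.perm := rfl
      have hQ : Q.perm⁻¹ = Q.perm := rfl
      rw [SemiconjBy, hρ, mul_inv_rev, hP, hQ, mul_assoc]
    have h2 := DFunLike.congr_fun (h1.zpow_right n) v
    rw [inv_zpow, ← zpow_neg] at h2
    exact h2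
  have hP {v w : V} (h : ρ.SameCycle v w) : ρ.SameCycle (P.mate v) (P.mate w) := by
    obtain ⟨n, rfl⟩ := h
    exact ⟨-n, (hc n v).symm⟩
  -- If `P v = ρ^n v`, then for `n = 2m` the point `ρ^m v` is fixed by `P`, and for `n = 2m + 1` the
  -- point `P (ρ^m v)` is fixed by `Q`. Neither involution has fixed points.
  have hne (v : V) : ¬ρ.SameCycle (P.mate v) v := by
    intro h
    obtain ⟨n, hn⟩ := h.symm
    rcases Int.even_or_odd' n with ⟨m, rfl | rfl⟩
    · apply P.mate_ne ((ρ ^ m) v)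
      rw [hc, ← hn, ← Equiv.Perm.mul_apply, ← zpow_add]
      congr 2
      ring
    · apply Q.mate_ne (P.mate ((ρ ^ m) v))
      rw [← hρv, hc, ← hn, ← Equiv.Perm.mul_apply, ← Equiv.Perm.mul_apply, ← zpow_add,
        ← zpow_one_add]
      congr 2
      ring
  let s := Equiv.Perm.SameCycle.setoid ρ
  -- `P` and `Q` induce the same pairing of the orbits of `ρ`. A direction of it pulls back to a
  -- common set of tails.
  let R : Pairing (Quotient s) :=
    { mate := Quotient.map P.mate fun _ _ h => hP h
      mate_mate := fun q => by
        induction q using Quotient.ind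
        simp [Quotient.map_mk, P.mate_mate]
      mate_ne := fun q => by
        induction q using Quotient.ind with
        | _ v =>
          exact fun h => hne v (Quotient.exact (s := s) h) }
  obtain ⟨o⟩ := R.exists_orientation
  have h1 (v : V) : Quotient.mk s (P.mate v) ∈ o.tail ↔ Quotient.mk s v ∉ o.tail :=
    o.mate_mem_tail (Quotient.mk s v)
  have h2 (v : V) : Quotient.mk s (Q.mate v) ∈ o.tail ↔ Quotient.mk s v ∉ o.tail := by
    have : Quotient.mk s (Q.mate v) = Quotient.mk s (P.mate v) := by
      refine (Quotient.sound (s := s) (show ρ.SameCycle _ _ from ⟨1, ?_⟩)).symm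
      rw [zpow_one, hρv, P.mate_mate]
    rw [this, h1]
  exact ⟨⟨Finset.univ.filter fun v => Quotient.mk s v ∈ o.tail, by simpa using h1⟩,
    ⟨Finset.univ.filter fun v => Quotient.mk s v ∈ o.tail, by simpa using h2⟩, rfl⟩

theorem gradedSign_mul_self {V : Type*} [Fintype V] [DecidableEq V] {P Q : Pairing V} (b : Bool)
    (o : P.Orientation) (o' : Q.Orientation) : gradedSign b o o' * gradedSign b o o' = 1 := by
  rw [gradedSign, ← mul_pow, ← Int.cast_mul, ← Units.val_mul, Int.units_mul_self]
  simp

/-! ### The contribution of one color. -/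

section SingleColor

variable {V : Type*} [Fintype V] [DecidableEq V] {P Q : Pairing V}

/-- The composition of two pairings, on a common set of tails. -/
def facePerm (o : P.Orientation) (o' : Q.Orientation) (h : o.tail = o'.tail) :
    Equiv.Perm {v // v ∈ o.tail} where
  toFun v := ⟨P.mate (Q.mate v), by
    have h1 (w : V) : w ∈ o.tail ↔ w ∈ o'.tail := by rw [h]
    rw [o.mate_mem_tail, h1, o'.mate_mem_tail, ← h1]
    exact not_not.2 v.2⟩
  invFun v := ⟨Q.mate (P.mate v), by
    have h1 (w : V) : w ∈ o.tail ↔ w ∈ o'.tail := by rw [h]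
    rw [h1, o'.mate_mem_tail, ← h1, o.mate_mem_tail]
    exact not_not.2 v.2⟩
  left_inv v := by simp [P.mate_mate, Q.mate_mate]
  right_inv v := by simp [P.mate_mate, Q.mate_mate]

/-- The carrying permutation can fix the common tails and send the head `P v` to the head `Q v`.
Identifying heads with tails through `P` makes it the face permutation. -/
theorem pairingSign_eq_sign_facePerm (o : P.Orientation) (o' : Q.Orientation)
    (h : o.tail = o'.tail) : pairingSign o o' = Equiv.Perm.sign (facePerm o o' h) := by
  set e : Equiv.Perm ({v // v ∈ o.tail} × Bool) :=
    Equiv.prodCongrLeft fun b : Bool => if b then 1 else facePerm o o' h with he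
  have hs (v : V) (hv : v ∈ o.tail) : o.split v = (⟨v, hv⟩, true) := by
    simp [Pairing.Orientation.split, hv]
  have hs' (v : {v // v ∈ o.tail}) : o.split.symm (v, true) = v := rfl
  have hs'' (v : {v // v ∈ o.tail}) : o.split.symm (v, false) = P.mate v := rfl
  have h1 (v : V) (hv : v ∈ o.tail) : o.split.symm.permCongr e v = v := by
    rw [Equiv.permCongr_apply, Equiv.symm_symm, hs v hv]
    simp [he, hs']
  have h2 (v : V) (hv : v ∈ o.tail) : o.split.symm.permCongr e (P.mate v) = Q.mate v := by
    rw [Equiv.permCongr_apply, Equiv.symm_symm, o.split_mate, hs v hv]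
    simp [he, hs'', facePerm, P.mate_mate]
  rw [pairingSign_eq o o' (o.split.symm.permCongr e), Equiv.Perm.sign_permCongr, he,
    Equiv.Perm.sign_prodCongrLeft]
  · simp
  · refine ⟨fun v => ?_, fun v => ?_⟩ <;> by_cases hv : v ∈ o.tail
    · rw [h1 v hv, h2 v hv]
    · have hv' := (o.mate_mem_tail v).2 hv
      have := h2 _ hv'
      rw [P.mate_mate] at this
      rw [h1 _ hv', this, Q.mate_mate]
    · rw [h1 v hv, h]
    · have hv' := (o.mate_mem_tail v).2 hv
      have := h2 _ hv'
      rw [P.mate_mate] at this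
      rw [this, o'.mate_mem_tail, ← h]
      tauto

/-- The functions that are invariant under two pairings are determined on a common tail. -/
theorem cycleCount_facePerm (o : P.Orientation) (o' : Q.Orientation) (h : o.tail = o'.tail) :
    cycleCount (facePerm o o' h) = faces P Q := by
  -- Both numbers are exponents of 2 in a count of invariant `Bool`-valued functions, so it is
  -- enough to match the functions. The same device proves `faces_map` and `faces_sum`.
  have key : Nat.card {x : {v // v ∈ o.tail} → Bool // ∀ v, x (facePerm o o' h v) = x v} =
      Nat.card {a : V → Bool // (∀ v, a (P.mate v) = a v) ∧ ∀ v, a (Q.mate v) = a v} := by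
    have hx (x : {v // v ∈ o.tail} → Bool) (hx : ∀ v, x (facePerm o o' h v) = x v) (v : V) :
        x (o.split (Q.mate v)).1 = x (o.split v).1 := by
      have h1 (w : V) : w ∈ o.tail ↔ w ∈ o'.tail := by rw [h]
      by_cases hv : v ∈ o.tail
      · have hv' : Q.mate v ∉ o.tail := by
          rw [h1, o'.mate_mem_tail, ← h1]
          exact not_not.2 hv
        have := hx ⟨v, hv⟩
        simpa [Pairing.Orientation.split, hv, hv', facePerm] using this
      · have hv' : Q.mate v ∈ o.tail := by
          rw [h1, o'.mate_mem_tail, ← h1]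
          exact hv
        have := hx ⟨Q.mate v, hv'⟩
        simpa [Pairing.Orientation.split, hv, hv', facePerm, Q.mate_mate] using this.symm
    refine (Nat.card_congr
      { toFun := fun a => ⟨fun v => a.1 v, fun v => by
          simp only [facePerm, Equiv.coe_fn_mk, a.2.1, a.2.2]⟩
        invFun := fun x => ⟨fun v => x.1 (o.split v).1, fun v => by
          simp only [o.split_mate], hx x.1 x.2⟩
        left_inv := fun a => ?_
        right_inv := fun x => ?_ }).symm
    · refine Subtype.ext (funext fun v => ?_)
      by_cases hv : v ∈ o.tail <;> simp [Pairing.Orientation.split, hv, a.2.1]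
    · refine Subtype.ext (funext fun v => ?_)
      simp [Pairing.Orientation.split]
  rw [card_functions_perm, card_invariant_functions, Fintype.card_bool] at key
  exact Nat.pow_right_injective le_rfl key

variable {X : Type*} [Fintype X] [DecidableEq X] {b : Bool} {g : Matrix X X ℂ}

/-- The summation variables split into values `x` on tails and `y` on heads. Each `y` stands between
two factors of `g`, and summing it gives the exchange sign times a delta. The deltas leave the
functions `x` that are constant on the cycles of the face permutation. -/
theorem sum_orientedProd_mul (hg2 : g * g = exchangeSign b • 1)
    (o : P.Orientation) (o' : Q.Orientation) (h : o.tail = o'.tail) :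
    ∑ a : V → X, (orientedProd o fun v w => g (a v) (a w)) *
      (orientedProd o' fun v w => g (a w) (a v)) =
      exchangeSign b ^ o.tail.card * (Fintype.card X : ℂ) ^ faces P Q := by
  set τ := facePerm o o' h with hτ
  let e : V ≃ {v // v ∈ o.tail} ⊕ {v // v ∈ o.tail} :=
    o.split.trans ((Equiv.prodComm _ _).trans (Equiv.boolProdEquivSum _))
  have e1 (v : {v // v ∈ o.tail}) : e v = Sum.inr v := by
    simp [e, Pairing.Orientation.split]
  have e2 (v : {v // v ∈ o.tail}) : e (P.mate v) = Sum.inl v := by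
    have hv := v.2
    have h' : P.mate v ∉ o.tail := fun h2 => (o.mate_mem_tail v).1 h2 hv
    simp [e, Pairing.Orientation.split, h', P.mate_mate]
  let E : (V → X) ≃ ({v // v ∈ o.tail} → X) × ({v // v ∈ o.tail} → X) :=
    (Equiv.arrowCongr e (Equiv.refl X)).trans (Equiv.sumArrowEquivProdArrow _ _ _)
  have hE (y x) (v : V) : E.symm (y, x) v = Sum.elim y x (e v) := rfl
  rw [← E.symm.sum_comp, Fintype.sum_prod_type, Finset.sum_comm]
  have hterm (x y : {v // v ∈ o.tail} → X) :
      (orientedProd o fun v w => g (E.symm (y, x) v) (E.symm (y, x) w)) *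
        (orientedProd o' fun v w => g (E.symm (y, x) w) (E.symm (y, x) v)) =
      ∏ u, g (x u) (y u) * g (y u) (x (τ.symm u)) := by
    rw [Finset.prod_mul_distrib]
    congr 1
    · rw [orientedProd, ← Finset.prod_coe_sort]
      refine Finset.prod_congr rfl fun v _ => ?_
      rw [hE, hE, e1, e2]
      rfl
    · rw [orientedProd, ← h, ← Finset.prod_coe_sort]
      refine Eq.trans ?_ (Equiv.prod_comp τ _)
      refine Finset.prod_congr rfl fun v _ => ?_
      have : Q.mate v = P.mate (τ v) := by simp [hτ, facePerm, P.mate_mate]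
      rw [hE, hE, e1, this, e2, Equiv.symm_apply_apply]
      rfl
  simp only [hterm]
  have hgg (x z : X) : ∑ y, g x y * g y z = exchangeSign b * if x = z then 1 else 0 := by
    simpa [Matrix.mul_apply, Matrix.one_apply] using congrFun (congrFun hg2 x) z
  have hsum (x : {v // v ∈ o.tail} → X) :
      ∑ y : {v // v ∈ o.tail} → X, ∏ u, g (x u) (y u) * g (y u) (x (τ.symm u)) =
      exchangeSign b ^ o.tail.card * if ∀ v, x (τ v) = x v then 1 else 0 := by
    rw [← Fintype.piFinset_univ, ← Finset.prod_univ_sum (fun _ => Finset.univ)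
      fun u y => g (x u) y * g y (x (τ.symm u))]
    simp only [hgg, Finset.prod_mul_distrib, Finset.prod_const, Finset.card_univ,
      Fintype.card_coe]
    congr 1
    refine (Equiv.prod_comp τ _).symm.trans ?_
    simp only [Equiv.symm_apply_apply]
    rw [Finset.prod_ite_zero]
    simp
  simp only [hsum]
  rw [← Finset.mul_sum, ← cycleCount_facePerm o o' h, ← hτ, Finset.sum_boole,
    ← Nat.cast_pow, ← card_functions_perm, Nat.card_eq_fintype_card, Fintype.card_subtype]

/-- The contribution of one color to a Feynman amplitude. -/
theorem sum_gradedSign_mul (hg : g.transpose = exchangeSign b • g)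
    (hg2 : g * g = exchangeSign b • 1) (o : P.Orientation) (o' : Q.Orientation) :
    ∑ a : V → X, gradedSign b o o' * ((orientedProd o fun v w => g (a v) (a w)) *
      (orientedProd o' fun v w => g (a w) (a v))) =
      (exchangeSign b * (Fintype.card X : ℂ)) ^ faces P Q := by
  -- The signed summand does not depend on the directions, so both pairings may be redirected to
  -- have common tails.
  obtain ⟨q, q', h⟩ := P.exists_common_tail Q
  have hs (x y : X) : g x y = exchangeSign b * g y x := congrFun (congrFun hg y) x
  have h1 (a : V → X) : gradedSign b o o' * ((orientedProd o fun v w => g (a v) (a w)) *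
      (orientedProd o' fun v w => g (a w) (a v))) =
      gradedSign b q q' * ((orientedProd q fun v w => g (a v) (a w)) *
      (orientedProd q' fun v w => g (a w) (a v))) := by
    rw [← gradedSign_mul_orientedProd b q o _ fun v w => hs (a v) (a w),
      ← gradedSign_mul_orientedProd b q' o' _ fun v w => hs (a w) (a v)]
    have h2 : gradedSign b q q' * (gradedSign b q o * gradedSign b q' o') =
        gradedSign b o o' := by
      have h3 := gradedSign_mul_self b q o
      have h4 := gradedSign_mul_self b o' q'
      rw [← gradedSign_mul b q o q', ← gradedSign_mul b o o' q', gradedSign_comm b q' o']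
      linear_combination (gradedSign b o o') * h3 * (gradedSign b o' q' * gradedSign b o' q') +
        gradedSign b o o' * h4
    rw [← h2]
    ring
  simp only [h1]
  rw [← Finset.mul_sum, sum_orientedProd_mul hg2 q q' h, gradedSign,
    pairingSign_eq_sign_facePerm q q' h, sign_eq_neg_one_pow_cycleCount, cycleCount_facePerm,
    Fintype.card_coe]
  push_cast
  rw [exchangeSign_eq_pow, mul_pow, ← mul_assoc, ← pow_mul, ← pow_mul, ← pow_add, ← pow_mul]
  congr 1
  -- The number of pairs enters once through the sign of the face permutation and once through `g *
  -- g`. It cancels modulo 2, and only the number of faces remains.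
  rw [show (q.tail.card + faces P Q) * b.toNat + b.toNat * q.tail.card =
    b.toNat * faces P Q + 2 * (b.toNat * q.tail.card) by ring, pow_add, pow_mul _ 2]
  simp

end SingleColor

/-! ## Transport and disjoint unions of pairings -/

/-- A pairing transported along a bijection. -/
def Pairing.map {V W : Type*} (e : V ≃ W) (P : Pairing V) : Pairing W where
  mate w := e (P.mate (e.symm w))
  mate_mate w := by simp [P.mate_mate]
  mate_ne w h := P.mate_ne (e.symm w) (e.eq_symm_apply.2 h)

/-- The transport of pairings as a bijection. -/
def Pairing.mapEquiv {V W : Type*} (e : V ≃ W) : Pairing V ≃ Pairing W where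
  toFun := Pairing.map e
  invFun := Pairing.map e.symm
  left_inv P := Pairing.ext fun v => by simp [Pairing.map]
  right_inv P := Pairing.ext fun v => by simp [Pairing.map]

/-- A direction transported along a bijection. -/
def Pairing.Orientation.map {V W : Type*} (e : V ≃ W) {P : Pairing V} (o : P.Orientation) :
    (P.map e).Orientation where
  tail := o.tail.map e.toEmbedding
  mate_mem_tail w := by
    have h (w : W) : w ∈ o.tail.map e.toEmbedding ↔ e.symm w ∈ o.tail := by
      simp
    rw [h, h]
    simpa [Pairing.map] using o.mate_mem_tail (e.symm w)

theorem Pairing.Orientation.mem_map_tail {V W : Type*} (e : V ≃ W) {P : Pairing V}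
    (o : P.Orientation) (v : V) : e v ∈ (o.map e).tail ↔ v ∈ o.tail := by
  simp [map]

theorem gradedSign_map {V W : Type*} [Fintype V] [DecidableEq V] [Fintype W] [DecidableEq W]
    (b : Bool) (e : V ≃ W) {P R : Pairing V} {R' : Pairing W} (r : R.Orientation)
    (r' : R'.Orientation) (h1 : ∀ v, e (R.mate v) = R'.mate (e v))
    (h2 : ∀ v, e v ∈ r'.tail ↔ v ∈ r.tail) (o : P.Orientation) :
    gradedSign b r' (o.map e) = gradedSign b r o := by
  obtain ⟨σ, hσ⟩ := exists_carries r o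
  rw [gradedSign, gradedSign, pairingSign_eq r o σ hσ, pairingSign_eq r' (o.map e) (e.permCongr σ),
    Equiv.Perm.sign_permCongr]
  refine ⟨fun w => ?_, fun w => ?_⟩
  · obtain ⟨v, rfl⟩ := e.surjective w
    rw [← h1]
    simp [Equiv.permCongr_apply, hσ.1, Pairing.map]
  · obtain ⟨v, rfl⟩ := e.surjective w
    rw [Equiv.permCongr_apply, Pairing.Orientation.mem_map_tail, h2]
    simpa using hσ.2 v

theorem orientedProd_map {V W : Type*} [Fintype V] [DecidableEq V] [Fintype W] [DecidableEq W]
    (e : V ≃ W) {P : Pairing V} (o : P.Orientation) (K : W → W → ℂ) :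
    orientedProd (o.map e) K = orientedProd o fun v w => K (e v) (e w) := by
  rw [orientedProd, Pairing.Orientation.map, Finset.prod_map]
  simp [orientedProd, Pairing.map]

/-- The disjoint union of pairings. -/
def Pairing.sigma {J : Type*} {W : J → Type*} (P : ∀ j, Pairing (W j)) :
    Pairing (Σ j, W j) where
  mate v := ⟨v.1, (P v.1).mate v.2⟩
  mate_mate v := by simp [Pairing.mate_mate]
  mate_ne v := by
    intro h
    obtain ⟨j, v⟩ := v
    exact (P j).mate_ne v (by simpa using h)

/-- The disjoint union of directed pairings. -/
def Pairing.Orientation.sigma {J : Type*} [Fintype J] {W : J → Type*} {P : ∀ j, Pairing (W j)}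
    (o : ∀ j, (P j).Orientation) : (Pairing.sigma P).Orientation where
  tail := Finset.univ.sigma fun j => (o j).tail
  mate_mem_tail v := by simpa [Pairing.sigma] using (o v.1).mate_mem_tail v.2

theorem orientedProd_sigma {J : Type*} [Fintype J] [DecidableEq J] {W : J → Type*}
    [∀ j, Fintype (W j)] [∀ j, DecidableEq (W j)] {P : ∀ j, Pairing (W j)}
    (o : ∀ j, (P j).Orientation) (K : (Σ j, W j) → (Σ j, W j) → ℂ) :
    orientedProd (Pairing.Orientation.sigma o) K =
      ∏ j, orientedProd (o j) fun v w => K ⟨j, v⟩ ⟨j, w⟩ := by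
  rw [orientedProd, Pairing.Orientation.sigma, Finset.prod_sigma]
  rfl

/-- Both sides are homomorphisms on a product of groups, so they need comparison only on each
factor, and there on transpositions. -/
theorem sign_sigmaCongrRight' {J : Type*} [Fintype J] [DecidableEq J] {W : J → Type*}
    [∀ j, Fintype (W j)] [∀ j, DecidableEq (W j)] (σ : ∀ j, Equiv.Perm (W j)) :
    Equiv.Perm.sign (Equiv.sigmaCongrRight σ) = ∏ j, Equiv.Perm.sign (σ j) := by
  let f : (∀ j, Equiv.Perm (W j)) →* ℤˣ :=
    Equiv.Perm.sign.comp (Equiv.Perm.sigmaCongrRightHom W)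
  let f' : (∀ j, Equiv.Perm (W j)) →* ℤˣ :=
    { toFun := fun σ => ∏ j, Equiv.Perm.sign (σ j)
      map_one' := by simp
      map_mul' := fun σ τ => by simp [Finset.prod_mul_distrib] }
  suffices h : f = f' from DFunLike.congr_fun h σ
  refine MonoidHom.pi_ext fun j τ => ?_
  have h' : f' (Pi.mulSingle j τ) = Equiv.Perm.sign τ := by
    refine (Finset.prod_eq_single j (fun i _ hi => ?_) (by simp)).trans (by simp)
    rw [Pi.mulSingle_eq_of_ne hi, map_one]
  rw [h']
  induction τ using Equiv.Perm.swap_induction_on with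
  | one => simp
  | swap_mul τ x y hxy ih =>
    rw [Pi.mulSingle_mul, map_mul, map_mul, ih (by
      refine (Finset.prod_eq_single j (fun i _ hi => ?_) (by simp)).trans (by simp)
      rw [Pi.mulSingle_eq_of_ne hi, map_one])]
    congr 1
    have : Equiv.sigmaCongrRight (Pi.mulSingle j (Equiv.swap x y) : ∀ j, Equiv.Perm (W j)) =
        Equiv.swap (⟨j, x⟩ : Σ j, W j) ⟨j, y⟩ := by
      refine Equiv.ext fun ⟨i, v⟩ => ?_
      by_cases hi : i = j
      · subst hi
        simp only [Equiv.sigmaCongrRight_apply, Pi.mulSingle_eq_same,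
          Equiv.swap_apply_def, Sigma.mk.injEq, heq_eq_eq, true_and]
        split_ifs <;> rfl
      · rw [Equiv.swap_apply_of_ne_of_ne]
        · simp [Pi.mulSingle_eq_of_ne hi]
        · exact fun h => hi (congrArg Sigma.fst h)
        · exact fun h => hi (congrArg Sigma.fst h)
    refine (congrArg Equiv.Perm.sign this).trans ?_
    rw [Equiv.Perm.sign_swap hxy, Equiv.Perm.sign_swap]
    simpa using hxy

theorem gradedSign_sigma {J : Type*} [Fintype J] [DecidableEq J] {W : J → Type*}
    [∀ j, Fintype (W j)] [∀ j, DecidableEq (W j)] {P Q : ∀ j, Pairing (W j)} (b : Bool)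
    (o : ∀ j, (P j).Orientation) (o' : ∀ j, (Q j).Orientation) :
    gradedSign b (Pairing.Orientation.sigma o) (Pairing.Orientation.sigma o') =
      ∏ j, gradedSign b (o j) (o' j) := by
  choose σ hσ using fun j => exists_carries (o j) (o' j)
  rw [gradedSign, pairingSign_eq _ _ (Equiv.sigmaCongrRight σ), sign_sigmaCongrRight']
  · push_cast
    rw [← Finset.prod_pow]
    exact Finset.prod_congr rfl fun j _ => by rw [gradedSign, pairingSign_eq _ _ _ (hσ j)]
  · refine ⟨fun v => ?_, fun v => ?_⟩
    · simpa [Pairing.sigma] using (hσ v.1).1 v.2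
    · simpa [Pairing.Orientation.sigma] using (hσ v.1).2 v.2

theorem prod_ofFn_sigma {A : Type*} [Monoid A] {m : ℕ} (n : Fin m → ℕ)
    (F : Fin (∑ i, n i) → A) :
    (List.ofFn F).prod =
      (List.ofFn fun i => (List.ofFn fun v => F (finSigmaFinEquiv ⟨i, v⟩)).prod).prod := by
  induction m with
  | zero =>
    have h : ∑ i, n i = 0 := by simp
    rw [List.ofFn_congr h]
    simp
  | succ m ih =>
    have h := Fin.sum_univ_castSucc n
    rw [List.ofFn_congr h, List.ofFn_add, List.prod_append, ih fun i => n i.castSucc,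
      List.ofFn_succ', List.concat_eq_append, List.prod_append, List.prod_singleton]
    congr 1
    · congr 2
      ext i
      congr 2
      ext v
      congr 1
      apply Fin.ext
      simp
    · congr 2
      ext v
      congr 1
      apply Fin.ext
      simp
      rfl

/-! ### Wick's theorem for several words. -/

section Wick

variable {I : Type} [Fintype I] [DecidableEq I] {p : Bool} {g : Matrix I I ℂ}

/-- Wick's theorem for a product of several words of even length. -/
theorem meanLinear_prod_words (hg : IsGradedForm p g) {n : ℕ} (k : Fin n → ℕ)
    (a : (Σ j, Fin (2 * k j)) → I) :
    meanLinear p g (List.ofFn fun j => (List.ofFn fun v => Alg.gen p (a ⟨j, v⟩)).prod).prod =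
      ∑ P : Pairing (Σ j, Fin (2 * k j)),
        gradedSign p (Pairing.Orientation.sigma fun j => refOrientation (k j)) P.orient *
          orientedProd P.orient fun v w => g (a w) (a v) := by
  have hs : ∑ j, 2 * k j = 2 * ∑ j, k j := (Finset.mul_sum _ _ _).symm
  let e : (Σ j, Fin (2 * k j)) ≃ Fin (2 * ∑ j, k j) := finSigmaFinEquiv.trans (finCongr hs)
  -- Every word starts at an even position because the preceding ones have even length.
  -- Concatenation thus carries the reference pairings of the words to the global one.
  obtain ⟨q, hq⟩ : ∃ q : Fin n → ℕ, ∀ x, (e x : ℕ) = 2 * q x.1 + x.2 :=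
    ⟨fun j => ∑ i : Fin j, k (Fin.castLE j.2.le i), fun x => by simp [e, Finset.mul_sum]⟩
  have hword : (List.ofFn fun j => (List.ofFn fun v => Alg.gen p (a ⟨j, v⟩)).prod).prod =
      (List.ofFn fun i => Alg.gen p (a (e.symm i))).prod := by
    rw [List.ofFn_congr hs.symm, prod_ofFn_sigma]
    congr 2
    ext j
    congr 2
    ext v
    congr 2
    rw [Equiv.eq_symm_apply]
    rfl
  rw [hword, meanLinear_prod_ofFn_eq_sum_pairing hg]
  rw [← (Pairing.mapEquiv e).sum_comp]
  refine Finset.sum_congr rfl fun P _ => ?_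
  refine (gradedSign_mul_orientedProd_eq p _ (P.orient.map e) _ _
    fun v w => hg.apply_comm _ _).trans ?_
  rw [orientedProd_map, gradedSign_map p e
    (Pairing.Orientation.sigma fun j => refOrientation (k j)) (refOrientation _)]
  · simp
  · intro x
    apply Fin.ext
    rw [hq]
    by_cases h : x.2.1 % 2 = 0
    · have h' : (2 * q x.1 + x.2.1) % 2 = 0 := by omega
      simp only [refPairing, hq, h, h', Pairing.sigma, dite_true]
      rfl
    · have h' : ¬(2 * q x.1 + x.2.1) % 2 = 0 := by omega
      simp only [refPairing, hq, h, h', Pairing.sigma, dite_false]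
      omega
  · intro x
    simp only [refOrientation, Pairing.Orientation.sigma, Finset.mem_filter, Finset.mem_univ,
      true_and, hq, Finset.mem_sigma]
    omega

end Wick

/-! ## Feynman amplitudes -/

namespace Signature

variable {D : ℕ} (s : Signature D)

theorem form_apply_comm (c : Fin D) (a b : Fin (s.N c)) :
    s.form c a b = exchangeSign (s.odd c) * s.form c b a := by
  have ha := a.2
  have hb := b.2
  rw [form, form]
  cases h : s.odd c
  · simp [exchangeSign, eq_comm]
  · have := (s.even_of_odd c h).two_dvd
    simp only [if_true, exchangeSign]
    split_ifs <;> first | omega | simp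

theorem form_mul_form (c : Fin D) : s.form c * s.form c = exchangeSign (s.odd c) • 1 := by
  ext a b
  have ha := a.2
  have hb := b.2
  rw [Matrix.mul_apply, Matrix.smul_apply, Matrix.one_apply]
  simp only [form]
  cases h : s.odd c
  · simp [exchangeSign]
  · have := (s.even_of_odd c h).two_dvd
    simp only [if_true, exchangeSign]
    by_cases hlt : a.1 < s.N c / 2
    · rw [Finset.sum_eq_single ⟨a.1 + s.N c / 2, by omega⟩]
      · simp only [Fin.ext_iff]
        split_ifs <;> first | omega | simp
      · intro j _ hj
        have hj' : j.1 ≠ a.1 + s.N c / 2 := fun h => hj (Fin.ext h)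
        split_ifs <;> first | omega | simp
      · simp
    · rw [Finset.sum_eq_single ⟨a.1 - s.N c / 2, by omega⟩]
      · simp only [Fin.ext_iff]
        split_ifs <;> first | omega | simp
      · intro j _ hj
        have hj' : j.1 ≠ a.1 - s.N c / 2 := fun h => hj (Fin.ext h)
        split_ifs <;> first | omega | simp
      · simp

theorem pow_parity {u : ℂ} (hu : u * u = 1) :
    u ^ s.parity.toNat = ∏ c, u ^ (s.odd c).toNat := by
  have h2 : u ^ 2 = 1 := by rw [sq, hu]
  rw [Finset.prod_pow_eq_pow_sum, parity]
  by_cases h : Odd (∑ c, (s.odd c).toNat)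
  · obtain ⟨m, hm⟩ := h
    have h' : Odd (∑ c, (s.odd c).toNat) := ⟨m, hm⟩
    rw [decide_eq_true h', hm, pow_succ, pow_mul, h2]
    simp
  · rw [decide_eq_false h]
    obtain ⟨m, hm⟩ := (Nat.not_odd_iff_even.1 h).two_dvd
    rw [hm, pow_mul, h2]
    simp

theorem exchangeSign_parity : exchangeSign s.parity = ∏ c, exchangeSign (s.odd c) := by
  simp only [exchangeSign_eq_pow]
  exact s.pow_parity (by norm_num)

theorem isGradedForm : IsGradedForm s.parity s.tensorForm where
  transpose_eq := by
    ext a b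
    rw [Matrix.transpose_apply, Matrix.smul_apply, tensorForm, tensorForm, exchangeSign_parity,
      smul_eq_mul, ← Finset.prod_mul_distrib]
    exact Finset.prod_congr rfl fun c _ => s.form_apply_comm c _ _
  mul_self := by
    ext a b
    have h (c) (x z : Fin (s.N c)) : ∑ y, s.form c x y * s.form c y z =
        exchangeSign (s.odd c) * if x = z then 1 else 0 := by
      simpa [Matrix.mul_apply, Matrix.one_apply] using congrFun (congrFun (s.form_mul_form c) x) z
    simp only [Matrix.mul_apply, tensorForm, ← Finset.prod_mul_distrib]
    rw [← Fintype.piFinset_univ, ← Finset.prod_univ_sum (fun _ => Finset.univ)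
      fun c y => s.form c (a c) y * s.form c y (b c)]
    simp only [h, Finset.prod_mul_distrib, Matrix.smul_apply, Matrix.one_apply, smul_eq_mul,
      exchangeSign_parity]
    congr 1
    rw [Finset.prod_ite_zero]
    simp [funext_iff]

/-- The mean value of the free theory. -/
def mean : s.Obs →ₗ[ℂ] ℂ := meanLinear s.parity s.tensorForm

/-- Distributes the Wick sign over the colors. This is why the statistics of `T` must be the sum of
the `|c|` modulo 2. -/
theorem gradedSign_parity {V : Type*} [Fintype V] [DecidableEq V] {P Q : Pairing V}
    (o : P.Orientation) (o' : Q.Orientation) :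
    gradedSign s.parity o o' = ∏ c, gradedSign (s.odd c) o o' := by
  refine s.pow_parity ?_
  rw [← Int.cast_mul, ← Units.val_mul, Int.units_mul_self]
  simp

/-- The coefficients of a trace invariant. -/
def kernel (B : ColoredGraph D) (o : B.Direction) (a : Fin (2 * B.k) → s.Index) : ℂ :=
  ∏ c, gradedSign (s.odd c) (refOrientation B.k) (o c) *
    orientedProd (o c) fun v w => s.form c (a v c) (a w c)

theorem invariant_eq (B : ColoredGraph D) (o : B.Direction) :
    s.invariant B o = ∑ a : Fin (2 * B.k) → s.Index,
      s.kernel B o a • (List.ofFn fun v => s.T (a v)).prod := rfl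

/-- The trace invariant does not depend on the directions of the edges. -/
theorem invariant_direction (B : ColoredGraph D) (o o' : B.Direction) :
    s.invariant B o = s.invariant B o' := by
  rw [invariant_eq, invariant_eq]
  refine Finset.sum_congr rfl fun a _ => ?_
  congr 1
  refine Finset.prod_congr rfl fun c _ => ?_
  exact gradedSign_mul_orientedProd_eq _ _ _ _ _ fun v w => s.form_apply_comm c _ _

variable {ι : Type*} (𝓑 : ι → ColoredGraph D)

/-- The vertices of a family of bubbles. -/
abbrev BubbleVertex {J : Type*} (b : J → ι) : Type _ := Σ j, Fin (2 * (𝓑 (b j)).k)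

/-- The edges of color `c` of a family of bubbles. -/
def bubbleEdges {J : Type*} (b : J → ι) (c : Fin D) : Pairing (BubbleVertex 𝓑 b) :=
  Pairing.sigma fun j => (𝓑 (b j)).edges c

/-- The amplitude of a family of bubbles that are joined by edges of color `0`. -/
def amplitude {J : Type*} (b : J → ι) (P : Pairing (BubbleVertex 𝓑 b)) : ℂ :=
  ∏ c, ((-1) ^ (s.odd c).toNat * (s.N c : ℂ)) ^ faces (bubbleEdges 𝓑 b c) P

/-- The sum over all the ways to join a family of bubbles. -/
def totalSum {J : Type*} [Finite J] (b : J → ι) : ℂ :=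
  ∑ P : Pairing (BubbleVertex 𝓑 b), s.amplitude 𝓑 b P

/-- Wick's theorem sums over the color-`0` pairings `P`, and `gradedSign_parity` splits the sign of
`P` over the colors. For each color it composes with the sign of the bubble edges to their sign
relative to `P`, without the reference pairing. The index sum factorizes over colors, and
`sum_gradedSign_mul` evaluates each factor. -/
theorem mean_prod_invariant {n : ℕ} (b : Fin n → ι) (o : ∀ j, (𝓑 (b j)).Direction) :
    s.mean (List.ofFn fun j => s.invariant (𝓑 (b j)) (o j)).prod = s.totalSum 𝓑 b := by
  have h1 : (List.ofFn fun j => s.invariant (𝓑 (b j)) (o j)).prod =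
      ∑ a : ∀ j, Fin (2 * (𝓑 (b j)).k) → s.Index, (∏ j, s.kernel (𝓑 (b j)) (o j) (a j)) •
        (List.ofFn fun j => (List.ofFn fun v => s.T (a j v)).prod).prod := by
    rw [← MultilinearMap.mkPiAlgebraFin_apply (R := ℂ)]
    simp only [invariant_eq]
    rw [MultilinearMap.map_sum]
    refine Finset.sum_congr rfl fun a _ => ?_
    rw [MultilinearMap.map_smul_univ, MultilinearMap.mkPiAlgebraFin_apply]
  rw [h1, map_sum]
  simp only [map_smul, smul_eq_mul]
  -- One index assignment per bubble is the same as one assignment on the disjoint union of the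
  -- vertices.
  rw [← (Equiv.piCurry fun (j : Fin n) (_ : Fin (2 * (𝓑 (b j)).k)) => s.Index).sum_comp]
  have h2 (a : BubbleVertex 𝓑 b → s.Index) :
      s.mean (List.ofFn fun j => (List.ofFn fun v =>
        s.T (Equiv.piCurry (fun (j : Fin n) (_ : Fin (2 * (𝓑 (b j)).k)) => s.Index) a j v)).prod).prod
      = ∑ P : Pairing (BubbleVertex 𝓑 b),
        gradedSign s.parity (Pairing.Orientation.sigma fun j => refOrientation (𝓑 (b j)).k)
          P.orient * orientedProd P.orient fun v w => s.tensorForm (a w) (a v) :=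
    meanLinear_prod_words s.isGradedForm (fun j => (𝓑 (b j)).k) a
  have h3 (a : BubbleVertex 𝓑 b → s.Index) :
      ∏ j, s.kernel (𝓑 (b j)) (o j)
        (Equiv.piCurry (fun (j : Fin n) (_ : Fin (2 * (𝓑 (b j)).k)) => s.Index) a j) =
      ∏ c, gradedSign (s.odd c) (Pairing.Orientation.sigma fun j => refOrientation (𝓑 (b j)).k)
          (Pairing.Orientation.sigma fun j => o j c) *
        orientedProd (Pairing.Orientation.sigma fun j => o j c)
          fun v w => s.form c (a v c) (a w c) := by
    simp only [kernel, gradedSign_sigma, orientedProd_sigma, ← Finset.prod_mul_distrib]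
    rw [Finset.prod_comm]
    rfl
  simp only [h2, h3, Finset.mul_sum]
  rw [Finset.sum_comm, totalSum]
  refine Finset.sum_congr rfl fun P _ => ?_
  have h4 (a : BubbleVertex 𝓑 b → s.Index) :
      (orientedProd P.orient fun v w => s.tensorForm (a w) (a v)) =
        ∏ c, orientedProd P.orient fun v w => s.form c (a w c) (a v c) := by
    simp only [orientedProd, tensorForm]
    exact Finset.prod_comm
  simp only [h4, gradedSign_parity, ← Finset.prod_mul_distrib]
  have h5 (c : Fin D) : ∑ a : BubbleVertex 𝓑 b → Fin (s.N c),
      (gradedSign (s.odd c) (Pairing.Orientation.sigma fun j => o j c) P.orient *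
      ((orientedProd (Pairing.Orientation.sigma fun j => o j c) fun v w => s.form c (a v) (a w)) *
      (orientedProd P.orient fun v w => s.form c (a w) (a v)))) =
      ((-1) ^ (s.odd c).toNat * (s.N c : ℂ)) ^ faces (bubbleEdges 𝓑 b c) P := by
    have := sum_gradedSign_mul (b := s.odd c) (g := s.form c) (Matrix.ext fun x y =>
      s.form_apply_comm c y x) (s.form_mul_form c)
      (Pairing.Orientation.sigma fun j => o j c) P.orient
    rw [exchangeSign_eq_pow, Fintype.card_fin] at this
    exact this
  rw [amplitude]
  simp only [← h5]
  rw [Finset.prod_univ_sum, Fintype.piFinset_univ]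
  rw [← (Equiv.piComm fun (_ : BubbleVertex 𝓑 b) (c : Fin D) => Fin (s.N c)).sum_comp]
  refine Finset.sum_congr rfl fun a _ => Finset.prod_congr rfl fun c _ => ?_
  simp only [Equiv.piComm_apply]
  set x := gradedSign (s.odd c) (Pairing.Orientation.sigma fun j => refOrientation (𝓑 (b j)).k)
    (Pairing.Orientation.sigma fun j => o j c) with hx
  have h6 := gradedSign_mul (s.odd c) (Pairing.Orientation.sigma fun j => o j c)
    (Pairing.Orientation.sigma fun j => refOrientation (𝓑 (b j)).k) P.orient
  rw [← h6, gradedSign_comm _ (Pairing.Orientation.sigma fun j => o j c), ← hx]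
  ring

end Signature

/-! ## Connected components of Feynman graphs -/

theorem faces_map {V W : Type*} [Finite V] [Finite W] (e : V ≃ W) (P Q : Pairing V) :
    faces (P.map e) (Q.map e) = faces P Q := by
  cases nonempty_fintype V
  cases nonempty_fintype W
  refine Nat.pow_right_injective le_rfl ?_
  show 2 ^ _ = 2 ^ _
  rw [← Fintype.card_bool, ← card_invariant_functions, ← card_invariant_functions]
  refine (Nat.card_congr ((Equiv.arrowCongr e (Equiv.refl Bool)).subtypeEquiv fun a => ?_)).symm
  simp only [Equiv.arrowCongr_apply, Function.comp, Equiv.refl_apply, Pairing.map,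
    Equiv.symm_apply_apply]
  exact and_congr (e.symm.forall_congr_right (q := fun v => a (P.mate v) = a v)).symm
    (e.symm.forall_congr_right (q := fun v => a (Q.mate v) = a v)).symm

/-- The disjoint union of two pairings. -/
def Pairing.sum {V W : Type*} (P : Pairing V) (Q : Pairing W) : Pairing (V ⊕ W) where
  mate := Sum.map P.mate Q.mate
  mate_mate v := by cases v <;> simp [Pairing.mate_mate]
  mate_ne v := by cases v <;> simp [Pairing.mate_ne]

theorem faces_sum {V W : Type*} [Finite V] [Finite W] (P P' : Pairing V) (Q Q' : Pairing W) :
    faces (P.sum Q) (P'.sum Q') = faces P P' + faces Q Q' := by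
  cases nonempty_fintype V
  cases nonempty_fintype W
  refine Nat.pow_right_injective le_rfl ?_
  show 2 ^ _ = 2 ^ _
  rw [pow_add, ← Fintype.card_bool, ← card_invariant_functions, ← card_invariant_functions,
    ← card_invariant_functions, ← Nat.card_prod]
  refine Nat.card_congr
    { toFun := fun a => (⟨fun v => a.1 (Sum.inl v), fun v => a.2.1 (Sum.inl v),
        fun v => a.2.2 (Sum.inl v)⟩, ⟨fun v => a.1 (Sum.inr v), fun v => a.2.1 (Sum.inr v),
        fun v => a.2.2 (Sum.inr v)⟩)
      invFun := fun a => ⟨Sum.elim a.1.1 a.2.1, ?_, ?_⟩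
      left_inv := fun a => Subtype.ext (funext fun v => by cases v <;> rfl)
      right_inv := fun a => rfl }
  · rintro (v | v)
    · exact a.1.2.1 v
    · exact a.2.2.1 v
  · rintro (v | v)
    · exact a.1.2.2 v
    · exact a.2.2.2 v

theorem Pairing.exists_eq_sum_map {V₁ V₂ V : Type*} (e : V₁ ⊕ V₂ ≃ V) (P : Pairing V)
    (h1 : ∀ v, ∃ w, P.mate (e (Sum.inl v)) = e (Sum.inl w))
    (h2 : ∀ v, ∃ w, P.mate (e (Sum.inr v)) = e (Sum.inr w)) :
    ∃ P₁ P₂, (Pairing.sum P₁ P₂).map e = P := by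
  choose f hf using h1
  choose f' hf' using h2
  refine ⟨⟨f, fun v => ?_, fun v h => ?_⟩, ⟨f', fun v => ?_, fun v h => ?_⟩, ?_⟩
  · apply Sum.inl_injective (β := V₂)
    apply e.injective
    rw [← hf, ← hf, P.mate_mate]
  · have := hf v
    rw [h] at this
    exact P.mate_ne _ this
  · apply Sum.inr_injective (α := V₁)
    apply e.injective
    rw [← hf', ← hf', P.mate_mate]
  · have := hf' v
    rw [h] at this
    exact P.mate_ne _ this
  · refine Pairing.ext fun v => ?_
    obtain ⟨v, rfl⟩ := e.surjective v
    rcases v with v | v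
    · simp [Pairing.map, Pairing.sum, hf]
    · simp [Pairing.map, Pairing.sum, hf']

theorem Pairing.sum_map_injective {V₁ V₂ V : Type*} (e : V₁ ⊕ V₂ ≃ V) {P₁ P₁' : Pairing V₁}
    {P₂ P₂' : Pairing V₂} (h : (Pairing.sum P₁ P₂).map e = (Pairing.sum P₁' P₂').map e) :
    P₁ = P₁' ∧ P₂ = P₂' := by
  constructor
  · refine Pairing.ext fun v => ?_
    simpa [Pairing.map, Pairing.sum] using congrArg (fun P => P.mate (e (Sum.inl v))) h
  · refine Pairing.ext fun v => ?_
    simpa [Pairing.map, Pairing.sum] using congrArg (fun P => P.mate (e (Sum.inr v))) h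

namespace Signature

variable {D : ℕ} (s : Signature D) {ι : Type*} (𝓑 : ι → ColoredGraph D)

/-- A set of bubbles that no edge of color `0` leaves. -/
def IsClosed {J : Type*} {b : J → ι} (P : Pairing (BubbleVertex 𝓑 b)) (q : J → Prop) : Prop :=
  ∀ v, q v.1 → q (P.mate v).1

/-- The edges of color `0` connect all the bubbles. -/
def IsConn {J : Type*} {b : J → ι} (P : Pairing (BubbleVertex 𝓑 b)) : Prop :=
  ∀ q : J → Prop, IsClosed 𝓑 P q → (∃ j, q j) → ∀ j, q j

open scoped Classical in
/-- The sum over all the ways to join a family of bubbles to a connected graph. -/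
def connectedSum {J : Type*} [Finite J] (b : J → ι) : ℂ :=
  ∑ P : Pairing (BubbleVertex 𝓑 b) with IsConn 𝓑 P, s.amplitude 𝓑 b P

/-- The bijection of vertices that a bijection of bubbles induces. -/
def vertexEquiv {J J' : Type*} (e : J ≃ J') (b : J' → ι) :
    BubbleVertex 𝓑 (b ∘ e) ≃ BubbleVertex 𝓑 b :=
  Equiv.sigmaCongrLeft (β := fun j => Fin (2 * (𝓑 (b j)).k)) e

theorem vertexEquiv_fst {J J' : Type*} (e : J ≃ J') (b : J' → ι) (v : BubbleVertex 𝓑 (b ∘ e)) :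
    (vertexEquiv 𝓑 e b v).1 = e v.1 := rfl

theorem amplitude_map {J J' : Type*} [Finite J] [Finite J'] (e : J ≃ J') (b : J' → ι)
    (P : Pairing (BubbleVertex 𝓑 (b ∘ e))) :
    s.amplitude 𝓑 b (P.map (vertexEquiv 𝓑 e b)) = s.amplitude 𝓑 (b ∘ e) P := by
  refine Finset.prod_congr rfl fun c _ => ?_
  rw [← faces_map (vertexEquiv 𝓑 e b) (bubbleEdges 𝓑 (b ∘ e) c) P]
  congr 2
  refine Pairing.ext fun v => ?_
  obtain ⟨v, rfl⟩ := (vertexEquiv 𝓑 e b).surjective v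
  simp only [Pairing.map, Equiv.symm_apply_apply]
  rfl

theorem isConn_map {J J' : Type*} (e : J ≃ J') (b : J' → ι)
    (P : Pairing (BubbleVertex 𝓑 (b ∘ e))) :
    IsConn 𝓑 (P.map (vertexEquiv 𝓑 e b)) ↔ IsConn 𝓑 P := by
  have hcl (q : J' → Prop) : IsClosed 𝓑 (P.map (vertexEquiv 𝓑 e b)) q ↔
      IsClosed 𝓑 P fun j => q (e j) := by
    rw [IsClosed, ← (vertexEquiv 𝓑 e b).forall_congr_right]
    simp only [Pairing.map, Equiv.symm_apply_apply, vertexEquiv_fst]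
    rfl
  constructor
  · rintro h q hq ⟨j, hj⟩ j'
    have := h (fun j => q (e.symm j)) ((hcl _).2 (by simpa using hq)) ⟨e j, by simpa using hj⟩
      (e j')
    simpa using this
  · rintro h q hq ⟨j, hj⟩ j'
    have := h _ ((hcl q).1 hq) ⟨e.symm j, by simpa using hj⟩ (e.symm j')
    simpa using this

theorem totalSum_comp {J J' : Type*} [Finite J] [Finite J'] (e : J ≃ J') (b : J' → ι) :
    s.totalSum 𝓑 (b ∘ e) = s.totalSum 𝓑 b := by
  rw [totalSum, totalSum, ← (Pairing.mapEquiv (vertexEquiv 𝓑 e b)).sum_comp]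
  exact Finset.sum_congr rfl fun P _ => (s.amplitude_map 𝓑 e b P).symm

theorem connectedSum_comp {J J' : Type*} [Finite J] [Finite J'] (e : J ≃ J') (b : J' → ι) :
    s.connectedSum 𝓑 (b ∘ e) = s.connectedSum 𝓑 b := by
  classical
  rw [connectedSum, connectedSum]
  refine Finset.sum_equiv (Pairing.mapEquiv (vertexEquiv 𝓑 e b)) (fun P => ?_)
    fun P _ => (s.amplitude_map 𝓑 e b P).symm
  simp only [Finset.mem_filter, Finset.mem_univ, true_and]
  exact (isConn_map 𝓑 e b P).symm

/-! ### Splitting off the component of a chosen bubble. -/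

section Subset

variable {α : Type*} [DecidableEq α] (b : α → ι)

/-- The total sum over a finite set of bubbles. -/
def totalOn (J : Finset α) : ℂ := s.totalSum 𝓑 fun j : J => b j

/-- The connected sum over a finite set of bubbles. -/
def connectedOn (J : Finset α) : ℂ := s.connectedSum 𝓑 fun j : J => b j

/-- The vertices of a set of bubbles and of its complement. -/
def splitVertex {J S : Finset α} (h : S ⊆ J) :
    BubbleVertex 𝓑 (fun j : S => b j) ⊕ BubbleVertex 𝓑 (fun j : (J \ S : Finset α) => b j) ≃
      BubbleVertex 𝓑 (fun j : J => b j) where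
  toFun := Sum.elim (fun v => ⟨⟨v.1.1, h v.1.2⟩, v.2⟩)
    fun v => ⟨⟨v.1.1, (Finset.mem_sdiff.1 v.1.2).1⟩, v.2⟩
  invFun v := if hv : v.1.1 ∈ S then Sum.inl ⟨⟨v.1.1, hv⟩, v.2⟩
    else Sum.inr ⟨⟨v.1.1, Finset.mem_sdiff.2 ⟨v.1.2, hv⟩⟩, v.2⟩
  left_inv := by
    rintro (⟨⟨j, hj⟩, v⟩ | ⟨⟨j, hj⟩, v⟩)
    · simp [hj]
    · simp [(Finset.mem_sdiff.1 hj).2]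
  right_inv := by
    rintro ⟨⟨j, hj⟩, v⟩
    by_cases hv : j ∈ S <;> simp [hv]

theorem exists_splitVertex_inl {J S : Finset α} (h : S ⊆ J)
    (v : BubbleVertex 𝓑 (fun j : J => b j)) (hv : v.1.1 ∈ S) :
    ∃ w, v = splitVertex 𝓑 b h (Sum.inl w) := ⟨⟨⟨v.1.1, hv⟩, v.2⟩, rfl⟩

theorem exists_splitVertex_inr {J S : Finset α} (h : S ⊆ J)
    (v : BubbleVertex 𝓑 (fun j : J => b j)) (hv : v.1.1 ∉ S) :
    ∃ w, v = splitVertex 𝓑 b h (Sum.inr w) :=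
  ⟨⟨⟨v.1.1, Finset.mem_sdiff.2 ⟨v.1.2, hv⟩⟩, v.2⟩, rfl⟩

theorem amplitude_sum {J S : Finset α} (h : S ⊆ J)
    (P₁ : Pairing (BubbleVertex 𝓑 (fun j : S => b j)))
    (P₂ : Pairing (BubbleVertex 𝓑 (fun j : (J \ S : Finset α) => b j))) :
    s.amplitude 𝓑 (fun j : J => b j) ((P₁.sum P₂).map (splitVertex 𝓑 b h)) =
      s.amplitude 𝓑 _ P₁ * s.amplitude 𝓑 _ P₂ := by
  rw [amplitude, amplitude, amplitude, ← Finset.prod_mul_distrib]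
  refine Finset.prod_congr rfl fun c _ => ?_
  rw [← pow_add, ← faces_sum, ← faces_map (splitVertex 𝓑 b h)]
  congr 2
  refine Pairing.ext fun v => ?_
  obtain ⟨v, rfl⟩ := (splitVertex 𝓑 b h).surjective v
  simp only [Pairing.map, Equiv.symm_apply_apply]
  rcases v with v | v <;> rfl

open scoped Classical in
/-- The bubbles in the connected component of the bubble `j₀`. -/
def component {J : Finset α} (j₀ : α) (P : Pairing (BubbleVertex 𝓑 fun j : J => b j)) :
    Finset α :=
  J.filter fun j => ∀ q : α → Prop, IsClosed 𝓑 P (fun j => q j.1) → q j₀ → q j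

/-- `S` is closed, hence contains the component. Conversely, a closed set containing `j₀` restricts
to a closed set of the connected part `P₁`, so it contains `S`. -/
theorem component_sum_map {J S : Finset α} (h : S ⊆ J) {j₀ : α} (hj : j₀ ∈ S)
    (P₁ : Pairing (BubbleVertex 𝓑 (fun j : S => b j)))
    (P₂ : Pairing (BubbleVertex 𝓑 (fun j : (J \ S : Finset α) => b j))) (hc : IsConn 𝓑 P₁) :
    component 𝓑 b j₀ ((P₁.sum P₂).map (splitVertex 𝓑 b h)) = S := by
  classical
  ext j
  rw [component, Finset.mem_filter]
  constructor
  · rintro ⟨-, hq⟩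
    refine hq (· ∈ S) (fun v hv => ?_) hj
    obtain ⟨w, rfl⟩ := exists_splitVertex_inl 𝓑 b h v hv
    simp only [Pairing.map, Equiv.symm_apply_apply]
    exact (P₁.mate w).1.2
  · refine fun hjS => ⟨h hjS, fun q hq hq0 => ?_⟩
    refine hc (fun j => q j.1) (fun v hv => ?_) ⟨⟨j₀, hj⟩, hq0⟩ ⟨j, hjS⟩
    have := hq (splitVertex 𝓑 b h (Sum.inl v)) hv
    simp only [Pairing.map, Equiv.symm_apply_apply] at this
    exact this

theorem exists_of_component_eq {J S : Finset α} (h : S ⊆ J) {j₀ : α} (hj0 : j₀ ∈ S)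
    (P : Pairing (BubbleVertex 𝓑 fun j : J => b j)) (hP : component 𝓑 b j₀ P = S) :
    ∃ (P₁ : Pairing (BubbleVertex 𝓑 (fun j : S => b j)))
      (P₂ : Pairing (BubbleVertex 𝓑 (fun j : (J \ S : Finset α) => b j))),
      IsConn 𝓑 P₁ ∧ (P₁.sum P₂).map (splitVertex 𝓑 b h) = P := by
  classical
  have hmem (j : α) : j ∈ S ↔ j ∈ J ∧
      ∀ q : α → Prop, IsClosed 𝓑 P (fun j => q j.1) → q j₀ → q j := by
    rw [← hP, component, Finset.mem_filter]
  have hcl (v : BubbleVertex 𝓑 fun j : J => b j) (hv : v.1.1 ∈ S) : (P.mate v).1.1 ∈ S := by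
    rw [hmem] at hv ⊢
    exact ⟨(P.mate v).1.2, fun q hq hq0 => hq v (hv.2 q hq hq0)⟩
  have hcl' (v : BubbleVertex 𝓑 fun j : J => b j) (hv : v.1.1 ∉ S) : (P.mate v).1.1 ∉ S := by
    intro hv'
    have := hcl _ hv'
    rw [P.mate_mate] at this
    exact hv this
  obtain ⟨P₁, P₂, rfl⟩ := Pairing.exists_eq_sum_map (splitVertex 𝓑 b h) P
    (fun v => exists_splitVertex_inl 𝓑 b h _ (hcl _ v.1.2))
    (fun v => exists_splitVertex_inr 𝓑 b h _ (hcl' _ (Finset.mem_sdiff.1 v.1.2).2))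
  refine ⟨P₁, P₂, ?_, rfl⟩
  have hext (q : S → Prop) (hq : IsClosed 𝓑 P₁ q) :
      IsClosed 𝓑 ((P₁.sum P₂).map (splitVertex 𝓑 b h))
        (fun j => (fun a => ∃ ha : a ∈ S, q ⟨a, ha⟩) j.1) := by
    rintro v ⟨hv, hqv⟩
    obtain ⟨w, rfl⟩ := exists_splitVertex_inl 𝓑 b h v hv
    simp only [Pairing.map, Equiv.symm_apply_apply]
    exact ⟨(P₁.mate w).1.2, hq w hqv⟩
  rintro q hq ⟨j₁, hj₁⟩ j
  -- The complement of a closed set is closed, since the pairing is an involution. Whichever of `q`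
  -- and its complement contains `j₀` must be all of `S`.
  by_cases h0 : ∃ ha : j₀ ∈ S, q ⟨j₀, ha⟩
  · obtain ⟨_, hj⟩ := ((hmem j).1 j.2).2 (fun a => ∃ ha : a ∈ S, q ⟨a, ha⟩) (hext q hq) h0
    exact hj
  · obtain ⟨_, hj⟩ := ((hmem j₁).1 j₁.2).2 (fun a => ∃ ha : a ∈ S, ¬q ⟨a, ha⟩)
      (hext (fun j => ¬q j) fun v hv hv' => hv (by
        have := hq _ hv'
        rwa [P₁.mate_mate] at this)) ⟨hj0, fun h' => h0 ⟨hj0, h'⟩⟩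
    exact absurd hj₁ hj

/-- Joinings are sorted by the component `S` of `j₀`. Those with a given `S` are a connected joining
of `S` and any joining of the rest, and amplitudes multiply because faces add. -/
theorem totalOn_eq_sum {J : Finset α} {j₀ : α} (hj : j₀ ∈ J) :
    s.totalOn 𝓑 b J = ∑ S ∈ J.powerset with j₀ ∈ S, s.connectedOn 𝓑 b S * s.totalOn 𝓑 b (J \ S) := by
  classical
  rw [totalOn, totalSum, ← Finset.sum_fiberwise_of_maps_to (g := component 𝓑 b j₀)
    (t := J.powerset.filter (j₀ ∈ ·))]
  · refine Finset.sum_congr rfl fun S hS => ?_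
    rw [Finset.mem_filter, Finset.mem_powerset] at hS
    rw [connectedOn, connectedSum, totalOn, totalSum, Finset.sum_mul_sum, ← Finset.sum_product']
    symm
    refine Finset.sum_bij (fun x _ => (x.1.sum x.2).map (splitVertex 𝓑 b hS.1)) ?_ ?_ ?_ ?_
    · rintro ⟨P₁, P₂⟩ hx
      simp only [Finset.mem_product, Finset.mem_filter, Finset.mem_univ, true_and, and_true] at hx
      simp only [Finset.mem_filter, Finset.mem_univ, true_and]
      exact component_sum_map 𝓑 b hS.1 hS.2 P₁ P₂ hx
    · rintro ⟨P₁, P₂⟩ _ ⟨P₁', P₂'⟩ _ hx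
      obtain ⟨h1, h2⟩ := Pairing.sum_map_injective _ hx
      exact Prod.ext h1 h2
    · intro P hP
      simp only [Finset.mem_filter, Finset.mem_univ, true_and] at hP
      obtain ⟨P₁, P₂, h1, h2⟩ := exists_of_component_eq 𝓑 b hS.1 hS.2 P hP
      exact ⟨(P₁, P₂), by simpa using h1, h2⟩
    · rintro ⟨P₁, P₂⟩ _
      exact (s.amplitude_sum 𝓑 b hS.1 P₁ P₂).symm
  · intro P _
    simp only [Finset.mem_filter, Finset.mem_powerset, component]
    exact ⟨Finset.filter_subset _ _, hj, fun q _ h => h⟩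

theorem totalOn_insert {J : Finset α} {j₀ : α} (hj : j₀ ∉ J) :
    s.totalOn 𝓑 b (insert j₀ J) =
      ∑ S ∈ J.powerset, s.connectedOn 𝓑 b (insert j₀ S) * s.totalOn 𝓑 b (J \ S) := by
  rw [s.totalOn_eq_sum 𝓑 b (Finset.mem_insert_self j₀ J), Finset.sum_filter,
    Finset.sum_powerset_insert hj, Finset.sum_eq_zero, zero_add]
  · refine Finset.sum_congr rfl fun S _ => ?_
    rw [if_pos (Finset.mem_insert_self _ _), Finset.insert_sdiff_insert,
      Finset.sdiff_insert_of_notMem hj]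
  · intro S hS
    rw [if_neg]
    exact fun h => hj (Finset.mem_powerset.1 hS h)

end Subset

end Signature

/-! ## Calculus of formal power series -/

section Series

variable {ι : Type*}

/-- The multi-exponent of a finite family of variables. -/
def mult {α : Type*} (b : α → ι) (J : Finset α) : ι →₀ ℕ := ∑ j ∈ J, Finsupp.single (b j) 1

/-- The factorial of a multi-exponent. -/
def multiFactorial (m : ι →₀ ℕ) : ℂ := m.prod fun _ k => (k.factorial : ℂ)

theorem multiFactorial_ne_zero (m : ι →₀ ℕ) : multiFactorial m ≠ 0 :=
  Finset.prod_ne_zero_iff.2 fun _ _ => Nat.cast_ne_zero.2 (Nat.factorial_ne_zero _)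

theorem multiFactorial_zero : multiFactorial (0 : ι →₀ ℕ) = 1 := Finsupp.prod_zero_index

theorem multiFactorial_add_single (m : ι →₀ ℕ) (i : ι) :
    multiFactorial (m + Finsupp.single i 1) = (m i + 1) * multiFactorial m := by
  classical
  have h (m : ι →₀ ℕ) :
      multiFactorial m = ((m i).factorial : ℂ) * multiFactorial (m.erase i) :=
    (Finsupp.mul_prod_erase' m i (fun _ k => (k.factorial : ℂ)) (by simp)).symm
  rw [h (m + Finsupp.single i 1), h m, Finsupp.erase_add, Finsupp.erase_single, add_zero]
  simp [Nat.factorial_succ, mul_assoc]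

theorem degree_mult {α : Type*} (b : α → ι) (J : Finset α) : (mult b J).degree = J.card := by
  simp [mult, Finsupp.degree_single]

/-- Lets each coefficient be treated through a word of labeled couplings, so that repeated bubbles
become distinguishable. -/
theorem exists_mult_eq (m : ι →₀ ℕ) : ∃ (n : ℕ) (b : Fin n → ι), mult b Finset.univ = m := by
  classical
  induction m using Finsupp.induction_linear with
  | zero => exact ⟨0, Fin.elim0, by simp [mult]⟩
  | add f g hf hg =>
    obtain ⟨n, b, rfl⟩ := hf
    obtain ⟨n', b', rfl⟩ := hg
    exact ⟨n + n', Fin.append b b', by simp [mult, Fin.sum_univ_add]⟩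
  | single i k => exact ⟨k, fun _ => i, by simp [mult]⟩

theorem exists_eq_single_of_degree_eq_one {m : ι →₀ ℕ} (hm : m.degree = 1) :
    ∃ i, m = Finsupp.single i 1 := by
  obtain ⟨n, b, rfl⟩ := exists_mult_eq m
  rw [degree_mult, Finset.card_univ, Fintype.card_fin] at hm
  subst hm
  exact ⟨b 0, by simp [mult]⟩

/-- The iterated derivative at zero with respect to a finite family of variables. -/
def dcoeff {α : Type*} (b : α → ι) (J : Finset α) (F : MvPowerSeries ι ℂ) : ℂ :=
  multiFactorial (mult b J) * MvPowerSeries.coeff (mult b J) F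

theorem dcoeff_empty {α : Type*} (b : α → ι) (F : MvPowerSeries ι ℂ) :
    dcoeff b ∅ F = MvPowerSeries.constantCoeff F := by
  simp [dcoeff, mult, multiFactorial_zero]

section

variable {α : Type*} [DecidableEq α] (b : α → ι)

theorem mult_insert {J : Finset α} {j : α} (hj : j ∉ J) :
    mult b (insert j J) = mult b J + Finsupp.single (b j) 1 := by
  rw [mult, Finset.sum_insert hj, add_comm, mult]

theorem dcoeff_insert {J : Finset α} {j : α} (hj : j ∉ J) (F : MvPowerSeries ι ℂ) :
    dcoeff b (insert j J) F = dcoeff b J (MvPowerSeries.pderiv ℂ (b j) F) := by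
  rw [dcoeff, dcoeff, mult_insert b hj, multiFactorial_add_single, MvPowerSeries.coeff_pderiv]
  ring

theorem dcoeff_add (J : Finset α) (F G : MvPowerSeries ι ℂ) :
    dcoeff b J (F + G) = dcoeff b J F + dcoeff b J G := by
  simp [dcoeff, mul_add]

/-- Leibniz's rule. -/
theorem dcoeff_mul (J : Finset α) (F G : MvPowerSeries ι ℂ) :
    dcoeff b J (F * G) = ∑ S ∈ J.powerset, dcoeff b S F * dcoeff b (J \ S) G := by
  induction J using Finset.induction_on generalizing F G with
  | empty => simp [dcoeff_empty]
  | insert j J hj ih =>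
    rw [dcoeff_insert b hj, Derivation.leibniz, dcoeff_add, smul_eq_mul, smul_eq_mul, ih,
      mul_comm G, ih, Finset.sum_powerset_insert hj]
    congr 1
    · refine Finset.sum_congr rfl fun S hS => ?_
      have hjS : j ∉ S := fun h => hj (Finset.mem_powerset.1 hS h)
      rw [Finset.insert_sdiff_of_notMem _ hjS, dcoeff_insert b fun h => hj (Finset.mem_sdiff.1 h).1]
    · refine Finset.sum_congr rfl fun S hS => ?_
      have hjS : j ∉ S := fun h => hj (Finset.mem_powerset.1 hS h)
      rw [Finset.insert_sdiff_insert, Finset.sdiff_insert_of_notMem hj, dcoeff_insert b hjS]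

end

theorem mult_map {α β : Type*} (f : α ↪ β) (b : β → ι) (J : Finset α) :
    mult b (J.map f) = mult (b ∘ f) J := by
  simp [mult]

/-! ### The formal exponential -/

theorem mult_eq_single_add {n : ℕ} (b : Fin (n + 1) → ι) (j : Fin (n + 1)) :
    mult b Finset.univ = mult (fun i => b (j.succAbove i)) Finset.univ +
      Finsupp.single (b j) 1 := by
  rw [mult, Fin.sum_univ_succAbove _ j, add_comm, mult]

theorem mult_apply {α : Type*} [DecidableEq ι] (b : α → ι) (J : Finset α) (i : ι) :
    mult b J i = (J.filter fun j => b j = i).card := by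
  rw [mult, Finsupp.finsetSum_apply, Finset.card_filter]
  exact Finset.sum_congr rfl fun j _ => by rw [Finsupp.single_apply]

theorem sum_mult {α M : Type*} [AddCommMonoid M] (b : α → ι) (J : Finset α) (f : ι → M) :
    ∑ i ∈ (mult b J).support, mult b J i • f i = ∑ j ∈ J, f (b j) := by
  classical
  rw [← Finset.sum_fiberwise_of_maps_to (g := b) (t := (mult b J).support)]
  · refine Finset.sum_congr rfl fun i _ => ?_
    rw [mult_apply, ← Finset.sum_const]
    exact Finset.sum_congr rfl fun j hj => by rw [(Finset.mem_filter.1 hj).2]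
  · intro j hj
    rw [Finsupp.mem_support_iff, mult_apply]
    exact Finset.card_ne_zero_of_mem (Finset.mem_filter.2 ⟨hj, rfl⟩)

section Exp

variable {A : Type*} [Ring A] [Algebra ℂ A] (w : ι → A) (W : MvPowerSeries ι A)

/-- A power series that is linear in the variables. -/
def IsLinearSeries : Prop :=
  (∀ i, MvPowerSeries.coeff (Finsupp.single i 1) W = w i) ∧
    ∀ m : ι →₀ ℕ, m.degree ≠ 1 → MvPowerSeries.coeff m W = 0

variable {w W}

theorem IsLinearSeries.coeff_mul (h : IsLinearSeries w W) (F : MvPowerSeries ι A) (m : ι →₀ ℕ) :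
    MvPowerSeries.coeff m (W * F) =
      ∑ i ∈ m.support, w i * MvPowerSeries.coeff (m - Finsupp.single i 1) F := by
  classical
  rw [MvPowerSeries.coeff_mul]
  symm
  refine Finset.sum_of_injOn (fun i => (Finsupp.single i 1, m - Finsupp.single i 1)) ?_ ?_ ?_ ?_
  · intro i _ j _ hij
    exact Finsupp.single_left_injective one_ne_zero (congrArg Prod.fst hij)
  · intro i hi
    rw [Finset.mem_coe, Finset.HasAntidiagonal.mem_antidiagonal]
    refine add_tsub_cancel_of_le (Finsupp.single_le_iff.2 ?_)
    exact Nat.one_le_iff_ne_zero.2 (Finsupp.mem_support_iff.1 hi)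
  · rintro ⟨p, q⟩ hpq hni
    rw [Finset.HasAntidiagonal.mem_antidiagonal] at hpq
    by_cases hd : p.degree = 1
    · exfalso
      obtain ⟨i, rfl⟩ := exists_eq_single_of_degree_eq_one hd
      refine hni ⟨i, ?_, ?_⟩
      · rw [Finset.mem_coe, Finsupp.mem_support_iff, ← hpq]
        simp
      · simp [← hpq]
    · rw [h.2 p hd, zero_mul]
  · intro i _
    rw [h.1]

theorem IsLinearSeries.coeff_pow_of_ne (h : IsLinearSeries w W) (n : ℕ) (m : ι →₀ ℕ)
    (hm : m.degree ≠ n) : MvPowerSeries.coeff m (W ^ n) = 0 := by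
  classical
  induction n generalizing m with
  | zero =>
    rw [pow_zero, MvPowerSeries.coeff_one, if_neg]
    rintro rfl
    simp at hm
  | succ n ih =>
    rw [pow_succ', h.coeff_mul]
    refine Finset.sum_eq_zero fun i hi => ?_
    rw [ih, mul_zero]
    intro h'
    apply hm
    have hle : Finsupp.single i 1 ≤ m :=
      Finsupp.single_le_iff.2 (Nat.one_le_iff_ne_zero.2 (Finsupp.mem_support_iff.1 hi))
    rw [← tsub_add_cancel_of_le hle, map_add, h', Finsupp.degree_single]

theorem mul_prod_ofFn_succAbove (hw : ∀ i j, Commute (w i) (w j)) {n : ℕ} (b : Fin (n + 1) → ι)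
    (j : Fin (n + 1)) :
    w (b j) * (List.ofFn fun i => w (b (j.succAbove i))).prod =
      (List.ofFn fun i => w (b i)).prod := by
  have hp : (w (b j) :: List.ofFn fun i => w (b (j.succAbove i))).Perm
      (List.ofFn fun i => w (b i)) := by
    rw [← Multiset.coe_eq_coe, ← Multiset.cons_coe, ← Fin.univ_val_map, ← Fin.univ_val_map,
      Fin.univ_succAbove _ j]
    simp [Function.comp_def]
  rw [← List.prod_cons]
  refine hp.prod_eq' ?_
  refine List.Pairwise.imp_of_mem (R := fun _ _ => True) ?_ (List.pairwise_of_forall fun _ _ => trivial)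
  intro x y hx hy _
  have hmem (x) (hx : x ∈ w (b j) :: List.ofFn fun i => w (b (j.succAbove i))) : ∃ i, x = w i := by
    rcases List.mem_cons.1 hx with rfl | hx
    · exact ⟨_, rfl⟩
    · obtain ⟨i, rfl⟩ := (List.mem_ofFn' _ _).1 hx
      exact ⟨_, rfl⟩
  obtain ⟨i, rfl⟩ := hmem x hx
  obtain ⟨i', rfl⟩ := hmem y hy
  exact hw i i'

/-- The multinomial theorem for commuting `w i`. Peeling one factor `w i` off the power yields `m i`
copies of the same product, and the `m i` add up to the length of the word. -/
theorem IsLinearSeries.coeff_pow (h : IsLinearSeries w W) (hw : ∀ i j, Commute (w i) (w j))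
    (n : ℕ) (b : Fin n → ι) :
    multiFactorial (mult b Finset.univ) • MvPowerSeries.coeff (mult b Finset.univ) (W ^ n) =
      (n.factorial : ℂ) • (List.ofFn fun i => w (b i)).prod := by
  classical
  induction n with
  | zero => simp [mult, multiFactorial_zero]
  | succ n ih =>
    have key (i : ι) (hi : i ∈ (mult b Finset.univ).support) :
        multiFactorial (mult b Finset.univ) • (w i *
          MvPowerSeries.coeff (mult b Finset.univ - Finsupp.single i 1) (W ^ n)) =
        mult b Finset.univ i • (n.factorial : ℂ) • (List.ofFn fun i => w (b i)).prod := by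
      have hi' := Finsupp.mem_support_iff.1 hi
      rw [mult_apply] at hi'
      obtain ⟨j, hj⟩ := Finset.card_pos.1 (Nat.pos_of_ne_zero hi')
      have hji := (Finset.mem_filter.1 hj).2
      subst hji
      rw [← mul_prod_ofFn_succAbove hw b j, ← mul_smul_comm (n.factorial : ℂ), ← ih,
        mult_eq_single_add b j, add_tsub_cancel_right, multiFactorial_add_single, mul_smul,
        mul_smul_comm, ← Nat.cast_smul_eq_nsmul ℂ]
      simp
    rw [pow_succ', h.coeff_mul, Finset.smul_sum, Finset.sum_congr rfl key,
      sum_mult b Finset.univ fun _ => (n.factorial : ℂ) • (List.ofFn fun i => w (b i)).prod]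
    rw [Finset.sum_const, Finset.card_univ, Fintype.card_fin, ← Nat.cast_smul_eq_nsmul ℂ, smul_smul,
      Nat.factorial_succ]
    push_cast
    rfl

theorem IsLinearSeries.coeff_formalExp (h : IsLinearSeries w W)
    (hw : ∀ i j, Commute (w i) (w j)) {n : ℕ} (b : Fin n → ι) :
    multiFactorial (mult b Finset.univ) • MvPowerSeries.coeff (mult b Finset.univ) (formalExp W) =
      (List.ofFn fun i => w (b i)).prod := by
  have hd : (mult b Finset.univ).degree = n := by rw [degree_mult, Finset.card_univ, Fintype.card_fin]
  have h1 : MvPowerSeries.coeff (mult b Finset.univ) (formalExp W) =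
      (n.factorial : ℂ)⁻¹ • MvPowerSeries.coeff (mult b Finset.univ) (W ^ n) := by
    refine (Finset.sum_eq_single (s := Finset.range ((mult b Finset.univ).degree + 1))
      (f := fun k => (k.factorial : ℂ)⁻¹ • MvPowerSeries.coeff (mult b Finset.univ) (W ^ k)) n
      (fun k _ hk => ?_) fun hn => ?_)
    · rw [h.coeff_pow_of_ne k _ (hd.trans_ne hk.symm), smul_zero]
    · rw [hd] at hn
      simp at hn
  rw [h1, smul_comm, h.coeff_pow hw, smul_smul, inv_mul_cancel₀, one_smul]
  exact Nat.cast_ne_zero.2 (Nat.factorial_ne_zero n)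

end Exp

/-! ### The formal logarithm -/

theorem coeff_pow_eq_zero_of_degree_lt {a : MvPowerSeries ι ℂ}
    (ha : MvPowerSeries.constantCoeff a = 0) {n : ℕ} {m : ι →₀ ℕ} (h : m.degree < n) :
    MvPowerSeries.coeff m (a ^ n) = 0 := by
  exact MvPowerSeries.coeff_of_lt_order (lt_of_lt_of_le (Nat.cast_lt.2 h)
    (MvPowerSeries.le_order_pow_of_constantCoeff_eq_zero n ha))

theorem pderiv_log_subst {F : MvPowerSeries ι ℂ} (hF : MvPowerSeries.constantCoeff F = 1) (i : ι) :
    MvPowerSeries.pderiv ℂ i ((PowerSeries.log ℂ).subst (F - 1)) =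
      F⁻¹ * MvPowerSeries.pderiv ℂ i F := by
  classical
  set a := F - 1 with ha
  have ha0 : MvPowerSeries.constantCoeff a = 0 := by rw [ha, map_sub, hF, map_one, sub_self]
  have hsub : PowerSeries.HasSubst a := by
    rw [PowerSeries.HasSubst, ha0]
    exact IsNilpotent.zero
  have hda : MvPowerSeries.pderiv ℂ i a = MvPowerSeries.pderiv ℂ i F := by
    rw [ha, map_sub, MvPowerSeries.pderiv_one, sub_zero]
  -- The logarithm series truncated after degree `N` in `a`. Its derivative is a finite geometric
  -- sum in `-a`, which `F = 1 - (-a)` collapses up to a remainder of order at least `N`.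
  let L (N : ℕ) : MvPowerSeries ι ℂ :=
    ∑ d ∈ Finset.range (N + 1), PowerSeries.coeff d (PowerSeries.log ℂ) • a ^ d
  have hL (N : ℕ) (e : ι →₀ ℕ) (he : e.degree ≤ N) :
      MvPowerSeries.coeff e ((PowerSeries.log ℂ).subst a) = MvPowerSeries.coeff e (L N) := by
    rw [PowerSeries.coeff_subst hsub, finsum_eq_sum_of_support_subset (s := Finset.range (N + 1))]
    · simp only [L, map_sum, map_smul]
    · intro d hd
      rw [Finset.mem_coe, Finset.mem_range]
      by_contra hlt
      refine hd ?_
      simp only [coeff_pow_eq_zero_of_degree_lt ha0 (show e.degree < d by omega), smul_zero]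
  have hdL (N : ℕ) : F * MvPowerSeries.pderiv ℂ i (L N) =
      (1 - (-a) ^ N) * MvPowerSeries.pderiv ℂ i F := by
    have h1 : MvPowerSeries.pderiv ℂ i (L N) =
        (∑ d ∈ Finset.range N, (-a) ^ d) * MvPowerSeries.pderiv ℂ i F := by
      have h0 (d : ℕ) : MvPowerSeries.pderiv ℂ i (PowerSeries.coeff d (PowerSeries.log ℂ) • a ^ d) =
          PowerSeries.coeff d (PowerSeries.log ℂ) •
            (d * a ^ (d - 1) * MvPowerSeries.pderiv ℂ i F) := by
        rw [Derivation.map_smul, MvPowerSeries.pderiv_pow, hda]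
      rw [map_sum, Finset.sum_congr rfl fun d _ => h0 d, Finset.sum_range_succ', Finset.sum_mul,
        Nat.cast_zero, zero_mul, zero_mul, smul_zero, add_zero]
      refine Finset.sum_congr rfl fun d _ => ?_
      have hd : ((d : ℂ) + 1) ≠ 0 := Nat.cast_add_one_ne_zero d
      rw [PowerSeries.coeff_log, if_neg (Nat.succ_ne_zero d), neg_pow a d, Nat.add_sub_cancel]
      have : (algebraMap ℚ ℂ) ((-1) ^ (d + 1 + 1) / ((d + 1 : ℕ) : ℚ)) * ((d : ℂ) + 1) =
          (-1) ^ d := by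
        simp only [map_div₀, map_natCast, pow_succ]
        push_cast
        field_simp
      have h2 : (((d + 1 : ℕ) : MvPowerSeries ι ℂ)) = MvPowerSeries.C ((d : ℂ) + 1) := by
        push_cast
        simp
      rw [h2, MvPowerSeries.smul_eq_C_mul, ← mul_assoc, ← mul_assoc, ← map_mul, this]
      simp
    have h3 : F = 1 - (-a) := by rw [ha]; ring
    rw [h1, ← mul_assoc]
    congr 1
    conv_lhs => rw [h3]
    exact mul_neg_geom_sum (-a) N
  have hF0 : MvPowerSeries.constantCoeff F ≠ 0 := by rw [hF]; exact one_ne_zero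
  rw [mul_comm, MvPowerSeries.eq_mul_inv_iff_mul_eq hF0, mul_comm]
  ext e
  -- A derivative looks one degree higher, hence the truncation at `e.degree + 1`. The remainder
  -- then does not reach degree `e`.
  have h4 : MvPowerSeries.coeff e (F * MvPowerSeries.pderiv ℂ i ((PowerSeries.log ℂ).subst a)) =
      MvPowerSeries.coeff e (F * MvPowerSeries.pderiv ℂ i (L (e.degree + 1))) := by
    rw [MvPowerSeries.coeff_mul, MvPowerSeries.coeff_mul]
    refine Finset.sum_congr rfl fun x hx => ?_
    rw [Finset.HasAntidiagonal.mem_antidiagonal] at hx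
    congr 1
    rw [MvPowerSeries.coeff_pderiv, MvPowerSeries.coeff_pderiv, hL (e.degree + 1)]
    rw [← hx]
    simp
  rw [h4, hdL, sub_mul, one_mul, map_sub, sub_eq_self, MvPowerSeries.coeff_mul]
  refine Finset.sum_eq_zero fun x hx => ?_
  rw [Finset.HasAntidiagonal.mem_antidiagonal] at hx
  rw [coeff_pow_eq_zero_of_degree_lt (by rw [map_neg, ha0, neg_zero]), zero_mul]
  rw [← hx]
  simp only [map_add]
  omega

end Series

/-! ## Homogeneous elements -/

section Homogeneous

variable {I : Type} [Fintype I] [DecidableEq I] (p : Bool)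

/-- The homogeneous elements of degree `d`. -/
def homogeneous (d : ℕ) : Submodule ℂ (Alg I p) :=
  Submodule.span ℂ {f | ∃ l : List I, l.length = d ∧ (l.map (Alg.gen p)).prod = f}

variable {p}

theorem prod_mem_homogeneous (l : List I) : (l.map (Alg.gen p)).prod ∈ homogeneous p l.length :=
  Submodule.subset_span ⟨l, rfl, rfl⟩

theorem mul_mem_homogeneous {d e : ℕ} {f h : Alg I p} (hf : f ∈ homogeneous p d)
    (hh : h ∈ homogeneous p e) : f * h ∈ homogeneous p (d + e) := by
  induction hf using Submodule.span_induction with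
  | mem f hf =>
    obtain ⟨l, rfl, rfl⟩ := hf
    induction hh using Submodule.span_induction with
    | mem h hh =>
      obtain ⟨l', rfl, rfl⟩ := hh
      rw [← List.prod_append, ← List.map_append, ← List.length_append]
      exact prod_mem_homogeneous _
    | zero => rw [mul_zero]; exact zero_mem _
    | add _ _ _ _ h1 h2 => rw [mul_add]; exact add_mem h1 h2
    | smul r _ _ h => rw [mul_smul_comm]; exact Submodule.smul_mem _ _ h
  | zero => rw [zero_mul]; exact zero_mem _
  | add _ _ _ _ h1 h2 => rw [add_mul]; exact add_mem h1 h2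
  | smul r _ _ h => rw [smul_mul_assoc]; exact Submodule.smul_mem _ _ h

theorem prod_ofFn_mem_homogeneous {n : ℕ} (d : Fin n → ℕ) (f : Fin n → Alg I p)
    (h : ∀ j, f j ∈ homogeneous p (d j)) :
    (List.ofFn f).prod ∈ homogeneous p (∑ j, d j) := by
  induction n with
  | zero => exact Submodule.subset_span ⟨[], by simp⟩
  | succ n ih =>
    rw [List.ofFn_succ, List.prod_cons, Fin.sum_univ_succ]
    exact mul_mem_homogeneous (h 0) (ih _ _ fun j => h j.succ)

theorem quadratic_mem_homogeneous (g : Matrix I I ℂ) : quadratic p g ∈ homogeneous p 2 :=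
  sum_mem fun a _ => sum_mem fun b _ => Submodule.smul_mem _ _ <|
    Submodule.subset_span ⟨[a, b], rfl, by simp⟩

theorem gen_mul_prod (a : I) (l : List I) :
    Alg.gen p a * (l.map (Alg.gen p)).prod =
      exchangeSign p ^ l.length • ((l.map (Alg.gen p)).prod * Alg.gen p a) := by
  induction l with
  | nil => simp
  | cons b l ih =>
    rw [List.map_cons, List.prod_cons, ← mul_assoc, Alg.gen_mul_gen, smul_mul_assoc, mul_assoc, ih,
      mul_smul_comm, smul_smul, List.length_cons, pow_succ', mul_assoc]

/-- Each generator passes an even number of generators, so the exchange signs cancel. Trace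
invariants have even degree, hence commute even for anticommuting `T`, which the expansion of the
exponential needs. -/
theorem commute_of_even {d e : ℕ} (hd : Even d) {f h : Alg I p} (hf : f ∈ homogeneous p d)
    (hh : h ∈ homogeneous p e) : Commute f h := by
  induction hf using Submodule.span_induction with
  | mem f hf =>
    obtain ⟨l, rfl, rfl⟩ := hf
    induction hh using Submodule.span_induction with
    | mem h hh =>
      obtain ⟨l', rfl, rfl⟩ := hh
      refine Commute.list_prod_right _ _ fun x hx => ?_
      obtain ⟨a, _, rfl⟩ := List.mem_map.1 hx
      obtain ⟨k, hk⟩ := hd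
      refine Commute.symm ?_
      rw [Commute, SemiconjBy, gen_mul_prod, hk, pow_add, ← mul_pow, exchangeSign_mul_self, one_pow,
        one_smul]
    | zero => exact Commute.zero_right _
    | add _ _ _ _ h1 h2 => exact h1.add_right h2
    | smul r _ _ h => exact h.smul_right r
  | zero => exact Commute.zero_left _
  | add _ _ _ _ h1 h2 => exact h1.add_left h2
  | smul r _ _ h => exact h.smul_left r

/-- The Schwinger-Dyson equation of the quadratic invariant. -/
theorem meanLinear_mul_quadratic {g : Matrix I I ℂ} (hg : IsGradedForm p g) {d : ℕ} {f : Alg I p}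
    (hf : f ∈ homogeneous p d) :
    meanLinear p g (f * quadratic p g) =
      (exchangeSign p * Fintype.card I + d) * meanLinear p g f := by
  rw [← (commute_of_even even_two (quadratic_mem_homogeneous g) hf).eq]
  induction hf using Submodule.span_induction with
  | mem f hf =>
    obtain ⟨l, rfl, rfl⟩ := hf
    exact meanLinear_quadratic_mul hg l
  | zero => simp
  | add _ _ _ _ h1 h2 => rw [mul_add, map_add, h1, h2, map_add, mul_add]
  | smul r _ _ h => rw [mul_smul_comm, map_smul, h, map_smul, smul_eq_mul, smul_eq_mul]; ring

end Homogeneous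

namespace Signature

/-! ## The perturbative expansion -/

variable {D : ℕ} (s : Signature D) {ι : Type*} (𝓑 : ι → ColoredGraph D)
  (o : ∀ i, (𝓑 i).Direction)

theorem invariant_mem_homogeneous (B : ColoredGraph D) (o : B.Direction) :
    s.invariant B o ∈ homogeneous s.parity B.order := by
  rw [invariant_eq]
  refine sum_mem fun a _ => Submodule.smul_mem _ _ <| Submodule.subset_span ⟨List.ofFn a, ?_, ?_⟩
  · rw [List.length_ofFn, ColoredGraph.order]
  · rw [List.map_ofFn]
    rfl

/-- The part of the Boltzmann weight that is linear in the coupling constant `i`. -/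
def vertexFactor (i : ι) : s.Obs := (-((𝓑 i).order : ℂ)⁻¹) • s.invariant (𝓑 i) (o i)

theorem vertexFactor_mem_homogeneous (i : ι) :
    s.vertexFactor 𝓑 o i ∈ homogeneous s.parity (𝓑 i).order :=
  Submodule.smul_mem _ _ (s.invariant_mem_homogeneous _ _)

theorem commute_vertexFactor (i j : ι) :
    Commute (s.vertexFactor 𝓑 o i) (s.vertexFactor 𝓑 o j) :=
  commute_of_even ⟨(𝓑 i).k, two_mul _⟩ (s.vertexFactor_mem_homogeneous 𝓑 o i)
    (s.vertexFactor_mem_homogeneous 𝓑 o j)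

theorem isLinearSeries_interaction :
    IsLinearSeries (s.vertexFactor 𝓑 o) (-s.interaction 𝓑 o) := by
  classical
  constructor
  · intro i
    rw [map_neg, vertexFactor, neg_smul]
    congr 1
    refine (Finset.sum_eq_single i (fun j _ hj => if_neg fun h => hj ?_) fun h => ?_).trans
      (if_pos rfl)
    · exact (Finsupp.single_left_injective one_ne_zero h).symm
    · simp at h
  · intro m hm
    rw [map_neg, neg_eq_zero]
    refine Finset.sum_eq_zero fun i _ => if_neg ?_
    rintro rfl
    exact hm (Finsupp.degree_single i 1)

/-- The factorial of the multi-exponent turns a coefficient into an iterated derivative, in which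
each letter of the word inserts one interaction vertex. -/
theorem coeff_integral {n : ℕ} (b : Fin n → ι) (f : s.Obs) :
    multiFactorial (mult b Finset.univ) *
        MvPowerSeries.coeff (mult b Finset.univ) (s.integral 𝓑 o f) =
      s.mean ((List.ofFn fun j => s.vertexFactor 𝓑 o (b j)).prod * f) := by
  rw [← (s.isLinearSeries_interaction 𝓑 o).coeff_formalExp (s.commute_vertexFactor 𝓑 o) b,
    smul_mul_assoc, map_smul, smul_eq_mul]
  congr 1
  exact gaussianMean_eq s.isGradedForm _

theorem ext_of_dcoeff {F G : MvPowerSeries ι ℂ}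
    (h : ∀ (n : ℕ) (b : Fin n → ι),
      multiFactorial (mult b Finset.univ) * MvPowerSeries.coeff (mult b Finset.univ) F =
        multiFactorial (mult b Finset.univ) * MvPowerSeries.coeff (mult b Finset.univ) G) :
    F = G := by
  ext m
  obtain ⟨n, b, rfl⟩ := exists_mult_eq m
  exact mul_left_cancel₀ (multiFactorial_ne_zero _) (h n b)

theorem integral_smul (r : ℂ) (f : s.Obs) : s.integral 𝓑 o (r • f) = r • s.integral 𝓑 o f := by
  refine ext_of_dcoeff fun n b => ?_
  rw [coeff_integral, mul_smul_comm, map_smul, MvPowerSeries.coeff_smul, mul_left_comm,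
    coeff_integral, smul_eq_mul]

theorem constantCoeff_Z : MvPowerSeries.constantCoeff (s.Z 𝓑 o) = 1 := by
  have h := s.coeff_integral 𝓑 o (Fin.elim0 : Fin 0 → ι) 1
  simpa [Z, mult, multiFactorial_zero, mean, meanLinear_one s.isGradedForm] using h

/-- Appending the letter `i` to a word inserts one more vertex of type `i`, and the factor `m i + 1`
of the larger factorial is the one in the derivative. -/
theorem pderiv_Z (i : ι) :
    MvPowerSeries.pderiv ℂ i (s.Z 𝓑 o) = s.integral 𝓑 o (s.vertexFactor 𝓑 o i) := by
  refine ext_of_dcoeff fun n b => ?_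
  have h := s.coeff_integral 𝓑 o (Fin.snoc b i : Fin (n + 1) → ι) 1
  rw [mult_eq_single_add _ (Fin.last n)] at h
  simp only [Fin.succAbove_last, Fin.snoc_castSucc, Fin.snoc_last] at h
  rw [multiFactorial_add_single, List.ofFn_succ'] at h
  simp only [Fin.snoc_castSucc, Fin.snoc_last, List.concat_eq_append, List.prod_append,
    List.prod_singleton, mul_one] at h
  rw [coeff_integral, ← h, MvPowerSeries.coeff_pderiv, Z]
  ring

variable {𝓑} in
theorem integral_invariant {i : ι} (hi : (𝓑 i).order ≠ 0) (o' : (𝓑 i).Direction) :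
    s.integral 𝓑 o (s.invariant (𝓑 i) o') =
      -(((𝓑 i).order : ℂ) • MvPowerSeries.pderiv ℂ i (s.Z 𝓑 o)) := by
  rw [pderiv_Z, vertexFactor, integral_smul, smul_smul, s.invariant_direction _ o' (o i), mul_neg,
    mul_inv_cancel₀ (Nat.cast_ne_zero.2 hi), neg_one_smul, neg_neg]

theorem constantCoeff_Z_ne_zero : MvPowerSeries.constantCoeff (s.Z 𝓑 o) ≠ 0 := by
  rw [constantCoeff_Z]
  exact one_ne_zero

theorem pderiv_lnZ (i : ι) :
    MvPowerSeries.pderiv ℂ i (s.lnZ 𝓑 o) = (s.Z 𝓑 o)⁻¹ * MvPowerSeries.pderiv ℂ i (s.Z 𝓑 o) :=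
  pderiv_log_subst (s.constantCoeff_Z 𝓑 o) i

variable {𝓑} in
theorem expectation_invariant {i : ι} (hi : (𝓑 i).order ≠ 0) (o' : (𝓑 i).Direction) :
    s.expectation 𝓑 o (s.invariant (𝓑 i) o') =
      -(((𝓑 i).order : ℂ) • MvPowerSeries.pderiv ℂ i (s.lnZ 𝓑 o)) := by
  rw [expectation, s.integral_invariant o hi, pderiv_lnZ, mul_neg, mul_smul_comm]

/-! ## The linked cluster theorem -/

section Cluster

variable {α : Type*} [DecidableEq α] (b : α → ι)

theorem dcoeff_Z (J : Finset α) :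
    dcoeff b J (s.Z 𝓑 o) =
      (∏ j ∈ J, -((𝓑 (b j)).order : ℂ)⁻¹) * s.totalOn 𝓑 b J := by
  let e : Fin J.card ≃ J := J.equivFin.symm
  have hm : mult (fun x => b (e x)) Finset.univ = mult b J := by
    rw [mult, mult, ← Finset.sum_coe_sort J]
    exact e.sum_comp fun j : J => Finsupp.single (b j) 1
  have hp : ∏ x, -((𝓑 (b (e x))).order : ℂ)⁻¹ = ∏ j ∈ J, -((𝓑 (b j)).order : ℂ)⁻¹ := by
    rw [← Finset.prod_coe_sort J]
    exact e.prod_comp fun j : J => -((𝓑 (b j)).order : ℂ)⁻¹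
  have h := s.coeff_integral 𝓑 o (fun x => b (e x)) 1
  rw [hm] at h
  rw [dcoeff, Z, h, mul_one, ← hp, totalOn, ← s.totalSum_comp 𝓑 e fun j : J => b j]
  refine Eq.trans ?_ (congrArg _ (s.mean_prod_invariant 𝓑 (fun x => b (e x)) fun x => o (b (e x))))
  rw [← smul_eq_mul, ← map_smul, ← MultilinearMap.mkPiAlgebraFin_apply (R := ℂ),
    ← MultilinearMap.mkPiAlgebraFin_apply (R := ℂ), ← MultilinearMap.map_smul_univ]
  rfl

/-- Read off from the normalization of `Z`; any choice of directions serves. -/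
theorem totalOn_empty : s.totalOn 𝓑 b ∅ = 1 := by
  have h := s.dcoeff_Z 𝓑 (fun i c => (𝓑 i).edges c |>.orient) b ∅
  rw [dcoeff_empty, constantCoeff_Z, Finset.prod_empty, one_mul] at h
  exact h.symm

variable {𝓑} in
-- Linked cluster theorem. Leibniz's rule for `M Z = -|V| ∂Z` and the splitting by the component of
-- `j₀` are the same convolution with the total sums. The convolution is invertible because `Z` has
-- constant term `1`: the summand `S = J` determines the unknown from smaller sets.
theorem dcoeff_expectation (hord : ∀ i, (𝓑 i).order ≠ 0) {J : Finset α} {j₀ : α} (hj : j₀ ∉ J)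
    (o' : (𝓑 (b j₀)).Direction) :
    dcoeff b J (s.expectation 𝓑 o (s.invariant (𝓑 (b j₀)) o')) =
      (∏ j ∈ J, -((𝓑 (b j)).order : ℂ)⁻¹) * s.connectedOn 𝓑 b (insert j₀ J) := by
  set M := s.expectation 𝓑 o (s.invariant (𝓑 (b j₀)) o') with hM
  have hMZ : M * s.Z 𝓑 o = -(((𝓑 (b j₀)).order : ℂ) • MvPowerSeries.pderiv ℂ (b j₀) (s.Z 𝓑 o)) := by
    rw [hM, expectation, mul_right_comm, MvPowerSeries.inv_mul_cancel _ (s.constantCoeff_Z_ne_zero 𝓑 o),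
      one_mul, s.integral_invariant o (hord _)]
  induction J using Finset.strongInduction with
  | H J ih =>
    have h1 := congrArg (dcoeff b J) hMZ
    have h2 : dcoeff b J (-(((𝓑 (b j₀)).order : ℂ) • MvPowerSeries.pderiv ℂ (b j₀) (s.Z 𝓑 o))) =
        (∏ j ∈ J, -((𝓑 (b j)).order : ℂ)⁻¹) * s.totalOn 𝓑 b (insert j₀ J) := by
      have h3 : dcoeff b J (-(((𝓑 (b j₀)).order : ℂ) • MvPowerSeries.pderiv ℂ (b j₀) (s.Z 𝓑 o))) =
          -((𝓑 (b j₀)).order : ℂ) * dcoeff b J (MvPowerSeries.pderiv ℂ (b j₀) (s.Z 𝓑 o)) := by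
        rw [dcoeff, dcoeff, map_neg, MvPowerSeries.coeff_smul]
        ring
      rw [h3, ← dcoeff_insert b hj, dcoeff_Z, Finset.prod_insert hj]
      have := Nat.cast_ne_zero (R := ℂ).2 (hord (b j₀))
      field_simp
    rw [h2, dcoeff_mul, s.totalOn_insert 𝓑 b hj, Finset.mul_sum,
      ← Finset.sum_erase_add _ _ (Finset.mem_powerset_self J),
      ← Finset.sum_erase_add _ _ (Finset.mem_powerset_self J)] at h1
    have h4 : ∀ S ∈ J.powerset.erase J, dcoeff b S M * dcoeff b (J \ S) (s.Z 𝓑 o) =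
        (∏ j ∈ J, -((𝓑 (b j)).order : ℂ)⁻¹) *
          (s.connectedOn 𝓑 b (insert j₀ S) * s.totalOn 𝓑 b (J \ S)) := by
      intro S hS
      rw [Finset.mem_erase, Finset.mem_powerset] at hS
      rw [ih S (Finset.ssubset_iff_subset_ne.2 ⟨hS.2, hS.1⟩) fun h => hj (hS.2 h), dcoeff_Z,
        ← Finset.prod_sdiff hS.2]
      ring
    rw [Finset.sum_congr rfl h4, add_right_inj, Finset.sdiff_self, totalOn_empty, dcoeff_empty,
      constantCoeff_Z, mul_one, mul_one] at h1
    exact h1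

end Cluster

/-! ## The quadratic invariant -/

theorem exchangeSign_mul_card :
    exchangeSign s.parity * Fintype.card s.Index =
      ∏ c, ((-1) ^ (s.odd c).toNat * (s.N c : ℂ)) := by
  rw [s.exchangeSign_parity, Finset.prod_mul_distrib]
  congr 1
  · exact Finset.prod_congr rfl fun c _ => exchangeSign_eq_pow _
  · rw [Fintype.card_pi]
    push_cast
    exact Finset.prod_congr rfl fun c _ => by rw [Fintype.card_fin]

/-- The coefficient of `λ^m` is the mean of a homogeneous element whose degree is the total number
of vertices of its bubbles. The Schwinger-Dyson equation multiplies it by the signed number of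
components plus this degree. -/
theorem coeff_integral_quadraticInvariant (m : ι →₀ ℕ) :
    MvPowerSeries.coeff m (s.integral 𝓑 o s.quadraticInvariant) =
      (∏ c, ((-1) ^ (s.odd c).toNat * (s.N c : ℂ)) +
        ∑ i ∈ m.support, m i * ((𝓑 i).order : ℂ)) * MvPowerSeries.coeff m (s.Z 𝓑 o) := by
  obtain ⟨n, b, rfl⟩ := exists_mult_eq m
  refine mul_left_cancel₀ (multiFactorial_ne_zero (mult b Finset.univ)) ?_
  rw [coeff_integral, mul_left_comm, Z, coeff_integral, mul_one, mean, quadraticInvariant,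
    meanLinear_mul_quadratic s.isGradedForm (prod_ofFn_mem_homogeneous (fun j => (𝓑 (b j)).order) _
      fun j => s.vertexFactor_mem_homogeneous 𝓑 o (b j)), exchangeSign_mul_card]
  congr 2
  rw [Nat.cast_sum, ← sum_mult b Finset.univ fun i => ((𝓑 i).order : ℂ)]
  exact Finset.sum_congr rfl fun i _ => nsmul_eq_mul _ _

theorem coeff_X_mul_pderiv (F : MvPowerSeries ι ℂ) (i : ι) (m : ι →₀ ℕ) :
    MvPowerSeries.coeff m (MvPowerSeries.X i * MvPowerSeries.pderiv ℂ i F) =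
      m i * MvPowerSeries.coeff m F := by
  classical
  by_cases hi : m i = 0
  · rw [hi, Nat.cast_zero, zero_mul, MvPowerSeries.X, MvPowerSeries.coeff_monomial_mul, if_neg]
    simp [hi]
  · have hle : Finsupp.single i 1 ≤ m := Finsupp.single_le_iff.2 (Nat.one_le_iff_ne_zero.2 hi)
    obtain ⟨m', rfl⟩ := exists_add_of_le hle
    rw [MvPowerSeries.X, MvPowerSeries.coeff_add_monomial_mul, one_mul, MvPowerSeries.coeff_pderiv,
      add_comm m']
    simp
    ring

/-- Convergence is coefficientwise: only the finitely many `i` in the support of `m` contribute to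
the coefficient of `λ^m`, even if the family of bubbles is infinite. -/
theorem hasSum_X_mul_pderiv_Z :
    HasSum (fun i => MvPowerSeries.X i *
        (((𝓑 i).order : ℂ) • MvPowerSeries.pderiv ℂ i (s.Z 𝓑 o)))
      (s.integral 𝓑 o s.quadraticInvariant -
        MvPowerSeries.C (∏ c, ((-1) ^ (s.odd c).toNat * (s.N c : ℂ))) * s.Z 𝓑 o) := by
  rw [MvPowerSeries.WithPiTopology.hasSum_iff_hasSum_coeff]
  intro m
  have h (i : ι) : MvPowerSeries.coeff m (MvPowerSeries.X i *
        (((𝓑 i).order : ℂ) • MvPowerSeries.pderiv ℂ i (s.Z 𝓑 o))) =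
      m i * ((𝓑 i).order : ℂ) * MvPowerSeries.coeff m (s.Z 𝓑 o) := by
    rw [mul_smul_comm, MvPowerSeries.coeff_smul, coeff_X_mul_pderiv]
    ring
  simp only [h]
  rw [map_sub, MvPowerSeries.coeff_C_mul, coeff_integral_quadraticInvariant, add_mul,
    add_sub_cancel_left, Finset.sum_mul]
  refine hasSum_sum_of_ne_finset_zero fun i hi => ?_
  rw [Finsupp.notMem_support_iff.1 hi, Nat.cast_zero, zero_mul, zero_mul]

theorem hasSum_X_mul_pderiv_lnZ :
    HasSum (fun i => MvPowerSeries.X i *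
        (((𝓑 i).order : ℂ) • MvPowerSeries.pderiv ℂ i (s.lnZ 𝓑 o)))
      (s.expectation 𝓑 o s.quadraticInvariant -
        MvPowerSeries.C (∏ c, ((-1) ^ (s.odd c).toNat * (s.N c : ℂ)))) := by
  have h := (s.hasSum_X_mul_pderiv_Z 𝓑 o).mul_left (s.Z 𝓑 o)⁻¹
  rw [mul_sub, mul_left_comm, MvPowerSeries.inv_mul_cancel _ (s.constantCoeff_Z_ne_zero 𝓑 o),
    mul_one] at h
  refine h.congr_fun fun i => ?_
  rw [pderiv_lnZ, mul_smul_comm, mul_smul_comm, mul_smul_comm, mul_left_comm]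

end Signature

/-! ## Words with given multiplicities -/

theorem exists_equiv_of_mult_eq {ι J J' : Type*} [Fintype J] [Fintype J'] (b : J → ι)
    (b' : J' → ι) (h : mult b Finset.univ = mult b' Finset.univ) : ∃ e : J ≃ J', b' ∘ e = b := by
  classical
  have hc (i : ι) : Fintype.card {j // b j = i} = Fintype.card {j // b' j = i} := by
    rw [Fintype.card_subtype, Fintype.card_subtype, ← mult_apply b, ← mult_apply b', h]
  exact ⟨Equiv.ofFiberEquiv fun i => Fintype.equivOfCardEq (hc i),
    funext fun j => Equiv.ofFiberEquiv_map _ j⟩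

theorem mult_comp {ι J J' : Type*} [Fintype J] [Fintype J'] (e : J ≃ J') (b : J' → ι) :
    mult (b ∘ e) Finset.univ = mult b Finset.univ :=
  e.sum_comp fun j => Finsupp.single (b j) 1

theorem card_stabilizer {ι : Type*} {n : ℕ} (b : Fin n → ι) :
    (Nat.card {e : Equiv.Perm (Fin n) // b ∘ e = b} : ℂ) = multiFactorial (mult b Finset.univ) := by
  classical
  rw [Nat.card_eq_fintype_card, DomMulAct.stabilizer_card', multiFactorial, Finsupp.prod]
  push_cast
  refine Finset.prod_congr ?_ fun i _ => ?_
  · ext i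
    rw [Finsupp.mem_support_iff, mult_apply, Finset.card_ne_zero, Finset.filter_nonempty_iff]
    simp
  · rw [mult_apply, Fintype.card_subtype]

instance {ι : Type*} {n : ℕ} (m : ι →₀ ℕ) :
    Finite {b : Fin n → ι // mult b Finset.univ = m} := by
  classical
  refine Finite.of_injective (β := Fin n → m.support)
    (fun b j => ⟨b.1 j, ?_⟩) fun b b' h => Subtype.ext (funext fun j => ?_)
  · have h := mult_apply b.1 Finset.univ (b.1 j)
    rw [b.2] at h
    rw [Finsupp.mem_support_iff, h, Finset.card_ne_zero]
    exact ⟨j, by simp⟩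
  · exact congrArg Subtype.val (congrFun h j)

/-- Orbit-stabilizer for permutations acting on words: the words with given multiplicities form one
orbit, and the stabilizer has order the product of the factorials. The chosen `e` are coset
representatives. -/
theorem card_words_mul {ι : Type*} {n : ℕ} (b : Fin n → ι) :
    (Nat.card {b' : Fin n → ι // mult b' Finset.univ = mult b Finset.univ} : ℂ) *
      multiFactorial (mult b Finset.univ) = n.factorial := by
  have hn : n.factorial = Nat.card (Equiv.Perm (Fin n)) := by
    rw [Nat.card_perm, Nat.card_fin]
  rw [← card_stabilizer, hn, ← Nat.cast_mul, ← Nat.card_prod]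
  congr 1
  choose e he using fun b' : {b' : Fin n → ι // mult b' Finset.univ = mult b Finset.univ} =>
    exists_equiv_of_mult_eq b'.1 b b'.2
  refine Nat.card_congr
    { toFun := fun x => (e x.1).trans x.2.1
      invFun := fun σ => (⟨b ∘ σ, mult_comp σ b⟩, ⟨(e ⟨b ∘ σ, mult_comp σ b⟩).symm.trans σ, ?_⟩)
      left_inv := fun x => ?_
      right_inv := fun σ => ?_ }
  · funext j
    have := congrFun (he ⟨b ∘ σ, mult_comp σ b⟩) ((e ⟨b ∘ σ, mult_comp σ b⟩).symm j)
    simpa using this.symm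
  · obtain ⟨b', σ, hσ⟩ := x
    have hb : (⟨b ∘ (e b').trans σ, mult_comp _ b⟩ :
        {b' : Fin n → ι // mult b' Finset.univ = mult b Finset.univ}) = b' := by
      refine Subtype.ext ?_
      show (b ∘ σ) ∘ e b' = b'.1
      rw [hσ, he]
    refine Prod.ext hb (Subtype.ext (Equiv.ext fun j => ?_))
    simp only [hb, Equiv.trans_apply, Equiv.apply_symm_apply]
  · ext j
    simp

theorem mult_insertNth {ι : Type*} {n : ℕ} (j : Fin (n + 1)) (i : ι) (b : Fin n → ι) :
    mult (j.insertNth i b : Fin (n + 1) → ι) (Finset.univ.erase j) = mult b Finset.univ := by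
  rw [Fin.univ_succAbove n j, Finset.erase_cons, mult_map]
  congr 1
  funext x
  simp

theorem mult_insertNth_univ {ι : Type*} {n : ℕ} (j : Fin (n + 1)) (i : ι) (b : Fin n → ι) :
    mult (j.insertNth i b : Fin (n + 1) → ι) Finset.univ =
      mult b Finset.univ + Finsupp.single i 1 := by
  rw [mult_eq_single_add _ j]
  simp

theorem prod_C_mul_X {ι α : Type*} (J : Finset α) (w : α → ℂ) (b : α → ι) :
    ∏ j ∈ J, MvPowerSeries.C (w j) * MvPowerSeries.X (b j) =
      MvPowerSeries.monomial (mult b J) (∏ j ∈ J, w j) := by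
  classical
  induction J using Finset.induction_on with
  | empty => simp [mult]
  | insert j J hj ih =>
    rw [Finset.prod_insert hj, Finset.prod_insert hj, ih, mult_insert b hj, MvPowerSeries.X,
      ← MvPowerSeries.monomial_zero_eq_C_apply, MvPowerSeries.monomial_mul_monomial,
      MvPowerSeries.monomial_mul_monomial, zero_add, mul_one, add_comm]

/-! ## Connected Feynman graphs -/

section Graph

theorem reachable_fromRel {V : Type*} {r : V → V → Prop} {v w : V}
    (h : (SimpleGraph.fromRel r).Reachable v w) (q : V → Prop) (hq : ∀ x y, r x y → (q x ↔ q y))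
    (hv : q v) : q w := by
  rw [SimpleGraph.reachable_iff_reflTransGen] at h
  induction h with
  | refl => exact hv
  | tail _ h ih =>
    rcases ((SimpleGraph.fromRel_adj _ _ _).1 h).2 with h | h
    · exact (hq _ _ h).1 ih
    · exact (hq _ _ h).2 ih

theorem reachable_of_rel {V : Type*} {r : V → V → Prop} {v w : V} (h : r v w) :
    (SimpleGraph.fromRel r).Reachable v w := by
  by_cases hvw : v = w
  · rw [hvw]
  · exact SimpleGraph.Adj.reachable ((SimpleGraph.fromRel_adj _ _ _).2 ⟨hvw, Or.inl h⟩)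

variable {D : ℕ} {ι : Type*} {𝓑 : ι → ColoredGraph D}

/-- Each bubble is connected, so only the color-`0` edges between bubbles matter. The condition `0 <
n` is there because a connected graph must be nonempty, while `IsConn` holds vacuously without
bubbles. -/
theorem connected_iff_isConn (hconn : ∀ i, (𝓑 i).Connected) {n : ℕ} (b : Fin n → ι)
    (P : Pairing (Signature.BubbleVertex 𝓑 b)) :
    (⟨n, b, P⟩ : FeynmanGraph 𝓑).Connected ↔ Signature.IsConn 𝓑 P ∧ 0 < n := by
  rw [FeynmanGraph.Connected]
  set r : Signature.BubbleVertex 𝓑 b → Signature.BubbleVertex 𝓑 b → Prop := fun v w =>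
    P.mate v = w ∨ ∃ c, ((⟨n, b, P⟩ : FeynmanGraph 𝓑).edges c).mate v = w with hr
  have hne (j : Fin n) : Nonempty (Fin (2 * (𝓑 (b j)).k)) := (hconn (b j)).nonempty
  constructor
  · intro h
    refine ⟨fun q hq ⟨j, hj⟩ j' => ?_, ?_⟩
    · obtain ⟨x⟩ := hne j
      obtain ⟨x'⟩ := hne j'
      refine reachable_fromRel (h.preconnected ⟨j, x⟩ ⟨j', x'⟩) (fun v => q v.1) ?_ hj
      rintro v w (rfl | ⟨c, rfl⟩)
      · exact ⟨hq v, fun h => by simpa only [P.mate_mate] using hq _ h⟩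
      · exact Iff.rfl
    · obtain ⟨v⟩ := h.nonempty
      exact v.1.pos
  · rintro ⟨h, hn⟩
    have hin (j : Fin n) (x y : Fin (2 * (𝓑 (b j)).k)) :
        (SimpleGraph.fromRel r).Reachable ⟨j, x⟩ ⟨j, y⟩ := by
      refine reachable_fromRel ((hconn (b j)).preconnected x y)
        (fun y => (SimpleGraph.fromRel r).Reachable ⟨j, x⟩ ⟨j, y⟩) ?_ (SimpleGraph.Reachable.refl _)
      rintro y z ⟨c, rfl⟩
      have hyz : (SimpleGraph.fromRel r).Reachable ⟨j, y⟩ ⟨j, ((𝓑 (b j)).edges c).mate y⟩ :=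
        reachable_of_rel (Or.inr ⟨c, rfl⟩)
      exact ⟨fun h => h.trans hyz, fun h => h.trans hyz.symm⟩
    refine (SimpleGraph.connected_iff _).2 ⟨fun v w => ?_, ?_⟩
    · refine h (fun j => ∀ x, (SimpleGraph.fromRel r).Reachable v ⟨j, x⟩) ?_
        ⟨v.1, fun x => hin v.1 v.2 x⟩ w.1 w.2
      intro y hy x
      have hym : (SimpleGraph.fromRel r).Reachable y (P.mate y) := reachable_of_rel (Or.inl rfl)
      exact ((hy y.2).trans hym).trans (hin _ _ _)
    · obtain ⟨x⟩ := hne ⟨0, hn⟩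
      exact ⟨⟨⟨0, hn⟩, x⟩⟩

theorem MarkedGraph.coeff_term {i : ι} (G : MarkedGraph 𝓑 i) (s : Signature D) (m : ι →₀ ℕ)
    [Decidable (m = mult G.bubble (Finset.univ.erase G.marked))] :
    MvPowerSeries.coeff m (G.term s) =
      if m = mult G.bubble (Finset.univ.erase G.marked) then
        (G.n.factorial : ℂ)⁻¹ * (∏ j ∈ Finset.univ.erase G.marked, -((𝓑 (G.bubble j)).order : ℂ)⁻¹) *
          G.faceWeight s
      else 0 := by
  classical
  rw [term, prod_C_mul_X, MvPowerSeries.coeff_mul_C, MvPowerSeries.coeff_C_mul,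
    MvPowerSeries.coeff_monomial]
  split_ifs <;> simp

/-- The connected graphs with a given number of bubbles. -/
abbrev JoinedGraph (𝓑 : ι → ColoredGraph D) (i : ι) (n : ℕ) (m : ι →₀ ℕ) : Type _ :=
  Σ (j : Fin (n + 1)) (b : {b : Fin n → ι // mult b Finset.univ = m}),
    {P : Pairing (Signature.BubbleVertex 𝓑 (j.insertNth i b.1 : Fin (n + 1) → ι)) //
      Signature.IsConn 𝓑 P}

/-- The marked graph of a connected way to join a family of bubbles. -/
def JoinedGraph.toMarkedGraph (hconn : ∀ i, (𝓑 i).Connected) {i : ι} {n : ℕ} {m : ι →₀ ℕ} (x : JoinedGraph 𝓑 i n m) :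
    MarkedGraph 𝓑 i where
  n := n + 1
  bubble := x.1.insertNth i x.2.1.1
  edges0 := x.2.2.1
  connected := (connected_iff_isConn hconn _ _).2 ⟨x.2.2.2, n.succ_pos⟩
  marked := x.1
  bubble_marked := Fin.insertNth_apply_same _ _ _

theorem JoinedGraph.toMarkedGraph_injective (hconn : ∀ i, (𝓑 i).Connected) {i : ι} {n : ℕ}
    {m : ι →₀ ℕ} :
    Function.Injective (toMarkedGraph hconn : JoinedGraph 𝓑 i n m → MarkedGraph 𝓑 i) := by
  rintro ⟨j, ⟨b, hb⟩, ⟨P, hP⟩⟩ ⟨j', ⟨b', hb'⟩, ⟨P', hP'⟩⟩ h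
  simp only [toMarkedGraph, MarkedGraph.mk.injEq, FeynmanGraph.mk.injEq, true_and, heq_eq_eq] at h
  obtain ⟨⟨h1, h2⟩, rfl⟩ := h
  obtain rfl := Fin.insertNth_right_injective (α := fun _ => ι) i h1
  obtain rfl := eq_of_heq h2
  rfl

theorem JoinedGraph.mem_range_toMarkedGraph (hconn : ∀ i, (𝓑 i).Connected) {i : ι} {n : ℕ}
    {m : ι →₀ ℕ} (hm : m.degree = n)
    (G : MarkedGraph 𝓑 i) (hG : m = mult G.bubble (Finset.univ.erase G.marked)) :
    G ∈ Set.range (toMarkedGraph hconn : JoinedGraph 𝓑 i n m → MarkedGraph 𝓑 i) := by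
  obtain ⟨⟨N, bubble, P⟩, hc, (j : Fin N), (hj : bubble j = i)⟩ := G
  change m = mult bubble (Finset.univ.erase j) at hG
  -- The marked bubble carries no coupling constant, so a monomial of degree `n` comes from graphs
  -- with `n + 1` bubbles.
  obtain rfl : N = n + 1 := by
    rw [hG, degree_mult, Finset.card_erase_of_mem (Finset.mem_univ _), Finset.card_univ,
      Fintype.card_fin] at hm
    have : 0 < N := j.pos
    change N - 1 = n at hm
    omega
  obtain ⟨b, rfl⟩ : ∃ b : Fin n → ι, (j.insertNth i b : Fin (n + 1) → ι) = bubble := by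
    subst hj
    exact ⟨_, Fin.insertNth_self_removeNth j bubble⟩
  rw [mult_insertNth] at hG
  exact ⟨⟨j, ⟨b, hG.symm⟩, ⟨P, ((connected_iff_isConn hconn _ _).1 hc).1⟩⟩, rfl⟩

end Graph

/-! ### Summation over marked graphs and the symmetry factors. -/

namespace Signature

variable {D : ℕ} (s : Signature D) {ι : Type*} {𝓑 : ι → ColoredGraph D}

theorem connectedSum_congr {J J' : Type*} [Fintype J] [Fintype J'] (b : J → ι) (b' : J' → ι)
    (h : mult b Finset.univ = mult b' Finset.univ) : s.connectedSum 𝓑 b = s.connectedSum 𝓑 b' := by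
  obtain ⟨e, rfl⟩ := exists_equiv_of_mult_eq b b' h
  exact s.connectedSum_comp 𝓑 e b'

theorem prod_congr_mult {J J' : Type*} [Fintype J] [Fintype J'] (b : J → ι) (b' : J' → ι)
    (h : mult b Finset.univ = mult b' Finset.univ) (w : ι → ℂ) : ∏ j, w (b j) = ∏ j, w (b' j) := by
  obtain ⟨e, rfl⟩ := exists_equiv_of_mult_eq b b' h
  exact e.prod_comp fun j => w (b' j)

theorem coeff_expectation_invariant (o : ∀ i, (𝓑 i).Direction) (hord : ∀ i, (𝓑 i).order ≠ 0)
    {n : ℕ} (b : Fin n → ι) {i : ι} (o' : (𝓑 i).Direction) :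
    multiFactorial (mult b Finset.univ) * MvPowerSeries.coeff (mult b Finset.univ)
        (s.expectation 𝓑 o (s.invariant (𝓑 i) o')) =
      (∏ j, -((𝓑 (b j)).order : ℂ)⁻¹) *
        s.connectedSum 𝓑 ((0 : Fin (n + 1)).insertNth i b : Fin (n + 1) → ι) := by
  -- The marked bubble gets label `0`, and the remaining labels are the variables of
  -- differentiation.
  obtain ⟨c, rfl, rfl⟩ : ∃ c : Fin (n + 1) → ι, c 0 = i ∧ (fun j : Fin n => c j.succ) = b :=
    ⟨Fin.cons i b, rfl, rfl⟩
  have h := s.dcoeff_expectation o c hord (J := Finset.univ.erase 0) (Finset.notMem_erase 0 _) o'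
  have hJ : Finset.univ.erase (0 : Fin (n + 1)) = Finset.univ.map (Fin.succEmb n) := by
    rw [Fin.univ_succ, Finset.erase_cons]
    rfl
  have hm : mult c (Finset.univ.erase 0) = mult (fun j : Fin n => c j.succ) Finset.univ := by
    rw [hJ, mult_map]
    rfl
  rw [dcoeff, hm, Finset.insert_erase (Finset.mem_univ _), hJ, Finset.prod_map, connectedOn] at h
  refine h.trans (congrArg _ (s.connectedSum_congr _ _ ?_))
  rw [mult_insertNth_univ]
  refine Eq.trans ?_ (mult_eq_single_add c 0)
  exact Finset.sum_attach Finset.univ fun j => Finsupp.single (c j) 1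

theorem prod_erase_insertNth {n : ℕ} (j : Fin (n + 1)) (i : ι) (b : Fin n → ι) (w : ι → ℂ) :
    ∏ x ∈ Finset.univ.erase j, w ((j.insertNth i b : Fin (n + 1) → ι) x) = ∏ x, w (b x) := by
  rw [Fin.univ_succAbove n j, Finset.erase_cons, Finset.prod_map]
  simp

theorem coeff_term_toMarkedGraph (hconn : ∀ i, (𝓑 i).Connected) {i : ι} {n : ℕ} (b : Fin n → ι)
    (x : JoinedGraph 𝓑 i n (mult b Finset.univ)) :
    MvPowerSeries.coeff (mult b Finset.univ) ((x.toMarkedGraph hconn).term s) =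
      ((n + 1).factorial : ℂ)⁻¹ * ((∏ j, -((𝓑 (b j)).order : ℂ)⁻¹) *
        s.amplitude 𝓑 (x.1.insertNth i x.2.1.1 : Fin (n + 1) → ι) x.2.2.1) := by
  classical
  obtain ⟨j, ⟨b', hb'⟩, ⟨P, hP⟩⟩ := x
  rw [MarkedGraph.coeff_term]
  refine (if_pos (hb'.symm.trans (mult_insertNth j i b').symm)).trans ?_
  rw [prod_congr_mult b b' hb'.symm fun i => -((𝓑 i).order : ℂ)⁻¹,
    ← prod_erase_insertNth j i b' fun i => -((𝓑 i).order : ℂ)⁻¹, mul_assoc]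
  rfl

/-- The connected sum depends only on the multiplicities of the bubbles, so every position of the
marked bubble and every word for the others contributes equally. -/
theorem sum_joinedGraph {i : ι} {n : ℕ} (b : Fin n → ι)
    [hfin : Fintype (JoinedGraph 𝓑 i n (mult b Finset.univ))] :
    ∑ x : JoinedGraph 𝓑 i n (mult b Finset.univ),
        s.amplitude 𝓑 (x.1.insertNth i x.2.1.1 : Fin (n + 1) → ι) x.2.2.1 =
      (n + 1) * (Nat.card {b' : Fin n → ι // mult b' Finset.univ = mult b Finset.univ} *
        s.connectedSum 𝓑 ((0 : Fin (n + 1)).insertNth i b : Fin (n + 1) → ι)) := by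
  classical
  cases nonempty_fintype {b' : Fin n → ι // mult b' Finset.univ = mult b Finset.univ}
  have hK (j : Fin (n + 1)) (b' : {b' : Fin n → ι // mult b' Finset.univ = mult b Finset.univ}) :
      ∑ P : {P : Pairing (BubbleVertex 𝓑 (j.insertNth i b'.1 : Fin (n + 1) → ι)) // IsConn 𝓑 P},
        s.amplitude 𝓑 (j.insertNth i b'.1 : Fin (n + 1) → ι) P.1 =
      s.connectedSum 𝓑 ((0 : Fin (n + 1)).insertNth i b : Fin (n + 1) → ι) := by
    rw [← s.connectedSum_congr (j.insertNth i b'.1 : Fin (n + 1) → ι), connectedSum]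
    · exact (Finset.sum_subtype _ (fun P => by simp) _).symm
    · rw [mult_insertNth_univ, mult_insertNth_univ, b'.2]
  trans ∑ j : Fin (n + 1), ∑ b' : {b' : Fin n → ι // mult b' Finset.univ = mult b Finset.univ},
    ∑ P : {P : Pairing (BubbleVertex 𝓑 (j.insertNth i b'.1 : Fin (n + 1) → ι)) // IsConn 𝓑 P},
        s.amplitude 𝓑 (j.insertNth i b'.1 : Fin (n + 1) → ι) P.1
  · obtain rfl : hfin = Sigma.instFintype := Subsingleton.elim _ _
    rw [Fintype.sum_sigma]
    exact Finset.sum_congr rfl fun j _ => Fintype.sum_sigma _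
  · simp only [hK]
    rw [Finset.sum_const, Finset.sum_const, Finset.card_univ, Finset.card_univ, Fintype.card_fin,
      ← Nat.card_eq_fintype_card, nsmul_eq_mul, nsmul_eq_mul]
    push_cast
    rfl

theorem hasSum_term (o : ∀ i, (𝓑 i).Direction) (hconn : ∀ i, (𝓑 i).Connected)
    (hord : ∀ i, (𝓑 i).order ≠ 0) (i : ι) (o' : (𝓑 i).Direction) :
    HasSum (fun G : MarkedGraph 𝓑 i => G.term s) (s.expectation 𝓑 o (s.invariant (𝓑 i) o')) := by
  classical
  rw [MvPowerSeries.WithPiTopology.hasSum_iff_hasSum_coeff]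
  intro m
  obtain ⟨n, b, rfl⟩ := exists_mult_eq m
  have hm : (mult b Finset.univ).degree = n := by
    rw [degree_mult, Finset.card_univ, Fintype.card_fin]
  rw [← (JoinedGraph.toMarkedGraph_injective hconn (i := i) (n := n)
    (m := mult b Finset.univ)).hasSum_iff fun G hG => (G.coeff_term s _).trans <|
      if_neg fun h => hG (JoinedGraph.mem_range_toMarkedGraph hconn hm G h)]
  -- Only these finitely many graphs contribute to the coefficient of `λ^m`. There are `n + 1`
  -- positions of the mark and `n! / m!` words, so the weight `1 / (n + 1)!` becomes the `1 / m!` of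
  -- the coefficient.
  cases nonempty_fintype (JoinedGraph 𝓑 i n (mult b Finset.univ))
  have h0 : MvPowerSeries.coeff (mult b Finset.univ)
      (s.expectation 𝓑 o (s.invariant (𝓑 i) o')) =
      ∑ x : JoinedGraph 𝓑 i n (mult b Finset.univ),
        MvPowerSeries.coeff (mult b Finset.univ) ((x.toMarkedGraph hconn).term s) := by
    simp only [s.coeff_term_toMarkedGraph hconn b]
    rw [← Finset.mul_sum, ← Finset.mul_sum, s.sum_joinedGraph b]
    refine mul_left_cancel₀ (multiFactorial_ne_zero (mult b Finset.univ)) ?_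
    rw [s.coeff_expectation_invariant o hord b o', Nat.factorial_succ]
    have h1 := card_words_mul b
    have h2 : (n.factorial : ℂ) ≠ 0 := Nat.cast_ne_zero.2 (Nat.factorial_ne_zero n)
    have h3 : ((n : ℂ) + 1) ≠ 0 := Nat.cast_add_one_ne_zero n
    push_cast
    field_simp
    rw [← h1]
    ring
  rw [h0]
  exact hasSum_fintype _

end Signature

end GradedTensor

end

/-! ### The theorem. -/

theorem mainTheorem4 {D : ℕ} (s : GradedTensor.Signature D) {ι : Type*}
    (𝓑 : ι → GradedTensor.ColoredGraph D) (o : ∀ i, (𝓑 i).Direction)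
    (hconn : ∀ i, (𝓑 i).Connected) (horder : ∀ i, 2 < (𝓑 i).order) :
    MvPowerSeries.constantCoeff (s.Z 𝓑 o) = 1 ∧
    (∀ (i : ι) (o' : (𝓑 i).Direction),
      s.expectation 𝓑 o (s.invariant (𝓑 i) o') =
          -(((𝓑 i).order : ℂ) • MvPowerSeries.pderiv ℂ i (s.lnZ 𝓑 o)) ∧
        HasSum (fun G : GradedTensor.MarkedGraph 𝓑 i => G.term s)
          (s.expectation 𝓑 o (s.invariant (𝓑 i) o'))) ∧
    ∃ E : MvPowerSeries ι ℂ,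
      HasSum (fun i : ι => MvPowerSeries.X i *
          (((𝓑 i).order : ℂ) • MvPowerSeries.pderiv ℂ i (s.lnZ 𝓑 o))) E ∧
        s.expectation 𝓑 o s.quadraticInvariant =
          MvPowerSeries.C (∏ c, ((-1) ^ (s.odd c).toNat * (s.N c : ℂ))) + E := by
  have hord (i : ι) : (𝓑 i).order ≠ 0 := (lt_trans two_pos (horder i)).ne'
  refine ⟨s.constantCoeff_Z 𝓑 o, fun i o' => ⟨s.expectation_invariant o (hord i) o',
    s.hasSum_term o hconn hord i o'⟩, _, s.hasSum_X_mul_pderiv_lnZ 𝓑 o, ?_⟩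
  rw [add_sub_cancel]
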